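/- Let $b\ge 2$, $\beta\ge 0$, $h\in\mathbb R$, and let $\mathbb T^b$ be the infinite rooted $b$-ary tree. For a spin configuration $\tau$ on $\mathbb T^b$ and a complete finite subtree $T\subset\mathbb T^b$ (a vertex $v$ and all its descendants up to $m\ge 0$ levels below it), let $\partial T$ be the set of children of the leaves of $T$, and let $\Omega=\Omega_T^\tau$ be the set of $\sigma\in\{\pm1\}^{T\cup\partial T}$ that agree with $\tau$ on $\partial T$. For $A\subseteq T$ let $\partial A$ be the set of neighbours of $A$ in $(T\cup\partial T)\setminus A$. For $\eta\in\Omega$ let $\mu_A^\eta$ be the Ising Gibbs distribution on the $\sigma\in\Omega$ that agree with $\eta$ outside $A$, with weights $\exp[\beta(\sum_{xy\in E(A\cup\partial A)}\sigma_x\sigma_y+h\sum_{x\in A}\sigma_x)]$. Write $\mu=\mu_T^\tau$ for the case $A=T$, $\mu_A(f)$ for the function $\eta\mapsto\mu_A^\eta(f)$, and $\mathrm{Ent}_A^\eta(f)=\mu_A^\eta(f\log f)-\mu_A^\eta(f)\log\mu_A^\eta(f)$ for $f\ge0$; $\mathrm{Ent}$ without indices is taken with respect to $\mu$. For $x\in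 T$ let $T_x$ be the part of $T$ formed by $x$ and its descendants, $\widetilde{T_x}=T_x\setminus\{x\}$, and let $B_{x,\ell}$ be the set of the first $\ell$ levels of $T_x$. Define $$p_{\min}=\min_{x\in T,\ s=\pm1,\ \eta\in\Omega}\mu^\eta_{T_x}(\sigma_x=s),\qquad \mathcal E_\ell(f)=\sum_{x\in T}\mu[\mathrm{Ent}_{B_{x,\ell}}(f)],\qquad c_{\mathrm{sob}}(\mu)=\inf_{f}\frac{\mathcal D(\sqrt f)}{\mathrm{Ent}(f)},$$ where the infimum is over non-constant $f\ge0$ on $\Omega$ and $\mathcal D(g)=\frac12\sum_{x\in T}\mu\big(c_x[g(\sigma^x)-g(\sigma)]^2\big)$ is the Dirichlet form of the heat-bath Glauber dynamics ($\sigma^x$ is $\sigma$ with the spin at $x$ flipped, and $c_x(\sigma)=\mu_{\{x\}}^\sigma(\sigma^x)$). Say that $\mu$ satisfies $\mathrm{EM}(\ell,\varepsilon)$ if for every $x\in T$, every $\eta\in\Omega$ and every $f\ge0$ on $\Omega$ that does not depend on the spins in $B_{x,\ell}$, $$\mathrm{Ent}^\eta_{T_x}[\mu_{\widetilde{T_x}}(f)]\le\varepsilon\,\mathrm{Ent}^\eta_{T_x}(f).$$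 **Theorem.** (i) For all $\tau$, $T$, $\ell$ and $0<\delta\le1$: if $\mu=\mu_T^\tau$ satisfies $\mathrm{EM}\big(\ell,[(1-\delta)p_{\min}/(\ell+1-\delta)]^2\big)$, then $\mathrm{Ent}(f)\le\frac2\delta\,\mathcal E_\ell(f)$ for all $f\ge0$ on $\Omega$. (ii) For all $\ell$ and $0<\delta\le1$ there is a constant $C>0$, depending only on $b,\beta,h,\ell,\delta$, such that for all $\tau$ and $T$ for which the hypothesis of (i) holds, $c_{\mathrm{sob}}(\mu_T^\tau)\ge1/C$. In particular, if for a fixed $\tau$ that hypothesis holds, with these $\ell,\delta$, for all complete finite subtrees $T$, then $c_{\mathrm{sob}}(\mu_T^\tau)=\Omega(1)$, i.e. it is bounded below by a positive constant independent of $T$. (iii) Conversely, for every $C>0$ there are constants $c,\theta>0$, depending only on $b,\beta,h,C$, such that for all $\tau$ and $T$ with $c_{\mathrm{sob}}(\mu_T^\tau)\ge1/C$, the measure $\mu_T^\tau$ satisfies $\mathrm{EM}(\ell,c\,e^{-\theta\ell})$ for all $\ell$. In particular, if for a fixed $\tau$ one has $c_{\mathrm{sob}}(\mu_T^\tau)=\Omega(1)$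 over all complete finite subtrees $T$, then for some $c,\theta>0$ every $\mu_T^\tau$ satisfies $\mathrm{EM}(\ell,c\,e^{-\theta\ell})$ for all $\ell$. -/

import Mathlib

noncomputable section

namespace IsingTree

/-- Vertices of the infinite rooted `b`-ary tree: the root is `[]` and the children of `x` are
the vertices `i :: x` with `i : Fin b`. -/
abbrev Vertex (b : ℕ) : Type := List (Fin b)

/-- Adjacency in the tree: one of the two vertices is a child of the other one. -/
abbrev Adjacent {b : ℕ} (x y : Vertex b) : Prop :=
  (∃ i : Fin b, y = i :: x) ∨ (∃ i : Fin b, x = i :: y)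

/-- The descendants of `x` that are exactly `k` levels below `x`. -/
def level {b : ℕ} (x : Vertex b) (k : ℕ) : Finset (Vertex b) :=
  Finset.univ.image fun w : Fin k → Fin b => List.ofFn w ++ x

/-- The complete finite subtree `T` of depth `m` rooted at `v` (it has `m + 1` levels). -/
def tree {b : ℕ} (v : Vertex b) (m : ℕ) : Finset (Vertex b) :=
  (Finset.range (m + 1)).biUnion (level v)

/-- The boundary `∂T` of the complete subtree: the children of its leaves. -/
def treeBoundary {b : ℕ} (v : Vertex b) (m : ℕ) : Finset (Vertex b) :=
  level v (m + 1)

/-- `∂A`: the neighbours of `A` in `(T ∪ ∂T) \ A`. -/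
def boundary {b : ℕ} (v : Vertex b) (m : ℕ) (A : Finset (Vertex b)) : Finset (Vertex b) :=
  ((tree v m ∪ treeBoundary v m) \ A).filter fun y => ∃ x ∈ A, Adjacent x y

/-- `T_x`: the part of `T` consisting of `x` and its descendants. -/
def subtree {b : ℕ} (v : Vertex b) (m : ℕ) (x : Vertex b) : Finset (Vertex b) :=
  (tree v m).filter fun y => x <:+ y

/-- `T_x` without its root `x`. -/
def subtreeTilde {b : ℕ} (v : Vertex b) (m : ℕ) (x : Vertex b) : Finset (Vertex b) :=
  (subtree v m x).erase x

/-- The block `B_{x,ℓ}`: the first `ℓ` levels of `T_x` (all of `T_x` if it has fewer levels). -/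
def block {b : ℕ} (v : Vertex b) (m : ℕ) (x : Vertex b) (ℓ : ℕ) : Finset (Vertex b) :=
  (subtree v m x).filter fun y => y.length < x.length + ℓ

/-- The sites of `T`. -/
abbrev Site {b : ℕ} (v : Vertex b) (m : ℕ) : Type := {x : Vertex b // x ∈ tree v m}

/-- Spin configurations on `T ∪ ∂T` that agree with a given `τ` on `∂T`, recorded through their
values on `T`; spins are the elements `1`, `-1` of `ℤˣ`. -/
abbrev Config {b : ℕ} (v : Vertex b) (m : ℕ) : Type := Site v m → ℤˣ

/-- The spin, as a real number, of a vertex of `T ∪ ∂T`: given by `σ` on `T`, by `τ` on `∂T`. -/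
def spin {b : ℕ} (τ : Vertex b → ℤˣ) {v : Vertex b} {m : ℕ} (σ : Config v m) (y : Vertex b) : ℝ :=
  if hy : y ∈ tree v m then ((σ ⟨y, hy⟩ : ℤ) : ℝ) else ((τ y : ℤ) : ℝ)

/-- The Boltzmann weight
`exp (β (∑_{xy ∈ E(A ∪ ∂A)} σ_x σ_y + h ∑_{x ∈ A} σ_x))`; every edge is listed once, as a pair
of a vertex `x` and a child `i :: x` of it. -/
def weight {b : ℕ} (β h : ℝ) (τ : Vertex b → ℤˣ) {v : Vertex b} {m : ℕ}
    (A : Finset (Vertex b)) (σ : Config v m) : ℝ :=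
  Real.exp (β *
    ((∑ x ∈ A ∪ boundary v m A, ∑ i : Fin b,
        if i :: x ∈ A ∪ boundary v m A then spin τ σ x * spin τ σ (i :: x) else 0)
      + h * ∑ x ∈ A, spin τ σ x))

/-- `σ` agrees with `η` outside `A`. -/
abbrev AgreeOff {b : ℕ} {v : Vertex b} {m : ℕ} (A : Finset (Vertex b)) (η σ : Config v m) : Prop :=
  ∀ x : Site v m, (x : Vertex b) ∉ A → σ x = η x

/-- The probability `μ_A^η(σ)` of `σ` under the Gibbs distribution on `A ⊆ T`, conditioned on
the configuration outside `A` being `η`. -/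
def gibbs {b : ℕ} (β h : ℝ) (τ : Vertex b → ℤˣ) {v : Vertex b} {m : ℕ}
    (A : Finset (Vertex b)) (η σ : Config v m) : ℝ :=
  if AgreeOff A η σ then
    weight β h τ A σ / ∑ σ' : Config v m, if AgreeOff A η σ' then weight β h τ A σ' else 0
  else 0

/-- The conditional expectation `μ_A(f)`, as a function `η ↦ μ_A^η(f)`. -/
def expect {b : ℕ} (β h : ℝ) (τ : Vertex b → ℤˣ) {v : Vertex b} {m : ℕ}
    (A : Finset (Vertex b)) (f : Config v m → ℝ) (η : Config v m) : ℝ :=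
  ∑ σ : Config v m, gibbs β h τ A η σ * f σ

/-- The conditional entropy `Ent_A(f)`, as a function `η ↦ Ent_A^η(f)`, for `f ≥ 0`
(with `0 log 0 = 0`). -/
def ent {b : ℕ} (β h : ℝ) (τ : Vertex b → ℤˣ) {v : Vertex b} {m : ℕ}
    (A : Finset (Vertex b)) (f : Config v m → ℝ) (η : Config v m) : ℝ :=
  expect β h τ A (fun σ => f σ * Real.log (f σ)) η
    - expect β h τ A f η * Real.log (expect β h τ A f η)

/-- The restriction of `τ` to `T`, as a configuration. -/
def tauConfig {b : ℕ} (τ : Vertex b → ℤˣ) (v : Vertex b) (m : ℕ) : Config v m :=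
  fun x => τ x

/-- The expectation `μ(f)` with respect to the Gibbs distribution `μ = μ_T^τ` on all of `T`. -/
def mean {b : ℕ} (β h : ℝ) (τ : Vertex b → ℤˣ) {v : Vertex b} {m : ℕ}
    (f : Config v m → ℝ) : ℝ :=
  expect β h τ (tree v m) f (tauConfig τ v m)

/-- The entropy `Ent(f)` with respect to `μ = μ_T^τ`. -/
def entropy {b : ℕ} (β h : ℝ) (τ : Vertex b → ℤˣ) {v : Vertex b} {m : ℕ}
    (f : Config v m → ℝ) : ℝ :=
  ent β h τ (tree v m) f (tauConfig τ v m)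

/-- The configuration `σ^x`, obtained from `σ` by flipping the spin at `x`. -/
def flip {b : ℕ} {v : Vertex b} {m : ℕ} (σ : Config v m)
    (x : Site v m) : Config v m :=
  Function.update σ x (-σ x)

/-- The heat-bath flip rate `c_x(σ) = μ_{{x}}^σ(σ^x)`. -/
def flipRate {b : ℕ} (β h : ℝ) (τ : Vertex b → ℤˣ) {v : Vertex b} {m : ℕ}
    (x : Site v m) (σ : Config v m) : ℝ :=
  gibbs β h τ {(x : Vertex b)} σ (flip σ x)

/-- The Dirichlet form `½ ∑_{x ∈ T} μ(c_x [f(σ^x) - f(σ)]²)` of the heat-bath Glauber dynamics. -/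
def dirichlet {b : ℕ} (β h : ℝ) (τ : Vertex b → ℤˣ) {v : Vertex b} {m : ℕ}
    (f : Config v m → ℝ) : ℝ :=
  (1 / 2) * ∑ x : Site v m,
    mean β h τ fun σ => flipRate β h τ x σ * (f (flip σ x) - f σ) ^ 2

/-- The logarithmic Sobolev constant of `μ_T^τ`: the infimum of `𝓓(√f) / Ent(f)` over
non-constant `f ≥ 0`. -/
def logSobolev {b : ℕ} (β h : ℝ) (τ : Vertex b → ℤˣ) (v : Vertex b) (m : ℕ) : ℝ :=
  sInf {r : ℝ | ∃ f : Config v m → ℝ, (∀ σ, 0 ≤ f σ) ∧ (∃ σ σ', f σ ≠ f σ') ∧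
    r = dirichlet β h τ (fun σ => Real.sqrt (f σ)) / entropy β h τ f}

/-- The block entropy form `∑_{x ∈ T} μ(Ent_{B_{x,ℓ}}(f))`. -/
def blockEntropyForm {b : ℕ} (β h : ℝ) (τ : Vertex b → ℤˣ) {v : Vertex b} {m : ℕ} (ℓ : ℕ)
    (f : Config v m → ℝ) : ℝ :=
  ∑ x ∈ tree v m, mean β h τ (ent β h τ (block v m x ℓ) f)

/-- Entropy mixing `EM(ℓ, ε)` for `μ_T^τ`: for all `x ∈ T`, all `η`, and all `f ≥ 0` that do not
depend on the spins in `B_{x,ℓ}`, the entropy of the projection of `f` onto the root of `T_x` is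
at most `ε` times the entropy of `f`. -/
def EntropyMixing {b : ℕ} (β h : ℝ) (τ : Vertex b → ℤˣ) (v : Vertex b) (m : ℕ)
    (ℓ : ℕ) (ε : ℝ) : Prop :=
  ∀ x ∈ tree v m, ∀ η : Config v m, ∀ f : Config v m → ℝ, (∀ σ, 0 ≤ f σ) →
    DependsOn f {y : Site v m | (y : Vertex b) ∉ block v m x ℓ} →
    ent β h τ (subtree v m x) (expect β h τ (subtreeTilde v m x) f) η
      ≤ ε * ent β h τ (subtree v m x) f η

/-- `p_min`: the minimum over `x ∈ T`, spins `s` and configurations `η` of the probability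
`μ_{T_x}^η(σ_x = s)` (an infimum over a finite nonempty set). -/
def pMin {b : ℕ} (β h : ℝ) (τ : Vertex b → ℤˣ) (v : Vertex b) (m : ℕ) : ℝ :=
  ⨅ q : Site v m × ℤˣ × Config v m,
    expect β h τ (subtree v m q.1) (fun σ => if σ q.1 = q.2.1 then 1 else 0) q.2.2

end IsingTree

end

/-! All the Gibbs distributions are conditionings `cexp` of one weight `exp (H σ)`. The argument
rests on the tower property, the entropy chain rule `cent_chain` and the Markov property
`Uncoupled.inv_cexp`.

(i) Write `Q x` for the `μ`-average of the entropy in `T_x` of `f` projected onto the spin at `x`.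
Peeling off vertices from the top and using convexity of the entropy bounds `Ent f` by `∑ Q x`
(`cent_cexp_le_sum`). In `cent_cexp_erase_le` one such projection is compared with the entropy in
the block `B`. The error is a covariance of two functions of a single spin, the projections of `f`
and of `μ_B f`. Pinsker's inequality bounds it by the geometric mean of their entropies, and entropy
mixing makes the second one small. This is why the hypothesis carries a square; its factor `p_min`
pays for the passage from Pinsker's bound to the covariance. Averaging `f` beforehand over
everything more than `ℓ` levels below `x` turns the error into `α` times the sum of `Q y` over `y`
within `ℓ` levels below `x`. Each `y` is counted at most `ℓ + 1` times and `α (ℓ + 1) < 1`, so the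
error is absorbed.

(ii) A block has boundedly many spins, and a flip changes the energy by a bounded amount. Hence its
entropy is at most a constant times its Dirichlet form (`cent_le_localForm`), and summing over
blocks counts each site boundedly often.

(iii) The log-Sobolev inequality passes from `T` to `T_x`, because the outside acts only through the
parent of `x` (`cent_le_of_global`, `cexp_below_le`). It makes the entropy decay exponentially under
a lazy heat-bath chain (`cent_step_le`), while a perturbation at `x` spreads with finite speed
(`exists_oscBound_iterate_step`). Running the chain for a time proportional to `ℓ` shows that a
function not depending on `B` is almost uncorrelated with the spin at `x` (`sq_cexp_sub_mul_le`).
For a single spin, the entropy of the projection is bounded by this covariance squared over the mean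
(`cent_cexp_erase_le_covariance`). -/

noncomputable section

open Real

set_option linter.unusedSectionVars false

/-! ### Conditional expectation and entropy in a finite spin system -/

namespace SpinSystem

variable {S : Type*} [Fintype S] [DecidableEq S]

/-- `σ` agrees with `η` outside `A`. -/
abbrev Agree (A : Finset S) (η σ : S → ℤˣ) : Prop := ∀ x, x ∉ A → σ x = η x

theorem Agree.refl (A : Finset S) (η : S → ℤˣ) : Agree A η η := fun _ _ => rfl

theorem Agree.symm {A : Finset S} {η σ : S → ℤˣ} (h : Agree A η σ) : Agree A σ η :=
  fun x hx => (h x hx).symm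

theorem Agree.trans {A : Finset S} {η σ ρ : S → ℤˣ} (h : Agree A η σ) (h' : Agree A σ ρ) :
    Agree A η ρ := fun x hx => (h' x hx).trans (h x hx)

theorem Agree.mono {A B : Finset S} (hAB : A ⊆ B) {η σ : S → ℤˣ} (h : Agree A η σ) :
    Agree B η σ := fun x hx => h x fun hA => hx (hAB hA)

theorem Agree.congr_left {A : Finset S} {η η' σ : S → ℤˣ} (h : Agree A η η') :
    Agree A η σ ↔ Agree A η' σ := ⟨fun h' => h.symm.trans h', fun h' => h.trans h'⟩

theorem Agree.univ (η σ : S → ℤˣ) : Agree Finset.univ η σ := fun x hx => absurd (Finset.mem_univ x) hx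

/-- The function `f` does not depend on the spins in `A`. -/
def Inv {X : Type*} (A : Finset S) (f : (S → ℤˣ) → X) : Prop :=
  ∀ η σ, Agree A η σ → f σ = f η

theorem Inv.mono {X : Type*} {A B : Finset S} (hAB : A ⊆ B) {f : (S → ℤˣ) → X} (hf : Inv B f) :
    Inv A f := fun η σ h => hf η σ (h.mono hAB)

theorem Inv.comp {X Y : Type*} {A : Finset S} {f : (S → ℤˣ) → X} (hf : Inv A f) (g : X → Y) :
    Inv A (fun σ => g (f σ)) := fun η σ h => congrArg g (hf η σ h)

theorem Inv.union {X : Type*} {A B : Finset S} {f : (S → ℤˣ) → X} (hA : Inv A f) (hB : Inv B f) :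
    Inv (A ∪ B) f := by
  intro η σ h
  have h1 : Agree A η (A.piecewise σ η) := fun x hx => by simp [hx]
  have h2 : Agree B (A.piecewise σ η) σ := by
    intro x hx
    by_cases hxA : x ∈ A
    · simp [hxA]
    · simp [hxA, h x (by simp [hx, hxA])]
  rw [hB _ _ h2, hA _ _ h1]

variable (H : (S → ℤˣ) → ℝ)

/-- The partition function of the spins in `A`, the other spins being those of `η`. -/
def partition (A : Finset S) (η : S → ℤˣ) : ℝ :=
  ∑ σ, if Agree A η σ then exp (H σ) else 0

/-- The conditional expectation of `f` under the weights `exp (H σ)`, given the spins of `η`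
outside `A`. -/
def cexp (A : Finset S) (f : (S → ℤˣ) → ℝ) (η : S → ℤˣ) : ℝ :=
  (∑ σ, if Agree A η σ then exp (H σ) * f σ else 0) / partition H A η

/-- The conditional entropy belonging to `cexp`. -/
def cent (A : Finset S) (f : (S → ℤˣ) → ℝ) (η : S → ℤˣ) : ℝ :=
  cexp H A (fun σ => f σ * log (f σ)) η - cexp H A f η * log (cexp H A f η)

theorem partition_pos (A : Finset S) (η : S → ℤˣ) : 0 < partition H A η := by
  unfold partition
  refine Finset.sum_pos' (fun σ _ => by split_ifs <;> positivity) ⟨η, Finset.mem_univ _, ?_⟩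
  rw [if_pos (Agree.refl A η)]
  positivity

theorem partition_inv (A : Finset S) : Inv A (partition H A) := by
  intro η σ h
  unfold partition
  exact Finset.sum_congr rfl fun ρ _ => if_congr h.congr_left.symm rfl rfl

theorem cexp_inv (A : Finset S) (f : (S → ℤˣ) → ℝ) : Inv A (cexp H A f) := by
  intro η σ h
  unfold cexp
  rw [partition_inv H A η σ h]
  congr 1
  exact Finset.sum_congr rfl fun ρ _ => if_congr h.congr_left.symm rfl rfl

theorem cent_inv (A : Finset S) (f : (S → ℤˣ) → ℝ) : Inv A (cent H A f) := by
  intro η σ h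
  unfold cent
  rw [cexp_inv H A _ η σ h, cexp_inv H A _ η σ h]

theorem cexp_mono_fiber {A : Finset S} {f g : (S → ℤˣ) → ℝ} {η : S → ℤˣ}
    (h : ∀ σ, Agree A η σ → f σ ≤ g σ) : cexp H A f η ≤ cexp H A g η := by
  unfold cexp
  refine div_le_div_of_nonneg_right (Finset.sum_le_sum fun σ _ => ?_) (partition_pos H A η).le
  split_ifs with hσ
  · exact mul_le_mul_of_nonneg_left (h σ hσ) (exp_pos _).le
  · rfl

theorem cexp_mono {A : Finset S} {f g : (S → ℤˣ) → ℝ} (h : ∀ σ, f σ ≤ g σ) (η : S → ℤˣ) :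
    cexp H A f η ≤ cexp H A g η := cexp_mono_fiber H fun σ _ => h σ

theorem cexp_congr_fiber {A : Finset S} {f g : (S → ℤˣ) → ℝ} {η : S → ℤˣ}
    (h : ∀ σ, Agree A η σ → f σ = g σ) : cexp H A f η = cexp H A g η :=
  le_antisymm (cexp_mono_fiber H fun σ hσ => (h σ hσ).le)
    (cexp_mono_fiber H fun σ hσ => (h σ hσ).ge)

theorem cent_congr_fiber {A : Finset S} {f g : (S → ℤˣ) → ℝ} {η : S → ℤˣ}
    (h : ∀ σ, Agree A η σ → f σ = g σ) : cent H A f η = cent H A g η := by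
  unfold cent
  rw [cexp_congr_fiber H h, cexp_congr_fiber H fun σ hσ => by rw [h σ hσ]]

theorem cexp_add (A : Finset S) (f g : (S → ℤˣ) → ℝ) (η : S → ℤˣ) :
    cexp H A (fun σ => f σ + g σ) η = cexp H A f η + cexp H A g η := by
  unfold cexp
  rw [← add_div, ← Finset.sum_add_distrib]
  congr 1
  refine Finset.sum_congr rfl fun σ _ => ?_
  split_ifs <;> ring

theorem cexp_mul_of_inv {A : Finset S} {g : (S → ℤˣ) → ℝ} (hg : Inv A g) (f : (S → ℤˣ) → ℝ)
    (η : S → ℤˣ) : cexp H A (fun σ => g σ * f σ) η = g η * cexp H A f η := by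
  unfold cexp
  rw [← mul_div_assoc, Finset.mul_sum]
  congr 1
  refine Finset.sum_congr rfl fun σ _ => ?_
  split_ifs with h
  · beta_reduce; rw [hg η σ h]; ring
  · simp

theorem cexp_const_mul (A : Finset S) (c : ℝ) (f : (S → ℤˣ) → ℝ) (η : S → ℤˣ) :
    cexp H A (fun σ => c * f σ) η = c * cexp H A f η :=
  cexp_mul_of_inv H (g := fun _ => c) (fun _ _ _ => rfl) f η

theorem cexp_sub (A : Finset S) (f g : (S → ℤˣ) → ℝ) (η : S → ℤˣ) :
    cexp H A (fun σ => f σ - g σ) η = cexp H A f η - cexp H A g η := by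
  have h := cexp_add H A f (fun σ => (-1) * g σ) η
  rw [cexp_const_mul] at h
  simpa [sub_eq_add_neg] using h

theorem cexp_one (A : Finset S) (η : S → ℤˣ) : cexp H A (fun _ => 1) η = 1 := by
  unfold cexp
  simp only [mul_one]
  exact div_self (partition_pos H A η).ne'

theorem cexp_of_inv {A : Finset S} {g : (S → ℤˣ) → ℝ} (hg : Inv A g) (η : S → ℤˣ) :
    cexp H A g η = g η := by
  simpa [cexp_one] using cexp_mul_of_inv H hg (fun _ => 1) η

theorem cexp_const (A : Finset S) (c : ℝ) (η : S → ℤˣ) : cexp H A (fun _ => c) η = c :=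
  cexp_of_inv H (g := fun _ => c) (fun _ _ _ => rfl) η

theorem cexp_sum {ι : Type*} (s : Finset ι) (A : Finset S) (f : ι → (S → ℤˣ) → ℝ) (η : S → ℤˣ) :
    cexp H A (fun σ => ∑ i ∈ s, f i σ) η = ∑ i ∈ s, cexp H A (f i) η := by
  classical
  induction s using Finset.induction_on with
  | empty => simpa using cexp_const H A 0 η
  | insert i s hi ih => simp only [Finset.sum_insert hi, cexp_add, ih]

theorem cexp_nonneg {A : Finset S} {f : (S → ℤˣ) → ℝ} (h : ∀ σ, 0 ≤ f σ) (η : S → ℤˣ) :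
    0 ≤ cexp H A f η := by
  rw [← cexp_const H A 0 η]
  exact cexp_mono H h η

theorem cexp_pos {A : Finset S} {f : (S → ℤˣ) → ℝ} (h : ∀ σ, 0 < f σ) (η : S → ℤˣ) :
    0 < cexp H A f η := by
  unfold cexp
  refine div_pos (Finset.sum_pos' (fun σ _ => ?_) ⟨η, Finset.mem_univ _, ?_⟩) (partition_pos H A η)
  · split_ifs
    · exact mul_nonneg (exp_pos _).le (h σ).le
    · rfl
  · rw [if_pos (Agree.refl A η)]
    exact mul_pos (exp_pos _) (h η)

theorem abs_cexp_le {A : Finset S} (f : (S → ℤˣ) → ℝ) (η : S → ℤˣ) :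
    |cexp H A f η| ≤ cexp H A (fun σ => |f σ|) η := by
  rw [abs_le]
  constructor
  · have := cexp_const_mul H A (-1) (fun σ => |f σ|) η
    rw [neg_one_mul] at this
    rw [← this]
    exact cexp_mono H (fun σ => by rw [neg_one_mul]; exact neg_abs_le _) η
  · exact cexp_mono H (fun σ => le_abs_self _) η

/-- The left side is a sum over pairs in a common `A`-fibre inside the `B`-fibre. After exchanging
the sums, the inner sum of weights is the partition function of the `A`-fibre and cancels the
denominator. -/
theorem cexp_tower {A B : Finset S} (hAB : A ⊆ B) (f : (S → ℤˣ) → ℝ) (η : S → ℤˣ) :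
    cexp H B (cexp H A f) η = cexp H B f η := by
  have key : (∑ σ, if Agree B η σ then exp (H σ) * cexp H A f σ else 0)
      = ∑ σ, if Agree B η σ then exp (H σ) * f σ else 0 := by
    have h1 : ∀ σ, (if Agree B η σ then exp (H σ) * cexp H A f σ else 0)
        = ∑ ρ, if Agree B η ρ ∧ Agree A ρ σ then
            exp (H σ) * (exp (H ρ) * f ρ / partition H A ρ) else 0 := by
      intro σ
      split_ifs with hσ
      · unfold cexp
        rw [Finset.sum_div, Finset.mul_sum]
        refine Finset.sum_congr rfl fun ρ _ => ?_
        by_cases hρ : Agree A σ ρ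
        · rw [if_pos hρ, if_pos ⟨hσ.trans (hρ.mono hAB), hρ.symm⟩, partition_inv H A σ ρ hρ]
        · rw [if_neg hρ, if_neg fun h => hρ h.2.symm]
          simp
      · refine (Finset.sum_eq_zero fun ρ _ => if_neg fun h => hσ ?_).symm
        exact h.1.trans (h.2.mono hAB)
    rw [Finset.sum_congr rfl fun σ _ => h1 σ, Finset.sum_comm]
    refine Finset.sum_congr rfl fun ρ _ => ?_
    by_cases hρ : Agree B η ρ
    · have : ∀ σ, (if Agree B η ρ ∧ Agree A ρ σ then
            exp (H σ) * (exp (H ρ) * f ρ / partition H A ρ) else 0)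
          = (if Agree A ρ σ then exp (H σ) else 0) * (exp (H ρ) * f ρ / partition H A ρ) := by
        intro σ
        rw [ite_mul, zero_mul]
        exact if_congr (and_iff_right hρ) rfl rfl
      rw [Finset.sum_congr rfl fun σ _ => this σ, ← Finset.sum_mul]
      change partition H A ρ * _ = _
      rw [if_pos hρ, mul_div_cancel₀ _ (partition_pos H A ρ).ne']
    · rw [if_neg hρ]
      exact Finset.sum_eq_zero fun σ _ => if_neg fun h => hρ h.1
  rw [cexp, key, cexp]

theorem cexp_mul_cexp {A B : Finset S} (hAB : A ⊆ B) {g : (S → ℤˣ) → ℝ} (hg : Inv A g)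
    (f : (S → ℤˣ) → ℝ) (η : S → ℤˣ) :
    cexp H B (fun σ => g σ * cexp H A f σ) η = cexp H B (fun σ => g σ * f σ) η := by
  rw [← cexp_tower H hAB (fun σ => g σ * f σ)]
  congr 1
  funext σ
  rw [cexp_mul_of_inv H hg]

/-- The conditional expectations over a subset are self-adjoint. -/
theorem cexp_mul_cexp_comm {A B : Finset S} (hAB : A ⊆ B) (f g : (S → ℤˣ) → ℝ) (η : S → ℤˣ) :
    cexp H B (fun σ => cexp H A f σ * g σ) η = cexp H B (fun σ => f σ * cexp H A g σ) η := by
  rw [← cexp_mul_cexp H hAB (cexp_inv H A f) g η]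
  simp only [mul_comm (cexp H A f _)]
  rw [cexp_mul_cexp H hAB (cexp_inv H A g) f η]
  simp only [mul_comm]

theorem cent_chain {A B : Finset S} (hAB : A ⊆ B) (f : (S → ℤˣ) → ℝ) (η : S → ℤˣ) :
    cent H B f η = cexp H B (cent H A f) η + cent H B (cexp H A f) η := by
  have h : cexp H B (cent H A f) η = cexp H B (fun σ => f σ * log (f σ)) η
      - cexp H B (fun σ => cexp H A f σ * log (cexp H A f σ)) η := by
    rw [← cexp_tower H hAB (fun σ => f σ * log (f σ)), ← cexp_sub]
    rfl
  rw [h]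
  unfold cent
  rw [cexp_tower H hAB]
  ring

theorem cent_of_inv {A : Finset S} {f : (S → ℤˣ) → ℝ} (hf : Inv A f) (η : S → ℤˣ) :
    cent H A f η = 0 := by
  unfold cent
  rw [cexp_of_inv H (hf.comp fun t => t * log t), cexp_of_inv H hf, sub_self]

theorem eq_zero_of_cexp_eq_zero {A : Finset S} {f : (S → ℤˣ) → ℝ} (hf : ∀ σ, 0 ≤ f σ)
    {η : S → ℤˣ} (h : cexp H A f η = 0) {σ : S → ℤˣ} (hσ : Agree A η σ) : f σ = 0 := by
  unfold cexp at h
  rw [div_eq_zero_iff, or_iff_left (partition_pos H A η).ne', Finset.sum_eq_zero_iff_of_nonneg] at h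
  · have := h σ (Finset.mem_univ σ)
    rw [if_pos hσ] at this
    simpa [(exp_pos (H σ)).ne'] using this
  · intro σ _
    split_ifs
    · exact mul_nonneg (exp_pos _).le (hf σ)
    · rfl

/-- The entropy dominates the Hellinger distance to the mean. -/
theorem cexp_sqrt_sub_sq_le_cent {A : Finset S} {f : (S → ℤˣ) → ℝ} (hf : ∀ σ, 0 ≤ f σ)
    (η : S → ℤˣ) : cexp H A (fun σ => (√(f σ) - √(cexp H A f η)) ^ 2) η ≤ cent H A f η := by
  set c := cexp H A f η with hc
  have hc0 : 0 ≤ c := cexp_nonneg H hf η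
  -- This is `log t ≤ t - 1` at `t = √c / √(f σ)`; the linear terms `- f σ + c` have mean zero.
  have hz : ∀ σ, Agree A η σ → (√(f σ) - √c) ^ 2 ≤ f σ * log (f σ) - f σ * log c - f σ + c := by
    intro σ hσ
    rcases hc0.eq_or_lt with h0 | h0
    · rw [eq_zero_of_cexp_eq_zero H hf (hc.symm.trans h0.symm) hσ, ← h0]; simp
    rcases (hf σ).eq_or_lt with h1 | h1
    · rw [← h1]; simp [sq_sqrt hc0]
    · have hs : 0 < √(f σ) := sqrt_pos.2 h1
      have ht : 0 < √c := sqrt_pos.2 h0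
      have e1 : log (f σ) - log c = -(2 * log (√c / √(f σ))) := by
        rw [log_div ht.ne' hs.ne', log_sqrt h1.le, log_sqrt h0.le]; ring
      have e2 := log_le_sub_one_of_pos (div_pos ht hs)
      have e3 : f σ * (√c / √(f σ)) = √(f σ) * √c := by
        nth_rewrite 1 [← mul_self_sqrt h1.le]; field_simp
      have e4 := mul_self_sqrt h1.le
      have e5 := mul_self_sqrt h0.le
      nlinarith [mul_le_mul_of_nonneg_left e2 h1.le]
  refine (cexp_mono_fiber H hz).trans (le_of_eq ?_)
  have e := cexp_mul_of_inv H (A := A) (g := fun _ => log c) (fun _ _ _ => rfl) f η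
  simp only [mul_comm (log c)] at e
  rw [cexp_add, cexp_sub, cexp_sub, cexp_const, e, ← hc]
  unfold cent
  rw [← hc]; ring

theorem cent_nonneg {A : Finset S} {f : (S → ℤˣ) → ℝ} (hf : ∀ σ, 0 ≤ f σ) (η : S → ℤˣ) :
    0 ≤ cent H A f η :=
  (cexp_nonneg H (fun _ => sq_nonneg _) η).trans (cexp_sqrt_sub_sq_le_cent H hf η)

theorem cent_cexp_le_cent {A B : Finset S} (hAB : A ⊆ B) {f : (S → ℤˣ) → ℝ} (hf : ∀ σ, 0 ≤ f σ)
    (η : S → ℤˣ) : cent H B (cexp H A f) η ≤ cent H B f η := by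
  rw [cent_chain H hAB f]
  linarith [cexp_nonneg H (A := B) (fun σ => cent_nonneg H (A := A) hf σ) η]

/-! ### Sets of spins that do not interact -/

variable {H}

/-- The spins in `A` and the spins in `A'` do not interact. -/
def Uncoupled (H : (S → ℤˣ) → ℝ) (A A' : Finset S) : Prop :=
  Disjoint A A' ∧ ∀ σ σ', Agree (A ∪ A') σ σ' →
    H σ + H σ' = H (A.piecewise σ σ') + H (A.piecewise σ' σ)

theorem piecewise_eq_of_agree_union {A A' : Finset S} (hd : Disjoint A A') {σ σ' : S → ℤˣ}
    (h : Agree (A ∪ A') σ σ') : A'.piecewise σ σ' = A.piecewise σ' σ := by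
  funext x
  by_cases hA : x ∈ A
  · simp [hA, Finset.disjoint_left.1 hd hA]
  · by_cases hA' : x ∈ A'
    · simp [hA, hA']
    · simp [hA, hA', h x (by simp [hA, hA'])]

theorem Uncoupled.symm {A A' : Finset S} (h : Uncoupled H A A') : Uncoupled H A' A := by
  refine ⟨h.1.symm, fun σ σ' hσ => ?_⟩
  rw [Finset.union_comm] at hσ
  rw [piecewise_eq_of_agree_union h.1 hσ, piecewise_eq_of_agree_union h.1 hσ.symm, h.2 σ σ' hσ,
    add_comm]

/-- The Markov property. -/
theorem Uncoupled.inv_cexp {A A' : Finset S} (h : Uncoupled H A A') {g : (S → ℤˣ) → ℝ}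
    (hg : Inv A' g) : Inv A' (cexp H A g) := by
  intro η η' hη
  unfold cexp
  rw [div_eq_div_iff (partition_pos H A η').ne' (partition_pos H A η).ne']
  unfold partition
  rw [Finset.sum_mul_sum, Finset.sum_mul_sum, Finset.sum_comm, ← Finset.sum_product',
    ← Finset.sum_product', Finset.univ_product_univ]
  -- After cross-multiplication both sides are sums over pairs of configurations. Exchanging the
  -- `A`-parts within a pair preserves the total energy and matches the terms.
  let F : (S → ℤˣ) × (S → ℤˣ) → (S → ℤˣ) × (S → ℤˣ) :=
    fun p => (A.piecewise p.2 p.1, A.piecewise p.1 p.2)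
  have hF : Function.Involutive F := by
    intro p
    ext x <;> by_cases hx : x ∈ A <;> simp [F, hx]
  refine Fintype.sum_equiv hF.toPerm _ _ ?_
  rintro ⟨σ, σ'⟩
  have ha : ∀ ξ ρ ρ' : S → ℤˣ, Agree A ξ (A.piecewise ρ ρ') ↔ Agree A ξ ρ' := by
    intro ξ ρ ρ'
    refine forall₂_congr fun x hx => ?_
    simp [hx]
  simp only [Function.Involutive.coe_toPerm, F, ha]
  by_cases h1 : Agree A η σ
  · by_cases h2 : Agree A η' σ'
    · rw [if_pos h1, if_pos h2, if_pos h1, if_pos h2]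
      have hσ : Agree (A ∪ A') σ σ' := by
        intro x hx
        simp only [Finset.mem_union, not_or] at hx
        rw [h2 x hx.1, h1 x hx.1, hη x hx.2]
      have hgσ : g σ' = g (A.piecewise σ' σ) := by
        refine hg _ _ fun x hx => ?_
        by_cases hA : x ∈ A
        · simp [hA]
        · simp [hA, hσ x (by simp [hA, hx])]
      have hH := h.2 σ σ' hσ
      rw [hgσ]
      have : exp (H σ') * exp (H σ) =
          exp (H (A.piecewise σ' σ)) * exp (H (A.piecewise σ σ')) := by
        rw [← exp_add, ← exp_add]; congr 1; linarith
      linear_combination g (A.piecewise σ' σ) * this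
    · rw [if_neg h2, if_neg h2, zero_mul, mul_zero]
  · rw [if_neg h1, if_neg h1, mul_zero, zero_mul]

/-- By the Markov property the iterated average depends on no spin in `A ∪ A'`. Averaging it over `A
∪ A'` therefore changes nothing, and the tower property removes the two inner averages. -/
theorem Uncoupled.cexp_union {A A' : Finset S} (h : Uncoupled H A A') (f : (S → ℤˣ) → ℝ) :
    cexp H (A ∪ A') f = cexp H A (cexp H A' f) := by
  have hi : Inv (A ∪ A') (cexp H A (cexp H A' f)) :=
    (cexp_inv H A _).union (h.inv_cexp (cexp_inv H A' f))
  funext η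
  rw [← cexp_of_inv H hi, cexp_tower H Finset.subset_union_left,
    cexp_tower H Finset.subset_union_right]

theorem Uncoupled.cexp_comm {A A' : Finset S} (h : Uncoupled H A A') (f : (S → ℤˣ) → ℝ) :
    cexp H A (cexp H A' f) = cexp H A' (cexp H A f) := by
  rw [← h.cexp_union, ← h.symm.cexp_union, Finset.union_comm]

/-- Convexity of the entropy. -/
theorem Uncoupled.cent_cexp_le {A A' : Finset S} (h : Uncoupled H A A') {f : (S → ℤˣ) → ℝ}
    (hf : ∀ σ, 0 < f σ) (η : S → ℤˣ) :
    cent H A' (cexp H A f) η ≤ cexp H A (cent H A' f) η := by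
  set k := cexp H A f with hk
  set K := cexp H A' f with hK
  set N := cexp H A' k with hN
  have hNK : N = cexp H A K := (h.cexp_comm f).symm
  have k0 : ∀ σ, 0 < k σ := cexp_pos H hf
  have K0 : ∀ σ, 0 < K σ := cexp_pos H hf
  have N0 : ∀ σ, 0 < N σ := cexp_pos H k0
  have h1 : ∀ σ, k σ * log (k σ) - log (N σ) * k σ
      ≤ cexp H A (fun ρ => f ρ * log (f ρ) - log (K ρ) * f ρ) σ := by
    intro σ
    -- The left side is the tangent plane at `(k σ, N σ)` of the convex function `x log (x / y)`.
    -- Since `k` and `N` are the `A`-averages of `f` and `K`, averaging gives Jensen's inequality.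
    have h2 : ∀ ρ, (log (k σ) - log (N σ) + 1) * f ρ - k σ / N σ * K ρ
        ≤ f ρ * log (f ρ) - log (K ρ) * f ρ := by
      intro ρ
      have hpos : 0 < k σ / N σ * K ρ / f ρ :=
        div_pos (mul_pos (div_pos (k0 σ) (N0 σ)) (K0 ρ)) (hf ρ)
      have e := log_le_sub_one_of_pos hpos
      rw [log_div (mul_pos (div_pos (k0 σ) (N0 σ)) (K0 ρ)).ne' (hf ρ).ne',
        log_mul (div_pos (k0 σ) (N0 σ)).ne' (K0 ρ).ne', log_div (k0 σ).ne' (N0 σ).ne'] at e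
      have e' := mul_le_mul_of_nonneg_left e (hf ρ).le
      have e3 : f ρ * (k σ / N σ * K ρ / f ρ - 1) = k σ / N σ * K ρ - f ρ := by
        field_simp [(hf ρ).ne']
      rw [e3] at e'
      linarith
    refine le_trans (le_of_eq ?_) (cexp_mono H h2 σ)
    rw [cexp_sub, cexp_const_mul, cexp_const_mul, ← hNK, ← hk, div_mul_cancel₀ _ (N0 σ).ne']
    ring
  have h3 := cexp_mono H (A := A') h1 η
  rw [← h.cexp_comm] at h3
  refine le_trans (le_of_eq ?_) (h3.trans (le_of_eq ?_))
  · rw [cexp_sub, cexp_mul_of_inv H ((cexp_inv H A' k).comp log)]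
    unfold cent
    rw [← hN]; ring
  · congr 1
    funext ρ
    rw [cexp_sub, cexp_mul_of_inv H ((cexp_inv H A' f).comp log)]
    unfold cent
    rw [← hK]; ring

theorem Uncoupled.cent_union_of_inv {A A' : Finset S} (h : Uncoupled H A A')
    {f : (S → ℤˣ) → ℝ} (hf : Inv A' f) (η : S → ℤˣ) :
    cent H (A ∪ A') f η = cent H A f η := by
  have e : ∀ g, Inv A' g → cexp H (A ∪ A') g = cexp H A g := by
    intro g hg
    rw [h.cexp_union]
    congr 1
    funext σ
    exact cexp_of_inv H hg σ
  unfold cent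
  rw [e _ hf, e _ (hf.comp fun t => t * log t)]

end SpinSystem

/-! ### The Ising model on the tree as a spin system -/

namespace IsingTree

open SpinSystem

section Geometry

variable {b : ℕ}

theorem mem_level {v x : Vertex b} {k : ℕ} :
    x ∈ level v k ↔ v <:+ x ∧ x.length = v.length + k := by
  unfold level
  simp only [Finset.mem_image, Finset.mem_univ, true_and]
  constructor
  · rintro ⟨w, rfl⟩
    exact ⟨List.suffix_append _ _, by simp [add_comm]⟩
  · rintro ⟨⟨l, rfl⟩, hl⟩
    have : l.length = k := by simp at hl; omega
    subst this
    exact ⟨l.get, by rw [List.ofFn_get]⟩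

theorem mem_tree {v x : Vertex b} {m : ℕ} :
    x ∈ tree v m ↔ v <:+ x ∧ x.length ≤ v.length + m := by
  unfold tree
  simp only [Finset.mem_biUnion, Finset.mem_range, mem_level]
  constructor
  · rintro ⟨k, hk, h1, h2⟩
    exact ⟨h1, by omega⟩
  · rintro ⟨h1, h2⟩
    have := h1.length_le
    exact ⟨x.length - v.length, by omega, h1, by omega⟩

/-- The set `T ∪ ∂T`. -/
def region (v : Vertex b) (m : ℕ) : Finset (Vertex b) := tree v m ∪ treeBoundary v m

variable {v : Vertex b} {m : ℕ}

/-- The sites of `T` that lie in `A`. -/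
def sites (v : Vertex b) (m : ℕ) (A : Finset (Vertex b)) : Finset (Site v m) :=
  A.subtype (· ∈ tree v m)

theorem mem_sites {A : Finset (Vertex b)} {y : Site v m} : y ∈ sites v m A ↔ (y : Vertex b) ∈ A :=
  Finset.mem_subtype

variable (β h : ℝ) (τ : Vertex b → ℤˣ)

/-- The total energy of a configuration on `T`. -/
def energy (v : Vertex b) (m : ℕ) (σ : Config v m) : ℝ :=
  β * ((∑ x ∈ region v m, ∑ i : Fin b,
      if i :: x ∈ region v m then spin τ σ x * spin τ σ (i :: x) else 0)
    + h * ∑ x ∈ tree v m, spin τ σ x)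

theorem spin_congr {σ σ' : Config v m} {x : Vertex b}
    (hx : ∀ hx : x ∈ tree v m, σ ⟨x, hx⟩ = σ' ⟨x, hx⟩) : spin τ σ x = spin τ σ' x := by
  unfold spin
  split_ifs with hy
  · rw [hx hy]
  · rfl

theorem abs_spin (σ : Config v m) (x : Vertex b) : |spin τ σ x| = 1 := by
  have : ∀ u : ℤˣ, |((u : ℤ) : ℝ)| = 1 := by
    intro u
    rcases Int.units_eq_one_or u with rfl | rfl <;> simp
  unfold spin
  split_ifs <;> exact this _

/-- The total energy and the exponent of `weight` differ only by terms without a site of `A`, which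
take the same value at `σ` and `σ'`. Hence every `gibbs` distribution is a conditioning of one
weight. -/
theorem weight_mul_exp_energy {A : Finset (Vertex b)} (hA : A ⊆ tree v m) {σ σ' : Config v m}
    (hσ : AgreeOff A σ σ') :
    weight β h τ A σ * exp (energy β h τ v m σ') = weight β h τ A σ' * exp (energy β h τ v m σ) := by
  have hs : ∀ x, x ∉ A → spin τ σ x = spin τ σ' x :=
    fun x hx => spin_congr τ fun hx' => (hσ ⟨x, hx'⟩ hx).symm
  set U := A ∪ boundary v m A with hU
  have hUr : U ⊆ region v m := by
    intro x hx
    rcases Finset.mem_union.1 hx with hx | hx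
    · exact Finset.mem_union_left _ (hA hx)
    · exact (Finset.mem_sdiff.1 (Finset.mem_filter.1 hx).1).1
  have hnb : ∀ x y, x ∈ A → y ∈ region v m → Adjacent x y → y ∈ U := by
    intro x y hx hy hxy
    by_cases hyA : y ∈ A
    · exact Finset.mem_union_left _ hyA
    · exact Finset.mem_union_right _
        (Finset.mem_filter.2 ⟨Finset.mem_sdiff.2 ⟨hy, hyA⟩, x, hx, hxy⟩)
  have hsub : ∀ ρ : Config v m, (∑ x ∈ U, ∑ i : Fin b,
      if i :: x ∈ U then spin τ ρ x * spin τ ρ (i :: x) else 0)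
      = ∑ x ∈ region v m, ∑ i : Fin b,
        if x ∈ U ∧ i :: x ∈ U then spin τ ρ x * spin τ ρ (i :: x) else 0 := by
    intro ρ
    rw [← Finset.sum_subset hUr]
    · refine Finset.sum_congr rfl fun x hx => Finset.sum_congr rfl fun i _ => ?_
      simp [hx]
    · intro x _ hx
      simp [hx]
  have hedge : ∀ x ∈ region v m, ∀ i : Fin b,
      (if i :: x ∈ region v m then spin τ σ x * spin τ σ (i :: x) else 0)
        - (if x ∈ U ∧ i :: x ∈ U then spin τ σ x * spin τ σ (i :: x) else 0)
      = (if i :: x ∈ region v m then spin τ σ' x * spin τ σ' (i :: x) else 0)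
        - (if x ∈ U ∧ i :: x ∈ U then spin τ σ' x * spin τ σ' (i :: x) else 0) := by
    intro x hx i
    by_cases h1 : x ∈ U ∧ i :: x ∈ U
    · simp [h1, hUr h1.2]
    · by_cases h2 : i :: x ∈ region v m
      · have hxA : x ∉ A := fun hxA =>
          h1 ⟨Finset.mem_union_left _ hxA, hnb x _ hxA h2 (Or.inl ⟨i, rfl⟩)⟩
        have hiA : i :: x ∉ A := fun hiA =>
          h1 ⟨hnb _ x hiA hx (Or.inr ⟨i, rfl⟩), Finset.mem_union_left _ hiA⟩
        simp only [if_neg h1, if_pos h2, hs x hxA, hs _ hiA]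
      · simp [h1, h2]
  have hfield : (∑ x ∈ tree v m, spin τ σ x) - ∑ x ∈ A, spin τ σ x
      = (∑ x ∈ tree v m, spin τ σ' x) - ∑ x ∈ A, spin τ σ' x := by
    rw [← Finset.sum_sdiff hA, ← Finset.sum_sdiff hA (f := fun x => spin τ σ' x)]
    rw [Finset.sum_congr rfl fun x hx => hs x (Finset.mem_sdiff.1 hx).2]
    ring
  have hsum := Finset.sum_congr (rfl : region v m = region v m) fun x hx =>
    Finset.sum_congr (rfl : (Finset.univ : Finset (Fin b)) = Finset.univ) fun i _ => hedge x hx i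
  simp only [Finset.sum_sub_distrib] at hsum
  unfold weight energy
  rw [← exp_add, ← exp_add, ← hU, hsub, hsub]
  congr 1
  linear_combination β * (-hsum) + β * h * (-hfield)

theorem gibbs_eq {A : Finset (Vertex b)} (hA : A ⊆ tree v m) (η σ : Config v m) :
    gibbs β h τ A η σ = if Agree (sites v m A) η σ then
      exp (energy β h τ v m σ) / partition (energy β h τ v m) (sites v m A) η else 0 := by
  have hag : ∀ σ' : Config v m, AgreeOff A η σ' ↔ Agree (sites v m A) η σ' := by
    intro σ'
    exact forall_congr' fun x => by rw [mem_sites]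
  unfold gibbs
  by_cases hσ : AgreeOff A η σ
  · rw [if_pos hσ, if_pos ((hag σ).1 hσ)]
    have hw : ∀ ρ : Config v m, 0 < weight β h τ A ρ := fun ρ => exp_pos _
    have hpos : 0 < ∑ σ' : Config v m, if AgreeOff A η σ' then weight β h τ A σ' else 0 := by
      refine Finset.sum_pos' (fun ρ _ => ?_) ⟨σ, Finset.mem_univ _, ?_⟩
      · split_ifs
        · exact (hw ρ).le
        · rfl
      · rw [if_pos hσ]; exact hw σ
    rw [div_eq_div_iff hpos.ne' (partition_pos _ _ _).ne']
    unfold partition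
    rw [Finset.mul_sum, Finset.mul_sum]
    refine Finset.sum_congr rfl fun ρ _ => ?_
    by_cases hρ : AgreeOff A η ρ
    · rw [if_pos hρ, if_pos ((hag ρ).1 hρ),
        weight_mul_exp_energy β h τ hA (σ := σ) (σ' := ρ) fun x hx => (hρ x hx).trans (hσ x hx).symm,
        mul_comm]
    · rw [if_neg hρ, if_neg fun h' => hρ ((hag ρ).2 h'), mul_zero, mul_zero]
  · rw [if_neg hσ, if_neg fun h' => hσ ((hag σ).2 h')]

theorem expect_eq {A : Finset (Vertex b)} (hA : A ⊆ tree v m) (f : Config v m → ℝ) :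
    expect β h τ A f = cexp (energy β h τ v m) (sites v m A) f := by
  funext η
  unfold expect cexp
  rw [Finset.sum_div]
  refine Finset.sum_congr rfl fun σ _ => ?_
  rw [gibbs_eq β h τ hA, ite_mul, ite_div, zero_mul, zero_div, div_mul_eq_mul_div]

theorem ent_eq {A : Finset (Vertex b)} (hA : A ⊆ tree v m) (f : Config v m → ℝ) :
    ent β h τ A f = cent (energy β h τ v m) (sites v m A) f := by
  funext η
  unfold ent cent
  rw [expect_eq β h τ hA, expect_eq β h τ hA]

theorem sites_tree : sites v m (tree v m) = Finset.univ :=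
  Finset.eq_univ_of_forall fun y => mem_sites.2 y.2

theorem mean_eq (f : Config v m → ℝ) (η : Config v m) :
    mean β h τ f = cexp (energy β h τ v m) Finset.univ f η := by
  unfold mean
  rw [expect_eq β h τ subset_rfl, sites_tree]
  exact cexp_inv _ _ _ _ _ (Agree.univ _ _)

theorem entropy_eq (f : Config v m → ℝ) (η : Config v m) :
    entropy β h τ f = cent (energy β h τ v m) Finset.univ f η := by
  unfold entropy
  rw [ent_eq β h τ subset_rfl, sites_tree]
  exact cent_inv _ _ _ _ _ (Agree.univ _ _)

/-- Exchanging the spins outside `A` keeps an edge term with both ends in `A` and swaps one with no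
end in `A`. If exactly one end lies in `A`, the other lies off `A ∪ A'`, where the two
configurations agree. -/
theorem uncoupled_of_not_adjacent {A A' : Finset (Site v m)} (hd : Disjoint A A')
    (hadj : ∀ x ∈ A, ∀ y ∈ A', ¬ Adjacent (x : Vertex b) (y : Vertex b)) :
    Uncoupled (energy β h τ v m) A A' := by
  refine ⟨hd, fun σ σ' hσ => ?_⟩
  have hA : ∀ x : Vertex b, (∃ hx : x ∈ tree v m, (⟨x, hx⟩ : Site v m) ∈ A) →
      ∀ ρ ρ' : Config v m, spin τ (A.piecewise ρ ρ') x = spin τ ρ x := by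
    rintro x ⟨hx, hxA⟩ ρ ρ'
    exact spin_congr τ fun _ => by simp [hxA]
  have hA' : ∀ x : Vertex b, ¬ (∃ hx : x ∈ tree v m, (⟨x, hx⟩ : Site v m) ∈ A) →
      ∀ ρ ρ' : Config v m, spin τ (A.piecewise ρ ρ') x = spin τ ρ' x := by
    intro x hx ρ ρ'
    exact spin_congr τ fun h1 => by
      have : (⟨x, h1⟩ : Site v m) ∉ A := fun h2 => hx ⟨h1, h2⟩
      simp [this]
  have hB : ∀ x : Vertex b, ¬ (∃ hx : x ∈ tree v m, (⟨x, hx⟩ : Site v m) ∈ A) →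
      ¬ (∃ hx : x ∈ tree v m, (⟨x, hx⟩ : Site v m) ∈ A') → spin τ σ x = spin τ σ' x := by
    intro x h1 h2
    refine spin_congr τ fun hx => (hσ ⟨x, hx⟩ ?_).symm
    rw [Finset.mem_union, not_or]
    exact ⟨fun h3 => h1 ⟨hx, h3⟩, fun h3 => h2 ⟨hx, h3⟩⟩
  have hvert : ∀ x : Vertex b, spin τ σ x + spin τ σ' x
      = spin τ (A.piecewise σ σ') x + spin τ (A.piecewise σ' σ) x := by
    intro x
    by_cases hx : ∃ hx : x ∈ tree v m, (⟨x, hx⟩ : Site v m) ∈ A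
    · rw [hA x hx, hA x hx]
    · rw [hA' x hx, hA' x hx, add_comm]
  have hedge : ∀ x y : Vertex b, Adjacent x y → spin τ σ x * spin τ σ y + spin τ σ' x * spin τ σ' y
      = spin τ (A.piecewise σ σ') x * spin τ (A.piecewise σ σ') y
        + spin τ (A.piecewise σ' σ) x * spin τ (A.piecewise σ' σ) y := by
    intro x y hxy
    by_cases hx : ∃ hx : x ∈ tree v m, (⟨x, hx⟩ : Site v m) ∈ A
    · by_cases hy : ∃ hy : y ∈ tree v m, (⟨y, hy⟩ : Site v m) ∈ A
      · rw [hA x hx, hA x hx, hA y hy, hA y hy]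
      · rw [hA x hx, hA x hx, hA' y hy, hA' y hy, hB y hy]
        rintro ⟨hy1, hy2⟩
        obtain ⟨hx1, hx2⟩ := hx
        exact hadj _ hx2 _ hy2 hxy
    · by_cases hy : ∃ hy : y ∈ tree v m, (⟨y, hy⟩ : Site v m) ∈ A
      · rw [hA y hy, hA y hy, hA' x hx, hA' x hx, hB x hx]
        rintro ⟨hx1, hx2⟩
        obtain ⟨hy1, hy2⟩ := hy
        exact hadj _ hy2 _ hx2 hxy.symm
      · rw [hA' x hx, hA' x hx, hA' y hy, hA' y hy, add_comm]
  have hterm : ∀ x : Vertex b, ∀ i : Fin b,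
      (if i :: x ∈ region v m then spin τ σ x * spin τ σ (i :: x) else 0)
      + (if i :: x ∈ region v m then spin τ σ' x * spin τ σ' (i :: x) else 0)
      = (if i :: x ∈ region v m then
          spin τ (A.piecewise σ σ') x * spin τ (A.piecewise σ σ') (i :: x) else 0)
      + (if i :: x ∈ region v m then
          spin τ (A.piecewise σ' σ) x * spin τ (A.piecewise σ' σ) (i :: x) else 0) := by
    intro x i
    split_ifs
    · exact hedge x _ (Or.inl ⟨i, rfl⟩)
    · rfl
  have hsum := Finset.sum_congr (rfl : region v m = region v m) fun x _ =>
    Finset.sum_congr (rfl : (Finset.univ : Finset (Fin b)) = Finset.univ) fun i _ => hterm x i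
  have hfield := Finset.sum_congr (rfl : tree v m = tree v m) fun x _ => hvert x
  simp only [Finset.sum_add_distrib] at hsum hfield
  unfold energy
  linear_combination β * hsum + β * h * hfield

/-- At most `b + 1` edge terms change, each by at most `2`, and the field term changes by at most `2
|h|`. -/
theorem energy_update_le (hβ : 0 ≤ β) (σ : Config v m) (y : Site v m) (s : ℤˣ) :
    energy β h τ v m (Function.update σ y s) ≤ energy β h τ v m σ + 2 * β * (b + 1 + |h|) := by
  set σ' := Function.update σ y s with hσ'
  have hs : ∀ x, x ≠ (y : Vertex b) → spin τ σ' x = spin τ σ x := by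
    intro x hx
    refine spin_congr τ fun hx' => ?_
    rw [hσ', Function.update_of_ne]
    exact fun h' => hx (congrArg Subtype.val h')
  have hedge : ∀ x : Vertex b, ∀ i : Fin b,
      (if i :: x ∈ region v m then spin τ σ' x * spin τ σ' (i :: x) else 0)
      - (if i :: x ∈ region v m then spin τ σ x * spin τ σ (i :: x) else 0)
      ≤ 2 * (if x = y then 1 else 0) + 2 * (if i :: x = y then 1 else 0) := by
    intro x i
    have h1 : ∀ ρ : Config v m, |spin τ ρ x * spin τ ρ (i :: x)| = 1 := by
      intro ρ; rw [abs_mul, abs_spin, abs_spin, one_mul]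
    have h2 := (abs_le.1 (h1 σ).le).1
    have h3 := (abs_le.1 (h1 σ').le).2
    by_cases hr : i :: x ∈ region v m
    · rw [if_pos hr, if_pos hr]
      by_cases hx : x = y
      · rw [if_pos hx]
        split_ifs <;> linarith
      · by_cases hix : i :: x = y
        · rw [if_neg hx, if_pos hix]; linarith
        · rw [if_neg hx, if_neg hix, hs x hx, hs _ hix]; linarith
    · rw [if_neg hr, if_neg hr]
      split_ifs <;> norm_num
  have hfield : h * ∑ x ∈ tree v m, spin τ σ' x - h * ∑ x ∈ tree v m, spin τ σ x ≤ 2 * |h| := by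
    rw [← mul_sub, ← Finset.sum_sub_distrib, Finset.sum_eq_single_of_mem (y : Vertex b) y.2
      fun x _ hx => by rw [hs x hx, sub_self]]
    refine (le_abs_self _).trans ?_
    rw [abs_mul, mul_comm]
    refine mul_le_mul_of_nonneg_right ((abs_sub _ _).trans ?_) (abs_nonneg h)
    rw [abs_spin, abs_spin]; norm_num
  have hsum := Finset.sum_le_sum fun x (_ : x ∈ region v m) =>
    Finset.sum_le_sum fun i (_ : i ∈ (Finset.univ : Finset (Fin b))) => hedge x i
  simp only [Finset.sum_sub_distrib, Finset.sum_add_distrib, ← Finset.mul_sum] at hsum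
  have hc1 : (∑ x ∈ region v m, ∑ _i : Fin b, if x = (y : Vertex b) then (1 : ℝ) else 0) ≤ b := by
    simp only [Finset.sum_const, Finset.card_univ, Fintype.card_fin, nsmul_eq_mul,
      ← Finset.mul_sum, Finset.sum_ite_eq']
    split_ifs <;> simp
  have hc2 : (∑ x ∈ region v m, ∑ i : Fin b, if i :: x = (y : Vertex b) then (1 : ℝ) else 0) ≤ 1 := by
    rcases hy : (y : Vertex b) with _ | ⟨j, z⟩
    · simp
    · have : ∀ x, (∑ i : Fin b, if i :: x = j :: z then (1 : ℝ) else 0) = if x = z then 1 else 0 := by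
        intro x
        by_cases hx : x = z <;> simp [hx]
      rw [Finset.sum_congr rfl fun x _ => this x, Finset.sum_ite_eq']
      split_ifs <;> simp
  unfold energy
  nlinarith [mul_le_mul_of_nonneg_left (add_le_add hsum hfield) hβ,
    mul_le_mul_of_nonneg_left hc1 hβ, mul_le_mul_of_nonneg_left hc2 hβ]

end Geometry

end IsingTree

/-! ### Pinsker's inequality and covariances on two points -/

/-- Pinsker's inequality for Bernoulli distributions. -/
theorem two_mul_sq_sub_le_bernoulli_kl {x p : ℝ} (hx0 : 0 < x) (hx1 : x < 1) (hp0 : 0 < p)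
    (hp1 : p < 1) :
    2 * (x - p) ^ 2 ≤ x * (log x - log p) + (1 - x) * (log (1 - x) - log (1 - p)) := by
  -- As a function of `p` the difference vanishes at `p = x`. Its derivative has the sign of `p - x`
  -- or vanishes, because `p (1 - p) ≤ 1 / 4`.
  set G : ℝ → ℝ := fun p => x * (log x - log p) + (1 - x) * (log (1 - x) - log (1 - p))
    - 2 * (x - p) ^ 2 with hG
  have hder : ∀ t, 0 < t → t < 1 →
      HasDerivAt G ((t - x) * (1 / (t * (1 - t)) - 4)) t := by
    intro t h0 h1
    have h2 : (1 - t) ≠ 0 := by linarith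
    have e1 : HasDerivAt (fun p => x * (log x - log p)) (x * (0 - t⁻¹)) t :=
      ((hasDerivAt_const t (log x)).sub (hasDerivAt_log h0.ne')).const_mul x
    have e2 : HasDerivAt (fun p => log (1 - p)) ((0 - 1) / (1 - t)) t :=
      ((hasDerivAt_const t (1 : ℝ)).sub (hasDerivAt_id t)).log h2
    have e3 : HasDerivAt (fun p => (1 - x) * (log (1 - x) - log (1 - p)))
        ((1 - x) * (0 - (0 - 1) / (1 - t))) t :=
      ((hasDerivAt_const t (log (1 - x))).sub e2).const_mul (1 - x)
    have e4 : HasDerivAt (fun p : ℝ => 2 * (x - p) ^ 2)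
        (2 * (((2 : ℕ) : ℝ) * (x - t) ^ (2 - 1) * (0 - 1))) t :=
      (((hasDerivAt_const t x).sub (hasDerivAt_id t)).pow 2).const_mul 2
    refine ((e1.add e3).sub e4).congr_deriv ?_
    field_simp
    ring
  have hfac : ∀ t : ℝ, 0 < t → t < 1 → 0 ≤ 1 / (t * (1 - t)) - 4 := by
    intro t h0 h1
    have h2 : 0 < t * (1 - t) := mul_pos h0 (by linarith)
    rw [sub_nonneg, le_div_iff₀ h2]
    nlinarith [sq_nonneg (2 * t - 1)]
  have hGx : G x = 0 := by simp [hG]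
  suffices 0 ≤ G p by simp only [hG] at this; linarith
  rcases le_total p x with hpx | hpx
  · have hanti : AntitoneOn G (Set.Icc p x) := by
      refine antitoneOn_of_deriv_nonpos (convex_Icc p x) (fun t ht =>
        (hder t (hp0.trans_le ht.1) (ht.2.trans_lt hx1)).continuousAt.continuousWithinAt) ?_ ?_
      all_goals
        intro t ht
        rw [interior_Icc] at ht
        have hd := hder t (hp0.trans ht.1) (ht.2.trans hx1)
      · exact hd.differentiableAt.differentiableWithinAt
      · rw [hd.deriv]
        exact mul_nonpos_of_nonpos_of_nonneg (by linarith [ht.2])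
          (hfac t (hp0.trans ht.1) (ht.2.trans hx1))
    rw [← hGx]
    exact hanti (Set.left_mem_Icc.2 hpx) (Set.right_mem_Icc.2 hpx) hpx
  · have hmono : MonotoneOn G (Set.Icc x p) := by
      refine monotoneOn_of_deriv_nonneg (convex_Icc x p) (fun t ht =>
        (hder t (hx0.trans_le ht.1) (ht.2.trans_lt hp1)).continuousAt.continuousWithinAt) ?_ ?_
      all_goals
        intro t ht
        rw [interior_Icc] at ht
        have hd := hder t (hx0.trans ht.1) (ht.2.trans hp1)
      · exact hd.differentiableAt.differentiableWithinAt
      · rw [hd.deriv]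
        exact mul_nonneg (by linarith [ht.1]) (hfac t (hx0.trans ht.1) (ht.2.trans hp1))
    rw [← hGx]
    exact hmono (Set.left_mem_Icc.2 hpx) (Set.right_mem_Icc.2 hpx) hpx

/-- Pinsker's inequality for a positive function on a two-point space. -/
theorem two_point_pinsker {p q a a' m : ℝ} (hp : 0 < p) (hq : 0 < q) (hpq : p + q = 1)
    (ha : 0 < a) (ha' : 0 < a') (hm : p * a + q * a' = m) :
    2 * (p * (a - m)) ^ 2 ≤ m * (p * (a * log a) + q * (a' * log a') - m * log m) := by
  have h1 : 0 < p * a := mul_pos hp ha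
  have h2 : 0 < q * a' := mul_pos hq ha'
  have hm0 : 0 < m := by linarith
  -- Apply the Bernoulli inequality to the law with density `a / m` and multiply by `m ^ 2`.
  have hx0 : 0 < p * a / m := div_pos h1 hm0
  have hx1 : p * a / m < 1 := by rw [div_lt_one hm0]; linarith
  have key := two_mul_sq_sub_le_bernoulli_kl hx0 hx1 hp (by linarith)
  have e1 : 1 - p * a / m = q * a' / m := by field_simp; linarith
  have e2 : 1 - p = q := by linarith
  rw [e1, e2, log_div h1.ne' hm0.ne', log_div h2.ne' hm0.ne', log_mul hp.ne' ha.ne',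
    log_mul hq.ne' ha'.ne'] at key
  have e3 := mul_le_mul_of_nonneg_left key (sq_nonneg m)
  have e4 : m ^ 2 * (2 * (p * a / m - p) ^ 2) = 2 * (p * (a - m)) ^ 2 := by
    field_simp
  have e5 : m ^ 2 * (p * a / m * (log p + log a - log m - log p)
      + q * a' / m * (log q + log a' - log m - log q))
      = m * (p * (a * log a) + q * (a' * log a') - (p * a + q * a') * log m) := by
    field_simp
    ring
  rw [e4, e5, hm] at e3
  exact e3

/-- With `u = p (k - m)` and `u' = p (a - m)` the covariance is `u u' / (p q)`, and Pinsker bounds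
both `u` and `u'` by square roots of entropies. The factor `P` in the bound for `k` compensates the
division by `p q`, since `P ≤ 2 p q`. -/
theorem two_point_covariance_le {p q a a' k k' m α P E : ℝ} (hp : 0 < p) (hq : 0 < q)
    (hpq : p + q = 1) (ha : 0 < a) (ha' : 0 < a') (hk : 0 < k) (hk' : 0 < k')
    (hma : p * a + q * a' = m) (hmk : p * k + q * k' = m) (hP : 0 ≤ P) (hα : 0 ≤ α)
    (hPp : P ≤ p) (hPq : P ≤ q) (hE : 0 ≤ E)
    (hka : p * (k * log k) + q * (k' * log k') - m * log m ≤ (α * P) ^ 2 * E)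
    (haE : p * (a * log a) + q * (a' * log a') - m * log m ≤ E) :
    (p * (k * a) + q * (k' * a')) / m - m ≤ α * E := by
  have hm : 0 < m := by rw [← hma]; exact add_pos (mul_pos hp ha) (mul_pos hq ha')
  have h1 := (two_point_pinsker hp hq hpq ha ha' hma).trans (mul_le_mul_of_nonneg_left haE hm.le)
  have h2 := (two_point_pinsker hp hq hpq hk hk' hmk).trans (mul_le_mul_of_nonneg_left hka hm.le)
  set u := p * (k - m)
  set u' := p * (a - m)
  have h3 : 2 * (u * u') ≤ m * (α * P * E) := by
    refine abs_le_of_sq_le_sq' (b := m * (α * P * E)) ?_ (by positivity) |>.2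
    have := mul_le_mul h2 h1 (by positivity) (by positivity)
    nlinarith [this]
  have hPpq : P ≤ 2 * (p * q) := by
    rcases le_total p q with h | h <;> nlinarith
  have hcov : p * q * ((p * (k * a) + q * (k' * a')) - m ^ 2) = u * u' := by
    have e1 : q * k' = m - p * k := by linarith
    have e2 : q * a' = m - p * a := by linarith
    have e3 : p * q * (p * (k * a) + q * (k' * a') - m ^ 2)
        = p * (q * (p * (k * a)) + (q * k') * (q * a') - q * m ^ 2) := by ring
    rw [e3, e1, e2]
    have e4 : q = 1 - p := by linarith
    rw [e4]; simp only [u, u']; ring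
  rw [sub_le_iff_le_add, div_le_iff₀ hm]
  have hpq0 : 0 < p * q := mul_pos hp hq
  have h4 : p * q * ((p * (k * a) + q * (k' * a')) - m ^ 2) ≤ p * q * (m * (α * E)) := by
    rw [hcov]
    have : m * (α * P * E) ≤ m * (α * E) * (2 * (p * q)) := by
      have := mul_le_mul_of_nonneg_left hPpq (show 0 ≤ m * (α * E) by positivity)
      linarith
    linarith
  have := le_of_mul_le_mul_left h4 hpq0
  linarith

/-! ### Projection onto a single spin -/

namespace SpinSystem

variable {S : Type*} [Fintype S] [DecidableEq S] (H : (S → ℤˣ) → ℝ)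

/-- The conditional probability that the spin at `x` is `s`. -/
def prob (A : Finset S) (x : S) (s : ℤˣ) (η : S → ℤˣ) : ℝ :=
  cexp H A (fun σ => if σ x = s then 1 else 0) η

theorem prob_add_prob (A : Finset S) (x : S) (η : S → ℤˣ) :
    prob H A x 1 η + prob H A x (-1) η = 1 := by
  unfold prob
  rw [← cexp_add]
  refine Eq.trans (cexp_congr_fiber H fun σ _ => ?_) (cexp_one H A η)
  rcases Int.units_eq_one_or (σ x) with h | h <;> simp [h]

theorem agree_update {A : Finset S} {x : S} (hx : x ∈ A) (s : ℤˣ) (η : S → ℤˣ) :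
    Agree A η (Function.update η x s) := by
  intro y hy
  rw [Function.update_of_ne]
  rintro rfl
  exact hy hx

theorem prob_pos {A : Finset S} {x : S} (hx : x ∈ A) (s : ℤˣ) (η : S → ℤˣ) :
    0 < prob H A x s η := by
  refine (cexp_nonneg H (fun σ => ?_) η).lt_of_ne' fun h => ?_
  · split_ifs <;> norm_num
  · have hag := agree_update hx s η
    have := eq_zero_of_cexp_eq_zero H (fun σ => by split_ifs <;> norm_num) h hag
    simp at this

theorem cexp_eq_prob_add {A : Finset S} {x : S} {F : (S → ℤˣ) → ℝ} (hF : Inv (A.erase x) F)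
    (η : S → ℤˣ) : cexp H A F η = prob H A x 1 η * F (Function.update η x 1)
      + prob H A x (-1) η * F (Function.update η x (-1)) := by
  have : cexp H A F η = cexp H A (fun σ => F (Function.update η x 1) * (if σ x = 1 then 1 else 0)
      + F (Function.update η x (-1)) * (if σ x = -1 then 1 else 0)) η := by
    refine cexp_congr_fiber H fun σ hσ => ?_
    have hup : ∀ s, σ x = s → F σ = F (Function.update η x s) := by
      intro s hs
      refine hF _ _ fun y hy => ?_
      by_cases hyx : y = x
      · subst hyx; simp [hs]
      · rw [Function.update_of_ne hyx]
        exact hσ y fun hyA => hy (Finset.mem_erase.2 ⟨hyx, hyA⟩)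
    rcases Int.units_eq_one_or (σ x) with h | h
    · rw [hup 1 h]; simp [h]
    · rw [hup (-1) h]; simp [h]
  rw [this, cexp_add, cexp_const_mul, cexp_const_mul, mul_comm, mul_comm (F _) (cexp _ _ _ _)]
  rfl

/-- The projection onto the spin at `x` loses little entropy if the projection of functions that
do not depend on `B` does. -/
theorem cent_cexp_erase_le {A B : Finset S} {x : S} (hx : x ∈ A) (hB : B ⊆ A)
    {f : (S → ℤˣ) → ℝ} (hf : ∀ σ, 0 < f σ) {α P : ℝ} (hα : 0 ≤ α) (hP : 0 ≤ P) (η : S → ℤˣ)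
    (hPs : ∀ s, P ≤ prob H A x s η)
    (hmix : cent H A (cexp H (A.erase x) (cexp H B f)) η
      ≤ (α * P) ^ 2 * cent H A (cexp H B f) η) :
    cent H A (cexp H (A.erase x) f) η ≤ cexp H A (cent H B f) η + α * cent H A f η := by
  set a := cexp H (A.erase x) f with ha
  set g := cexp H B f with hg
  set k := cexp H (A.erase x) g with hk
  set m := cexp H A f η with hm
  have hAx : A.erase x ⊆ A := Finset.erase_subset x A
  have a0 : ∀ σ, 0 < a σ := cexp_pos H hf
  have g0 : ∀ σ, 0 < g σ := cexp_pos H hf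
  have k0 : ∀ σ, 0 < k σ := cexp_pos H g0
  have m0 : 0 < m := cexp_pos H hf η
  have ma : cexp H A a η = m := cexp_tower H hAx f η
  have mg : cexp H A g η = m := cexp_tower H hB f η
  have mk : cexp H A k η = m := (cexp_tower H hAx g η).trans mg
  have ia : Inv (A.erase x) a := cexp_inv H _ _
  have ik : Inv (A.erase x) k := cexp_inv H _ _
  -- This is `log t ≤ t - 1` at `t = a g / (m f)`. Integrated, it bounds the entropy of `a` by the
  -- mean of `cent H B f` plus the covariance of `a` and `g` divided by `m`.
  have hpt : ∀ σ, f σ - 1 / m * (a σ * g σ)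
      ≤ f σ * log (f σ) - log (g σ) * f σ - (log (a σ) * f σ - log m * f σ) := by
    intro σ
    have e := log_le_sub_one_of_pos (div_pos (mul_pos (g0 σ) (a0 σ)) (mul_pos m0 (hf σ)))
    rw [log_div (mul_pos (g0 σ) (a0 σ)).ne' (mul_pos m0 (hf σ)).ne',
      log_mul (g0 σ).ne' (a0 σ).ne', log_mul m0.ne' (hf σ).ne'] at e
    have e' := mul_le_mul_of_nonneg_left e (hf σ).le
    have e3 : f σ * (g σ * a σ / (m * f σ) - 1) = 1 / m * (a σ * g σ) - f σ := by
      have := (hf σ).ne'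
      field_simp
    rw [e3] at e'
    linarith
  have hint := cexp_mono H (A := A) hpt η
  have ea : cexp H A (fun σ => log (a σ) * f σ) η = cexp H A (fun σ => a σ * log (a σ)) η := by
    rw [← cexp_mul_cexp H hAx (ia.comp log) f η]
    simp only [mul_comm (log _), ← ha]
  have eg : cexp H A (fun σ => log (g σ) * f σ) η = cexp H A (fun σ => g σ * log (g σ)) η := by
    rw [← cexp_mul_cexp H hB ((cexp_inv H B f).comp log) f η]
    simp only [mul_comm (log _), ← hg]
  -- Within `A`, `a` depends only on the spin at `x`, so `g` may be replaced by its projection `k`;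
  -- what remains is a covariance on two points.
  have ek : cexp H A (fun σ => a σ * g σ) η = cexp H A (fun σ => k σ * a σ) η := by
    rw [← cexp_mul_cexp H hAx ia g η]
    simp only [mul_comm (a _), ← hk]
  rw [cexp_sub, cexp_const_mul, cexp_sub, cexp_sub, cexp_sub, cexp_const_mul, ea, eg, ek, ← hm] at hint
  have hcB : cexp H A (cent H B f) η = cexp H A (fun σ => f σ * log (f σ)) η
      - cexp H A (fun σ => g σ * log (g σ)) η := by
    rw [← cexp_tower H hB (fun σ => f σ * log (f σ)), ← cexp_sub]
    rfl
  have hca : cent H A a η = cexp H A (fun σ => a σ * log (a σ)) η - m * log m := by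
    unfold cent; rw [ma]
  have hck : cent H A k η = cexp H A (fun σ => k σ * log (k σ)) η - m * log m := by
    unfold cent; rw [mk]
  have hcov := two_point_covariance_le (p := prob H A x 1 η) (q := prob H A x (-1) η)
    (a := a (Function.update η x 1)) (a' := a (Function.update η x (-1)))
    (k := k (Function.update η x 1)) (k' := k (Function.update η x (-1))) (m := m) (α := α) (P := P)
    (E := cent H A f η) (prob_pos H hx 1 η) (prob_pos H hx (-1) η) (prob_add_prob H A x η)
    (a0 _) (a0 _) (k0 _) (k0 _)
    (by rw [← cexp_eq_prob_add H ia, ma]) (by rw [← cexp_eq_prob_add H ik, mk]) hP hα (hPs 1)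
    (hPs (-1)) (cent_nonneg H (fun σ => (hf σ).le) η)
    (by
      rw [← cexp_eq_prob_add H (ik.comp fun t => t * log t), ← hck]
      exact hmix.trans (mul_le_mul_of_nonneg_left
        (cent_cexp_le_cent H hB (fun σ => (hf σ).le) η) (sq_nonneg _)))
    (by
      rw [← cexp_eq_prob_add H (ia.comp fun t => t * log t), ← hca]
      exact cent_cexp_le_cent H hAx (fun σ => (hf σ).le) η)
  have ika : Inv (A.erase x) (fun σ => k σ * a σ) := fun η σ h => by
    beta_reduce; rw [ik η σ h, ia η σ h]
  rw [← cexp_eq_prob_add H ika, div_eq_mul_one_div, mul_comm _ (1 / m)] at hcov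
  rw [hca, hcB]
  linarith

theorem cexp_empty (f : (S → ℤˣ) → ℝ) : cexp H ∅ f = f := by
  funext η
  refine cexp_of_inv H (fun η σ h => ?_) η
  rw [funext fun x => h x (Finset.notMem_empty x)]

theorem continuous_cexp {A : Finset S} {F : ℝ → (S → ℤˣ) → ℝ} (hF : ∀ σ, Continuous fun t => F t σ)
    (η : S → ℤˣ) : Continuous fun t => cexp H A (F t) η := by
  unfold cexp
  refine Continuous.div_const (continuous_finsetSum _ fun σ _ => ?_) _
  split_ifs
  · exact continuous_const.mul (hF σ)
  · exact continuous_const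

theorem continuous_cent {A : Finset S} {F : ℝ → (S → ℤˣ) → ℝ} (hF : ∀ σ, Continuous fun t => F t σ)
    (η : S → ℤˣ) : Continuous fun t => cent H A (F t) η := by
  unfold cent
  exact (continuous_cexp H (fun σ => Real.continuous_mul_log.comp (hF σ)) η).sub
    (Real.continuous_mul_log.comp (continuous_cexp H hF η))

end SpinSystem

/-! ### Entropy mixing implies the block entropy inequality -/

namespace IsingTree

open SpinSystem

variable {b : ℕ} {v : Vertex b} {m : ℕ}

/-- The sites below `x`, including `x`. -/
def below (x : Site v m) : Finset (Site v m) :=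
  Finset.univ.filter fun y => (x : Vertex b) <:+ (y : Vertex b)

/-- The first `ℓ` levels below `x`. -/
def top (x : Site v m) (ℓ : ℕ) : Finset (Site v m) :=
  (below x).filter fun y => (y : Vertex b).length < (x : Vertex b).length + ℓ

theorem mem_below {x y : Site v m} : y ∈ below x ↔ (x : Vertex b) <:+ (y : Vertex b) := by
  simp [below]

theorem mem_top {x y : Site v m} {ℓ : ℕ} : y ∈ top x ℓ ↔ (x : Vertex b) <:+ (y : Vertex b) ∧
    (y : Vertex b).length < (x : Vertex b).length + ℓ := by
  simp [top, mem_below]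

theorem self_mem_below (x : Site v m) : x ∈ below x := mem_below.2 (List.suffix_refl _)

theorem top_subset_below (x : Site v m) (ℓ : ℕ) : top x ℓ ⊆ below x := Finset.filter_subset _ _

theorem below_subset {x y : Site v m} (h : y ∈ below x) : below y ⊆ below x :=
  fun _ hz => mem_below.2 ((mem_below.1 h).trans (mem_below.1 hz))

theorem sites_subtree (x : Site v m) : sites v m (subtree v m x) = below x := by
  ext y
  simp [mem_sites, subtree, mem_below, y.2]

theorem sites_subtreeTilde (x : Site v m) : sites v m (subtreeTilde v m x) = (below x).erase x := by
  ext y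
  rw [mem_sites, subtreeTilde, Finset.mem_erase, Finset.mem_erase, ← mem_sites, sites_subtree, Ne, Ne,
    Subtype.ext_iff]

theorem sites_block (x : Site v m) (ℓ : ℕ) : sites v m (block v m x ℓ) = top x ℓ := by
  ext y
  simp [mem_sites, block, subtree, mem_top, y.2]

theorem subtree_subset (x : Vertex b) : subtree v m x ⊆ tree v m := Finset.filter_subset _ _

theorem subtreeTilde_subset (x : Vertex b) : subtreeTilde v m x ⊆ tree v m :=
  (Finset.erase_subset _ _).trans (subtree_subset x)

theorem block_subset (x : Vertex b) (ℓ : ℕ) : block v m x ℓ ⊆ tree v m :=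
  (Finset.filter_subset _ _).trans (subtree_subset x)

variable (β h : ℝ) (τ : Vertex b → ℤˣ)

theorem entropyMixing_iff {ℓ : ℕ} {ε : ℝ} : EntropyMixing β h τ v m ℓ ε ↔
    ∀ (x : Site v m) (η : Config v m) (f : Config v m → ℝ), (∀ σ, 0 ≤ f σ) → Inv (top x ℓ) f →
      cent (energy β h τ v m) (below x) (cexp (energy β h τ v m) ((below x).erase x) f) η
        ≤ ε * cent (energy β h τ v m) (below x) f η := by
  have hdep : ∀ (x : Site v m) (f : Config v m → ℝ),
      DependsOn f {y : Site v m | (y : Vertex b) ∉ block v m x ℓ} ↔ Inv (top x ℓ) f := by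
    intro x f
    constructor
    · intro hf η σ hσ
      refine hf fun y hy => hσ y ?_
      rwa [← sites_block, mem_sites]
    · intro hf σ η hση
      refine hf η σ fun y hy => hση y ?_
      rwa [← sites_block, mem_sites] at hy
  unfold EntropyMixing
  constructor
  · intro H x η f hf hi
    have := H x x.2 η f hf ((hdep x f).2 hi)
    rwa [ent_eq _ _ _ (subtree_subset _), ent_eq _ _ _ (subtree_subset _),
      expect_eq _ _ _ (subtreeTilde_subset _), sites_subtree, sites_subtreeTilde] at this
  · intro H x hx η f hf hi
    have := H ⟨x, hx⟩ η f hf ((hdep ⟨x, hx⟩ f).1 hi)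
    rwa [ent_eq _ _ _ (subtree_subset _), ent_eq _ _ _ (subtree_subset _),
      expect_eq _ _ _ (subtreeTilde_subset _), sites_subtree ⟨x, hx⟩, sites_subtreeTilde ⟨x, hx⟩]

theorem pMin_le (x : Site v m) (s : ℤˣ) (η : Config v m) :
    pMin β h τ v m ≤ prob (energy β h τ v m) (below x) x s η := by
  have := ciInf_le (Set.finite_range fun q : Site v m × ℤˣ × Config v m =>
    expect β h τ (subtree v m q.1) (fun σ => if σ q.1 = q.2.1 then 1 else 0) q.2.2).bddBelow
    (x, s, η)
  refine this.trans (le_of_eq ?_)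
  rw [expect_eq _ _ _ (subtree_subset _), sites_subtree]
  rfl

instance : Nonempty (Site v m) := ⟨⟨v, mem_tree.2 ⟨List.suffix_refl _, by omega⟩⟩⟩

theorem pMin_nonneg : 0 ≤ pMin β h τ v m := by
  refine le_ciInf fun q => ?_
  rw [expect_eq _ _ _ (subtree_subset _)]
  exact cexp_nonneg _ (fun σ => by split_ifs <;> norm_num) _

theorem pMin_le_half : pMin β h τ v m ≤ 1 / 2 := by
  have x : Site v m := Classical.arbitrary _
  have h1 := pMin_le β h τ x 1 1
  have h2 := pMin_le β h τ x (-1) 1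
  have h3 := prob_add_prob (energy β h τ v m) (below x) x 1
  linarith

/-- Entropy mixing with a constant below `1` fails for empty blocks. -/
theorem not_entropyMixing_zero {ε : ℝ} (hε : ε < 1) : ¬ EntropyMixing β h τ v m 0 ε := by
  rw [entropyMixing_iff]
  intro hmix
  have x : Site v m := Classical.arbitrary _
  -- With an empty block this indicator is admissible and is its own projection, so mixing would
  -- force its entropy to vanish although it is not constant.
  let f : Config v m → ℝ := fun σ => if σ x = 1 then 1 else 0
  have hf : ∀ σ, 0 ≤ f σ := fun σ => by simp only [f]; split_ifs <;> norm_num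
  have htop : top x 0 = ∅ := by
    ext y
    simp only [mem_top, Finset.notMem_empty, iff_false, not_and, not_lt, add_zero]
    exact fun hxy => hxy.length_le
  have hi : Inv ((below x).erase x) f := by
    intro η σ hσ
    simp only [f]
    rw [hσ x (Finset.notMem_erase _ _)]
  have h1 := hmix x 1 f hf (by
    rw [htop]; intro η σ hσ; rw [funext fun x => hσ x (Finset.notMem_empty x)])
  rw [funext (cexp_of_inv _ hi)] at h1
  have h2 := cexp_sqrt_sub_sq_le_cent (energy β h τ v m) (A := below x) hf 1
  set c := cexp (energy β h τ v m) (below x) f 1 with hc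
  have h4 := cent_nonneg (energy β h τ v m) (A := below x) hf 1
  have h5 : cexp (energy β h τ v m) (below x) (fun σ => (√(f σ) - √c) ^ 2) 1 = 0 := by
    refine le_antisymm (h2.trans ?_) (cexp_nonneg _ (fun _ => sq_nonneg _) _)
    nlinarith
  have h6 := fun s => eq_zero_of_cexp_eq_zero _ (fun _ => sq_nonneg _) h5
    (agree_update (self_mem_below x) s 1)
  have h7 := h6 1
  have h8 := h6 (-1)
  simp [f] at h7 h8
  rw [h8] at h7
  norm_num at h7

theorem child_mem_below {x y : Site v m} : y ∈ below x ↔ y = x ∨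
    ∃ (i : Fin b) (z : Vertex b), (y : Vertex b) = i :: z ∧ (x : Vertex b) <:+ z := by
  rw [mem_below]
  constructor
  · intro hxy
    rcases hy : (y : Vertex b) with _ | ⟨i, z⟩
    · rw [hy, List.suffix_nil] at hxy
      exact Or.inl (Subtype.ext (hy.trans hxy.symm))
    · rw [hy, List.suffix_cons_iff] at hxy
      rcases hxy with h | h
      · exact Or.inl (Subtype.ext (hy.trans h.symm))
      · exact Or.inr ⟨i, z, rfl, h⟩
  · rintro (rfl | ⟨i, z, h1, h2⟩)
    · exact List.suffix_refl _
    · rw [h1]; exact h2.trans (List.suffix_cons _ _)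

/-- Removing a subtree from a set that does not contain the parent of its root leaves a set
that does not interact with the subtree. -/
theorem uncoupled_below {x : Site v m} {A R : Finset (Site v m)} (hA : A ⊆ below x)
    (hR : ∀ y ∈ R, y ∉ below x) (hpar : ∀ y ∈ R, ∀ i : Fin b, (x : Vertex b) ≠ i :: (y : Vertex b)) :
    Uncoupled (energy β h τ v m) A R := by
  refine uncoupled_of_not_adjacent β h τ (Finset.disjoint_left.2 fun y hy hy' => hR y hy' (hA hy)) ?_
  rintro z hz u hu (⟨i, hi⟩ | ⟨i, hi⟩)
  · exact hR u hu (mem_below.2 (hi ▸ (mem_below.1 (hA hz)).trans (List.suffix_cons _ _)))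
  · rcases child_mem_below.1 (hA hz) with rfl | ⟨j, w, h1, h2⟩
    · exact hpar u hu i hi
    · rw [hi] at h1
      injection h1 with _ h1
      exact hR u hu (mem_below.2 (h1 ▸ h2))

/-- The chain rule for the entropy along the tree. -/
theorem cent_cexp_le_sum {f : Config v m → ℝ} (hf : ∀ σ, 0 < f σ) {D : Finset (Site v m)}
    (hD : ∀ y ∈ D, below y ⊆ D) (n : ℕ) : ∀ A : Finset (Site v m), (∀ y ∈ A, below y ⊆ A) → D ⊆ A →
    (A \ D).card = n → ∀ η, cent (energy β h τ v m) A (cexp (energy β h τ v m) D f) η ≤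
      ∑ y ∈ A \ D, cexp (energy β h τ v m) A (cent (energy β h τ v m) (below y)
        (cexp (energy β h τ v m) ((below y).erase y) f)) η := by
  set H := energy β h τ v m
  induction n with
  | zero =>
    intro A hA hDA hn η
    have : A = D := Finset.Subset.antisymm (Finset.sdiff_eq_empty_iff_subset.1
      (Finset.card_eq_zero.1 hn)) hDA
    subst this
    rw [cent_of_inv H (cexp_inv H A f), Finset.sdiff_self, Finset.sum_empty]
  | succ n ih =>
    intro A hA hDA hn η
    have hne : (A \ D).Nonempty := Finset.card_pos.1 (by omega)
    -- A site of least depth in `A \ D` has no parent in `A`: a parent in `D` would bring the site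
    -- into `D`, and a parent outside `D` would be less deep.
    obtain ⟨y, hy, hmin⟩ := Finset.exists_min_image (A \ D) (fun y => (y : Vertex b).length) hne
    have hyA := (Finset.mem_sdiff.1 hy).1
    have hyD := (Finset.mem_sdiff.1 hy).2
    have hpar : ∀ z ∈ A, ∀ i : Fin b, (y : Vertex b) ≠ i :: (z : Vertex b) := by
      intro z hz i hi
      by_cases hzD : z ∈ D
      · exact hyD (hD z hzD (mem_below.2 (hi ▸ List.suffix_cons _ _)))
      · have := hmin z (Finset.mem_sdiff.2 ⟨hz, hzD⟩)
        rw [hi, List.length_cons] at this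
        omega
    set A' := A.erase y with hA'
    have hA'A : A' ⊆ A := Finset.erase_subset _ _
    have hDA' : D ⊆ A' := fun z hz => Finset.mem_erase.2 ⟨fun e => hyD (e ▸ hz), hDA hz⟩
    have hA'down : ∀ z ∈ A', below z ⊆ A' := by
      intro z hz u hu
      have hzA := (Finset.mem_erase.1 hz).2
      refine Finset.mem_erase.2 ⟨?_, hA z hzA hu⟩
      rintro rfl
      rcases child_mem_below.1 hu with rfl | ⟨i, w, h1, h2⟩
      · exact (Finset.mem_erase.1 hz).1 rfl
      · have hwt : w ∈ tree v m := by
          have h3 := mem_tree.1 u.2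
          have h4 := mem_tree.1 z.2
          rw [h1, List.length_cons] at h3
          exact mem_tree.2 ⟨h4.1.trans h2, by omega⟩
        exact hpar ⟨w, hwt⟩ (hA z hzA (mem_below.2 h2)) i h1
    have hsd : A \ D = insert y (A' \ D) := by
      rw [hA', Finset.erase_sdiff_comm, Finset.insert_erase hy]
    have hy' : y ∉ A' \ D := fun hh => (Finset.mem_erase.1 (Finset.mem_sdiff.1 hh).1).1 rfl
    have hn' : (A' \ D).card = n := by
      rw [hsd, Finset.card_insert_of_notMem hy'] at hn; omega
    rw [cent_chain H hA'A, funext (cexp_tower H hDA' f), hsd, Finset.sum_insert hy', add_comm]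
    refine add_le_add ?_ ?_
    -- Averaging over `A.erase y` means projecting onto `y` inside `below y` and then averaging over
    -- `R`. The result depends on no spin in `R`, so its entropy lives on `below y`, and convexity
    -- takes the average over `R` outside.
    · set R := A \ below y with hR
      have hbA : below y ⊆ A := hA y hyA
      have hRb : ∀ z ∈ R, z ∉ below y := fun z hz => (Finset.mem_sdiff.1 hz).2
      have hRp : ∀ z ∈ R, ∀ i : Fin b, (y : Vertex b) ≠ i :: (z : Vertex b) :=
        fun z hz => hpar z (Finset.mem_sdiff.1 hz).1
      have u1 : Uncoupled H (below y) R := uncoupled_below β h τ subset_rfl hRb hRp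
      have u2 : Uncoupled H ((below y).erase y) R :=
        uncoupled_below β h τ (Finset.erase_subset _ _) hRb hRp
      have e1 : A = below y ∪ R := by rw [hR, Finset.union_sdiff_of_subset hbA]
      have e2 : A' = R ∪ (below y).erase y := by
        ext z
        simp only [hA', hR, Finset.mem_erase, Finset.mem_union, Finset.mem_sdiff]
        constructor
        · rintro ⟨h1, h2⟩
          by_cases h3 : z ∈ below y
          · exact Or.inr ⟨h1, h3⟩
          · exact Or.inl ⟨h2, h3⟩
        · rintro (⟨h1, h2⟩ | ⟨h1, h2⟩)
          · exact ⟨fun e => h2 (e ▸ self_mem_below y), h1⟩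
          · exact ⟨h1, hbA h2⟩
      set q := cexp H ((below y).erase y) f with hq
      have q0 : ∀ σ, 0 < q σ := cexp_pos H hf
      have hRA : R ⊆ A := Finset.sdiff_subset
      rw [e2, u2.symm.cexp_union, ← hq, ← cexp_of_inv H (cent_inv H A (cexp H R q)) η]
      rw [← cexp_tower H hRA (cent H (below y) q)]
      refine cexp_mono H (fun σ => ?_) η
      have : cent H A (cexp H R q) σ = cent H (below y) (cexp H R q) σ := by
        conv_lhs => rw [e1]
        exact u1.cent_union_of_inv (cexp_inv H R q) σ
      rw [this]
      exact u1.symm.cent_cexp_le q0 σ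
    · refine (cexp_mono H (ih A' hA'down hDA' hn') η).trans (le_of_eq ?_)
      rw [cexp_sum]
      exact Finset.sum_congr rfl fun z _ => cexp_tower H hA'A _ _

/-- The ancestors of `y` form a chain, so each is determined by its distance to `y`, which ranges
over `0, …, ℓ`. -/
theorem card_ancestors_le (y : Site v m) (ℓ : ℕ) :
    (Finset.univ.filter fun x : Site v m => (x : Vertex b) <:+ (y : Vertex b) ∧
      (y : Vertex b).length ≤ (x : Vertex b).length + ℓ).card ≤ ℓ + 1 := by
  rw [← Finset.card_range (ℓ + 1)]
  refine Finset.card_le_card_of_injOn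
    (fun x => (y : Vertex b).length - (x : Vertex b).length) ?_ ?_
  · intro x hx
    have := (Finset.mem_filter.1 hx).2
    simp only [Finset.coe_range, Set.mem_Iio]
    omega
  · intro x hx x' hx' hxx
    have h1 := (Finset.mem_filter.1 hx).2
    have h2 := (Finset.mem_filter.1 hx').2
    have h3 := h1.1.length_le
    have h4 := h2.1.length_le
    simp only at hxx
    have h5 : (x : Vertex b).length = (x' : Vertex b).length := by omega
    exact Subtype.ext ((List.suffix_of_suffix_length_le h1.1 h2.1 h5.le).eq_of_length h5)

theorem sum_top_le {Q : Site v m → ℝ} (hQ0 : ∀ y, 0 ≤ Q y) (ℓ : ℕ) :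
    ∑ x, ∑ y ∈ top x (ℓ + 1), Q y ≤ ((ℓ : ℝ) + 1) * ∑ y, Q y := by
  have h1 : ∑ x, ∑ y ∈ top x (ℓ + 1), Q y = ∑ y : Site v m, ∑ x ∈ (Finset.univ.filter fun x : Site v m =>
      (x : Vertex b) <:+ (y : Vertex b) ∧ (y : Vertex b).length ≤ (x : Vertex b).length + ℓ),
      Q y := by
    refine Finset.sum_comm' fun x y => ?_
    simp [mem_top, ← add_assoc]
  rw [h1, Finset.mul_sum]
  refine Finset.sum_le_sum fun y _ => ?_
  rw [Finset.sum_const, nsmul_eq_mul]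
  refine mul_le_mul_of_nonneg_right ?_ (hQ0 y)
  exact_mod_cast card_ancestors_le y ℓ

theorem blockEntropyForm_eq (ℓ : ℕ) (f : Config v m → ℝ) (η : Config v m) :
    blockEntropyForm β h τ ℓ f = ∑ x : Site v m,
      cexp (energy β h τ v m) Finset.univ (cent (energy β h τ v m) (top x ℓ) f) η := by
  unfold blockEntropyForm
  rw [← Finset.sum_coe_sort]
  refine Finset.sum_congr rfl fun x _ => ?_
  rw [mean_eq β h τ _ η, ent_eq _ _ _ (block_subset _ _), sites_block]

/-- One step of the comparison between the entropy and the block entropy form. -/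
theorem cent_cexp_below_le {ℓ : ℕ} {α P : ℝ} (hα : 0 ≤ α) (hP : 0 ≤ P)
    (hPs : ∀ (x : Site v m) s η, P ≤ prob (energy β h τ v m) (below x) x s η)
    (hmix : EntropyMixing β h τ v m ℓ ((α * P) ^ 2)) {f : Config v m → ℝ} (hf : ∀ σ, 0 < f σ)
    (x : Site v m) (η : Config v m) :
    cent (energy β h τ v m) (below x) (cexp (energy β h τ v m) ((below x).erase x) f) η
    ≤ cexp (energy β h τ v m) (below x) (cent (energy β h τ v m) (top x ℓ) f) η
      + α * ∑ y ∈ top x (ℓ + 1), cexp (energy β h τ v m) (below x) (cent (energy β h τ v m) (below y)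
        (cexp (energy β h τ v m) ((below y).erase y) f)) η := by
  rw [entropyMixing_iff] at hmix
  set H := energy β h τ v m
  -- Mixing is used for `cexp H D f` instead of `f`. The set `D` starts at distance `ℓ + 1` from
  -- `x`, so the level at distance `ℓ` separates it from `top x ℓ`, and the chain rule for `cexp H D
  -- f` involves only sites within distance `ℓ`.
  set D := below x \ top x (ℓ + 1) with hD
  have hmemD : ∀ y, y ∈ D ↔ (x : Vertex b) <:+ (y : Vertex b) ∧
      (x : Vertex b).length + ℓ < (y : Vertex b).length := by
    intro y
    rw [hD, Finset.mem_sdiff, mem_top, mem_below]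
    constructor
    · rintro ⟨h1, h2⟩
      exact ⟨h1, by by_contra h3; exact h2 ⟨h1, by omega⟩⟩
    · rintro ⟨h1, h2⟩
      exact ⟨h1, fun h3 => by omega⟩
  have hDx : D ⊆ (below x).erase x := by
    intro y hy
    have h1 := (hmemD y).1 hy
    refine Finset.mem_erase.2 ⟨?_, mem_below.2 h1.1⟩
    rintro rfl
    omega
  have hDb : D ⊆ below x := Finset.sdiff_subset
  have hDdown : ∀ y ∈ D, below y ⊆ D := by
    intro y hy z hz
    have h1 := (hmemD y).1 hy
    have h2 := mem_below.1 hz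
    exact (hmemD z).2 ⟨h1.1.trans h2, h1.2.trans_le h2.length_le⟩
  have hu : Uncoupled H D (top x ℓ) := by
    refine uncoupled_of_not_adjacent β h τ (Finset.disjoint_left.2 fun y hy hy' => ?_) ?_
    · have h1 := (hmemD y).1 hy
      have h2 := mem_top.1 hy'
      omega
    · intro y hy z hz hyz
      have h1 := (hmemD y).1 hy
      have h2 := mem_top.1 hz
      rcases hyz with ⟨i, hi⟩ | ⟨i, hi⟩
      · rw [hi, List.length_cons] at h2; omega
      · rw [hi, List.length_cons] at h1; omega
  have f0 : ∀ σ, 0 < cexp H D f σ := cexp_pos H hf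
  have key := cent_cexp_erase_le H (self_mem_below x) (top_subset_below x ℓ) f0 hα hP η
    (fun s => hPs x s η) (hmix x η _ (fun σ => (cexp_pos H f0 σ).le) (cexp_inv H _ _))
  have h1 := cexp_mono H (A := below x) (fun σ => hu.cent_cexp_le hf σ) η
  rw [cexp_tower H hDb] at h1
  have h2 := cent_cexp_le_sum β h τ hf hDdown _ (below x) (fun y hy => below_subset hy) hDb rfl η
  rw [hD, Finset.sdiff_sdiff_eq_self (top_subset_below x (ℓ + 1)), ← hD] at h2
  have e : cexp H ((below x).erase x) (cexp H D f) = cexp H ((below x).erase x) f :=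
    funext fun σ => cexp_tower H hDx f σ
  rw [e] at key
  exact key.trans (add_le_add h1 (mul_le_mul_of_nonneg_left h2 hα))

/-- Summing `cent_cexp_below_le` over all sites gives `∑ Q ≤ ∑ E + α (ℓ + 1) ∑ Q`, and the last term
is absorbed on the left. -/
theorem entropy_le_of_pos {ℓ : ℕ} {δ : ℝ} (hδ : 0 < δ) (hδ1 : δ ≤ 1) (hmix : EntropyMixing β h τ v m ℓ
    (((1 - δ) * pMin β h τ v m / ((ℓ : ℝ) + 1 - δ)) ^ 2)) {f : Config v m → ℝ}
    (hf : ∀ σ, 0 < f σ) : entropy β h τ f ≤ 2 / δ * blockEntropyForm β h τ ℓ f := by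
  have hp0 := pMin_nonneg β h τ (v := v) (m := m)
  -- For `ℓ = 0` the hypothesis cannot hold: its constant is the square of `pMin ≤ 1 / 2`, or `0`
  -- when `δ = 1`, where the quotient is `0 / 0`.
  rcases Nat.eq_zero_or_pos ℓ with rfl | hℓ
  · refine absurd hmix (not_entropyMixing_zero β h τ ?_)
    have hp := pMin_le_half β h τ (v := v) (m := m)
    rcases hδ1.eq_or_lt with rfl | hδ1
    · simp
    · have : (1 - δ) * pMin β h τ v m / (((0 : ℕ) : ℝ) + 1 - δ) = pMin β h τ v m := by
        have : 1 - δ ≠ 0 := by linarith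
        push_cast
        rw [zero_add]
        field_simp
      rw [this]
      nlinarith
  have hℓ1 : (1 : ℝ) ≤ ℓ := by exact_mod_cast hℓ
  set α := (1 - δ) / ((ℓ : ℝ) + 1 - δ) with hα
  have hden : 0 < (ℓ : ℝ) + 1 - δ := by linarith
  have hα0 : 0 ≤ α := div_nonneg (by linarith) hden.le
  rw [show (1 - δ) * pMin β h τ v m / ((ℓ : ℝ) + 1 - δ) = α * pMin β h τ v m by
    rw [hα]; ring] at hmix
  have key := cent_cexp_below_le β h τ hα0 hp0 (fun x s η => pMin_le β h τ x s η) hmix hf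
  have hch := cent_cexp_le_sum β h τ hf (D := ∅) (fun y hy => absurd hy (Finset.notMem_empty y)) _
    Finset.univ (fun y _ => Finset.subset_univ _) (Finset.empty_subset _) rfl 1
  rw [entropy_eq β h τ _ 1, blockEntropyForm_eq β h τ _ _ 1]
  set H := energy β h τ v m
  rw [cexp_empty, Finset.sdiff_empty] at hch
  set Q : Site v m → ℝ := fun y => cexp H Finset.univ (cent H (below y)
    (cexp H ((below y).erase y) f)) 1 with hQ
  set E : Site v m → ℝ := fun x => cexp H Finset.univ (cent H (top x ℓ) f) 1 with hE
  have hQ0 : ∀ y, 0 ≤ Q y := fun y => cexp_nonneg H (fun σ => cent_nonneg H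
    (fun ρ => (cexp_pos H hf ρ).le) σ) 1
  have hstep : ∀ x, Q x ≤ E x + α * ∑ y ∈ top x (ℓ + 1), Q y := by
    intro x
    have h1 := cexp_mono H (A := Finset.univ) (key x) 1
    rw [cexp_add, cexp_const_mul, cexp_sum, cexp_tower H (Finset.subset_univ _)] at h1
    simp only [cexp_tower H (Finset.subset_univ _)] at h1
    exact h1
  have hcount : ∑ x, ∑ y ∈ top x (ℓ + 1), Q y ≤ ((ℓ : ℝ) + 1) * ∑ y, Q y := sum_top_le hQ0 ℓ
  have hsum := Finset.sum_le_sum fun x (_ : x ∈ (Finset.univ : Finset (Site v m))) => hstep x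
  rw [Finset.sum_add_distrib, ← Finset.mul_sum] at hsum
  have htot : ∑ x, Q x ≤ ∑ x, E x + α * (((ℓ : ℝ) + 1) * ∑ y, Q y) :=
    hsum.trans (by linarith [mul_le_mul_of_nonneg_left hcount hα0])
  have hQs : 0 ≤ ∑ y, Q y := Finset.sum_nonneg fun y _ => hQ0 y
  refine hch.trans ?_
  have h1 : (1 - α * (ℓ + 1)) * ∑ y, Q y ≤ ∑ x, E x := by linarith
  -- This reduces to `1 - δ ≤ ℓ`, where `1 ≤ ℓ` is used.
  have h2 : δ / 2 ≤ 1 - α * (ℓ + 1) := by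
    have : 1 - α * (ℓ + 1) = δ * ℓ / (ℓ + 1 - δ) := by
      rw [hα]; field_simp; ring
    rw [this, le_div_iff₀ hden]
    nlinarith
  have h3 : δ / 2 * ∑ y, Q y ≤ ∑ x, E x := (mul_le_mul_of_nonneg_right h2 hQs).trans h1
  have h4 := mul_le_mul_of_nonneg_left h3 (show 0 ≤ 2 / δ by positivity)
  have h5 : 2 / δ * (δ / 2 * ∑ y, Q y) = ∑ y, Q y := by field_simp
  rwa [h5] at h4

/-- Entropy mixing implies the block entropy inequality. -/
theorem entropy_le_blockEntropyForm {ℓ : ℕ} {δ : ℝ} (hδ : 0 < δ) (hδ1 : δ ≤ 1)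
    (hmix : EntropyMixing β h τ v m ℓ (((1 - δ) * pMin β h τ v m / ((ℓ : ℝ) + 1 - δ)) ^ 2))
    {f : Config v m → ℝ} (hf : ∀ σ, 0 ≤ f σ) :
    entropy β h τ f ≤ 2 / δ * blockEntropyForm β h τ ℓ f := by
  -- Apply the strictly positive case to `f + t` and let `t` decrease to `0`.
  have hcont : ∀ σ : Config v m, Continuous fun t : ℝ => f σ + t :=
    fun σ => continuous_const.add continuous_id
  have hc1 : Continuous fun t : ℝ => entropy β h τ fun σ => f σ + t := by
    simp only [entropy_eq β h τ _ 1]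
    exact continuous_cent _ hcont 1
  have hc2 : Continuous fun t : ℝ => 2 / δ * blockEntropyForm β h τ ℓ fun σ => f σ + t := by
    simp only [blockEntropyForm_eq β h τ _ _ 1]
    exact continuous_const.mul (continuous_finsetSum _ fun x _ =>
      continuous_cexp _ (fun σ => continuous_cent _ hcont σ) 1)
  have h1 := (hc1.tendsto 0).mono_left (nhdsWithin_le_nhds (s := Set.Ioi 0))
  have h2 := (hc2.tendsto 0).mono_left (nhdsWithin_le_nhds (s := Set.Ioi 0))
  simp only [add_zero] at h1 h2
  refine le_of_tendsto_of_tendsto h1 h2 ?_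
  filter_upwards [self_mem_nhdsWithin] with t ht
  exact entropy_le_of_pos β h τ hδ hδ1 hmix fun σ => add_pos_of_nonneg_of_pos (hf σ) ht

end IsingTree

/-! ### A log-Sobolev inequality for boundedly many spins -/

namespace SpinSystem

variable {S : Type*} [Fintype S] [DecidableEq S] (H : (S → ℤˣ) → ℝ)

/-- The heat-bath flip rate at `y`. -/
def rate (y : S) (σ : S → ℤˣ) : ℝ :=
  exp (H (Function.update σ y (-σ y))) / partition H {y} σ

/-- The Dirichlet form of the heat-bath dynamics in `A`, before multiplication by `1 / 2`. -/
def localForm (A : Finset S) (g : (S → ℤˣ) → ℝ) (y : S) (η : S → ℤˣ) : ℝ :=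
  cexp H A (fun σ => rate H y σ * (g (Function.update σ y (-σ y)) - g σ) ^ 2) η

theorem rate_nonneg (y : S) (σ : S → ℤˣ) : 0 ≤ rate H y σ :=
  div_nonneg (exp_pos _).le (partition_pos H _ _).le

theorem localForm_nonneg (A : Finset S) (g : (S → ℤˣ) → ℝ) (y : S) (η : S → ℤˣ) :
    0 ≤ localForm H A g y η :=
  cexp_nonneg H (fun σ => mul_nonneg (rate_nonneg H y σ) (sq_nonneg _)) η

theorem update_eq_or (σ : S → ℤˣ) (y : S) (s : ℤˣ) :
    Function.update σ y s = σ ∨ Function.update σ y s = Function.update σ y (-σ y) := by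
  rcases Int.units_eq_one_or s with rfl | rfl <;> rcases Int.units_eq_one_or (σ y) with h | h
  · left; rw [← h, Function.update_eq_self]
  · right; rw [h, neg_neg]
  · right; rw [h]
  · left; rw [← h, Function.update_eq_self]

/-- A function whose single flips in `A₀` are bounded by `D` varies by at most `D` times the number of
flips. -/
theorem abs_sub_le_card_mul {A₀ : Finset S} {η : S → ℤˣ} {g : (S → ℤˣ) → ℝ} {D : ℝ} (hD0 : 0 ≤ D)
    (hD : ∀ ρ, Agree A₀ η ρ → ∀ y ∈ A₀, |g (Function.update ρ y (-ρ y)) - g ρ| ≤ D)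
    (A : Finset S) : A ⊆ A₀ → ∀ σ σ', Agree A₀ η σ → Agree A σ σ' →
    |g σ' - g σ| ≤ A.card * D := by
  induction A using Finset.induction_on with
  | empty =>
    intro _ σ σ' _ h
    rw [funext fun x => h x (Finset.notMem_empty x)]
    simp
  | insert y A hy ih =>
    intro hA σ σ' hσ h
    have hyA : y ∈ A₀ := hA (Finset.mem_insert_self _ _)
    set ρ := Function.update σ y (σ' y) with hρ
    have h1 : Agree A ρ σ' := by
      intro x hx
      by_cases hxy : x = y
      · subst hxy; simp [hρ]
      · rw [hρ, Function.update_of_ne hxy]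
        exact h x (by simp [hx, hxy])
    have h2 := ih ((Finset.subset_insert _ _).trans hA) ρ σ' (hσ.trans (agree_update hyA _ _)) h1
    have h3 : |g ρ - g σ| ≤ D := by
      rcases update_eq_or σ y (σ' y) with e | e
      · rw [hρ, e]; simpa using hD0
      · rw [hρ, e]; exact hD σ hσ y hyA
    rw [Finset.card_insert_of_notMem hy]
    push_cast
    have := abs_sub_le (g σ') (g ρ) (g σ)
    linarith

theorem card_agree_le (A : Finset S) (η : S → ℤˣ) :
    (Finset.univ.filter fun σ => Agree A η σ).card ≤ 2 ^ A.card := by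
  rw [← Finset.card_powerset]
  refine Finset.card_le_card_of_injOn (fun σ => A.filter fun x => σ x = 1) ?_ ?_
  · intro σ _
    exact Finset.mem_powerset.2 (Finset.filter_subset _ _)
  · intro σ hσ σ' hσ' he
    have h1 := (Finset.mem_filter.1 hσ).2
    have h2 := (Finset.mem_filter.1 hσ').2
    funext x
    by_cases hx : x ∈ A
    · have := Finset.ext_iff.1 he x
      simp only [Finset.mem_filter, hx, true_and] at this
      rcases Int.units_eq_one_or (σ x) with h3 | h3 <;>
        rcases Int.units_eq_one_or (σ' x) with h4 | h4 <;> simp_all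
    · rw [h1 x hx, h2 x hx]

variable {H} {r : ℝ} (hr : ∀ σ y s, H (Function.update σ y s) ≤ H σ + r)
include hr

theorem abs_energy_flip_le (ρ : S → ℤˣ) (y : S) :
    |H (Function.update ρ y (-ρ y)) - H ρ| ≤ r := by
  have h1 := hr ρ y (-ρ y)
  have h2 := hr (Function.update ρ y (-ρ y)) y (ρ y)
  rw [Function.update_idem, Function.update_eq_self] at h2
  rw [abs_le]
  constructor <;> linarith

/-- The fibre has at most `2 ^ A.card` configurations, each reached from `σ` by at most `A.card`
flips that cost a factor `exp r`. -/
theorem partition_le {A : Finset S} {η σ : S → ℤˣ} (hr0 : 0 ≤ r) (hσ : Agree A η σ) :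
    partition H A η ≤ (2 * exp r) ^ A.card * exp (H σ) := by
  have h1 : ∀ ρ, Agree A η ρ → exp (H ρ) ≤ exp r ^ A.card * exp (H σ) := by
    intro ρ hρ
    have := abs_sub_le_card_mul (η := η) (g := H) hr0
      (fun ρ _ y _ => abs_energy_flip_le hr ρ y) A subset_rfl σ ρ hσ (hσ.symm.trans hρ)
    rw [← exp_nat_mul, ← exp_add]
    exact exp_le_exp.2 (by linarith [(abs_le.1 this).2])
  unfold partition
  rw [← Finset.sum_filter]
  refine (Finset.sum_le_card_nsmul _ _ _ fun ρ hρ => h1 ρ (Finset.mem_filter.1 hρ).2).trans ?_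
  rw [nsmul_eq_mul, mul_pow, mul_assoc]
  refine mul_le_mul_of_nonneg_right ?_ (by positivity)
  exact_mod_cast card_agree_le A η

theorem le_mul_cexp {A : Finset S} {η σ : S → ℤˣ} (hr0 : 0 ≤ r) (hσ : Agree A η σ)
    {F : (S → ℤˣ) → ℝ} (hF : ∀ σ, 0 ≤ F σ) : F σ ≤ (2 * exp r) ^ A.card * cexp H A F η := by
  have h1 : exp (H σ) * F σ ≤ ∑ ρ, if Agree A η ρ then exp (H ρ) * F ρ else 0 := by
    refine le_trans (le_of_eq ?_) (Finset.single_le_sum (fun ρ _ => ?_) (Finset.mem_univ σ))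
    · rw [if_pos hσ]
    · split_ifs
      · exact mul_nonneg (exp_pos _).le (hF ρ)
      · rfl
  unfold cexp
  rw [← mul_div_assoc, le_div_iff₀ (partition_pos H A η)]
  calc F σ * partition H A η ≤ F σ * ((2 * exp r) ^ A.card * exp (H σ)) :=
        mul_le_mul_of_nonneg_left (partition_le hr hr0 hσ) (hF σ)
    _ = (2 * exp r) ^ A.card * (exp (H σ) * F σ) := by ring
    _ ≤ _ := mul_le_mul_of_nonneg_left h1 (by positivity)

theorem one_le_mul_rate (hr0 : 0 ≤ r) (y : S) (σ : S → ℤˣ) : 1 ≤ 2 * exp r * rate H y σ := by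
  have := partition_le hr (A := {y}) hr0 (agree_update (Finset.mem_singleton_self y) (-σ y) σ)
  rw [Finset.card_singleton, pow_one] at this
  unfold rate
  rwa [← mul_div_assoc, le_div_iff₀ (partition_pos H _ _), one_mul]

omit hr in
/-- The entropy is controlled by the oscillation of the square root. -/
theorem cent_le_of_osc {A : Finset S} {f : (S → ℤˣ) → ℝ} (hf : ∀ σ, 0 ≤ f σ) {η : S → ℤˣ} {D : ℝ}
    (hD : ∀ σ σ', Agree A η σ → Agree A η σ' → |√(f σ') - √(f σ)| ≤ D) :
    cent H A f η ≤ 4 * D ^ 2 := by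
  set m := cexp H A f η with hm
  have hm0 : 0 ≤ m := cexp_nonneg H hf η
  have hD0 : 0 ≤ D := (abs_nonneg _).trans (hD η η (Agree.refl A η) (Agree.refl A η))
  have hosc : ∀ σ, Agree A η σ → (√(f σ) - √m) ^ 2 ≤ D ^ 2 := by
    intro σ hσ
    rw [sq_le_sq, abs_of_nonneg hD0, abs_le]
    have hs := sqrt_nonneg (f σ)
    constructor
    · have : √m ≤ √(f σ) + D := by
        rw [sqrt_le_iff]
        refine ⟨by positivity, ?_⟩
        rw [hm, ← cexp_const H A ((√(f σ) + D) ^ 2) η]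
        refine cexp_mono_fiber H fun σ' hσ' => ?_
        rw [← sq_sqrt (hf σ')]
        exact pow_le_pow_left₀ (sqrt_nonneg _) (by linarith [(abs_le.1 (hD σ σ' hσ hσ')).2]) 2
      linarith
    · suffices √(f σ) - D ≤ √m by linarith
      rcases le_total (√(f σ)) D with h | h
      · linarith [sqrt_nonneg m]
      · refine le_sqrt_of_sq_le ?_
        rw [hm, ← cexp_const H A ((√(f σ) - D) ^ 2) η]
        refine cexp_mono_fiber H fun σ' hσ' => ?_
        rw [← sq_sqrt (hf σ')]
        exact pow_le_pow_left₀ (by linarith) (by linarith [(abs_le.1 (hD σ σ' hσ hσ')).1]) 2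
  rcases hm0.eq_or_lt with h0 | h0
  · rw [cent_congr_fiber H (g := fun _ => 0) fun σ hσ => eq_zero_of_cexp_eq_zero H hf h0.symm hσ,
      cent_of_inv H (fun _ _ _ => rfl)]
    positivity
  -- By `log t ≤ t - 1` the integrand is at most `(f - m) ^ 2 / m + (f - m)`. Factoring `f - m`
  -- through square roots bounds `(f - m) ^ 2` by `2 D ^ 2 (f + m)`, and integration gives `4 D ^
  -- 2`.
  have hpt : ∀ σ, Agree A η σ →
      f σ * log (f σ) - log m * f σ ≤ (2 * D ^ 2 / m) * f σ + 2 * D ^ 2 + (f σ - m) := by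
    intro σ hσ
    have h1 : f σ * log (f σ) - log m * f σ ≤ f σ * (f σ - m) / m := by
      rcases (hf σ).eq_or_lt with h1 | h1
      · rw [← h1]; simp
      · have e := log_le_sub_one_of_pos (div_pos h1 h0)
        rw [log_div h1.ne' h0.ne'] at e
        have e' := mul_le_mul_of_nonneg_left e h1.le
        have : f σ * (f σ / m - 1) = f σ * (f σ - m) / m := by field_simp
        linarith
    refine h1.trans ?_
    rw [div_le_iff₀ h0]
    have e1 : ((2 * D ^ 2 / m) * f σ + 2 * D ^ 2 + (f σ - m)) * m
        = 2 * D ^ 2 * (f σ + m) + (f σ - m) * m := by field_simp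
    rw [e1]
    have e2 : f σ - m = (√(f σ) - √m) * (√(f σ) + √m) := by
      have := sq_sqrt (hf σ)
      have := sq_sqrt hm0
      nlinarith
    have e3 : (√(f σ) + √m) ^ 2 ≤ 2 * (f σ + m) := by
      have := sq_sqrt (hf σ)
      have := sq_sqrt hm0
      nlinarith [sq_nonneg (√(f σ) - √m)]
    have e4 : (f σ - m) ^ 2 ≤ D ^ 2 * (2 * (f σ + m)) := by
      rw [e2, mul_pow]
      exact mul_le_mul (hosc σ hσ) e3 (sq_nonneg _) (sq_nonneg _)
    nlinarith
  have hint := cexp_mono_fiber H hpt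
  rw [cexp_sub, cexp_const_mul, cexp_add, cexp_add, cexp_const_mul, cexp_sub, cexp_const,
    cexp_const, ← hm] at hint
  unfold cent
  rw [← hm]
  have : 2 * D ^ 2 / m * m = 2 * D ^ 2 := by field_simp
  linarith

/-- A logarithmic Sobolev inequality with a constant that depends on the number of spins. -/
theorem cent_le_localForm {A : Finset S} (hr0 : 0 ≤ r) {f : (S → ℤˣ) → ℝ} (hf : ∀ σ, 0 ≤ f σ)
    (η : S → ℤˣ) : cent H A f η ≤ 4 * (A.card : ℝ) ^ 2 * (2 * exp r) ^ (A.card + 1) *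
      ∑ y ∈ A, localForm H A (fun σ => √(f σ)) y η := by
  -- `Q` bounds the squared change of `√f` under any single flip: `A.card` factors `2 exp r` come
  -- from the probability of the configuration, one from the flip rate.
  set Q := (2 * exp r) ^ (A.card + 1) * ∑ y ∈ A, localForm H A (fun σ => √(f σ)) y η with hQ
  have hQ0 : 0 ≤ Q := mul_nonneg (by positivity)
    (Finset.sum_nonneg fun y _ => localForm_nonneg H A _ y η)
  have hflip : ∀ ρ, Agree A η ρ → ∀ y ∈ A,
      |√(f (Function.update ρ y (-ρ y))) - √(f ρ)| ≤ √Q := by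
    intro ρ hρ y hy
    refine abs_le_sqrt ?_
    set z := (√(f (Function.update ρ y (-ρ y))) - √(f ρ)) ^ 2 with hz
    have h1 : z ≤ 2 * exp r * (rate H y ρ * z) := by
      have := mul_le_mul_of_nonneg_right (one_le_mul_rate hr hr0 y ρ) (sq_nonneg _ : 0 ≤ z)
      linarith
    have h2 : rate H y ρ * z ≤ (2 * exp r) ^ A.card * localForm H A (fun σ => √(f σ)) y η :=
      le_mul_cexp hr hr0 hρ
        (F := fun σ => rate H y σ * (√(f (Function.update σ y (-σ y))) - √(f σ)) ^ 2)
        (fun σ => mul_nonneg (rate_nonneg H y σ) (sq_nonneg _))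
    have h3 := Finset.single_le_sum (fun y _ => localForm_nonneg H A (fun σ => √(f σ)) y η) hy
    rw [hQ, pow_succ', mul_assoc]
    refine h1.trans (mul_le_mul_of_nonneg_left (h2.trans ?_) (by positivity))
    exact mul_le_mul_of_nonneg_left h3 (by positivity)
  have h := cent_le_of_osc (H := H) (A := A) hf (η := η) (D := A.card * √Q) fun σ σ' hσ hσ' =>
    abs_sub_le_card_mul (g := fun σ => √(f σ)) (sqrt_nonneg Q) hflip A subset_rfl σ σ' hσ
      (hσ.symm.trans hσ')
  rw [mul_pow, sq_sqrt hQ0, hQ] at h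
  linarith

omit hr in
theorem cent_pos_of_ne {A : Finset S} {f : (S → ℤˣ) → ℝ} (hf : ∀ σ, 0 ≤ f σ) {η σ σ' : S → ℤˣ}
    (hσ : Agree A η σ) (hσ' : Agree A η σ') (hne : f σ ≠ f σ') : 0 < cent H A f η := by
  refine (cent_nonneg H hf η).lt_of_ne' fun h0 => hne ?_
  have h1 := le_antisymm ((cexp_sqrt_sub_sq_le_cent H hf η).trans h0.le)
    (cexp_nonneg H (fun _ => sq_nonneg _) η)
  have h2 := eq_zero_of_cexp_eq_zero H (fun _ => sq_nonneg _) h1 hσ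
  have h3 := eq_zero_of_cexp_eq_zero H (fun _ => sq_nonneg _) h1 hσ'
  rw [sq_eq_zero_iff, sub_eq_zero] at h2 h3
  exact (sqrt_inj (hf σ) (hf σ')).1 (h2.trans h3.symm)

end SpinSystem

/-! ### From block entropies to the log-Sobolev constant -/

namespace IsingTree

open SpinSystem

variable {b : ℕ} {v : Vertex b} {m : ℕ} {β : ℝ} {h : ℝ} (τ : Vertex b → ℤˣ)

theorem dirichlet_eq (f : Config v m → ℝ) (η : Config v m) : dirichlet β h τ f
    = 1 / 2 * ∑ y, localForm (energy β h τ v m) Finset.univ f y η := by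
  unfold dirichlet localForm
  congr 1
  refine Finset.sum_congr rfl fun x _ => ?_
  rw [mean_eq β h τ _ η]
  refine cexp_congr_fiber _ fun σ _ => ?_
  have hx : ({(x : Vertex b)} : Finset (Vertex b)) ⊆ tree v m := Finset.singleton_subset_iff.2 x.2
  have hs : sites v m {(x : Vertex b)} = {x} := by
    ext y
    rw [mem_sites, Finset.mem_singleton, Finset.mem_singleton, Subtype.ext_iff]
  unfold flipRate flip
  rw [gibbs_eq _ _ _ hx, hs, if_pos (agree_update (Finset.mem_singleton_self x) _ _)]
  rfl

theorem energy_update (hβ : 0 ≤ β) (σ : Config v m) (y : Site v m) (s : ℤˣ) :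
    energy β h τ v m (Function.update σ y s) ≤ energy β h τ v m σ + 2 * β * (b + 1 + |h|) :=
  energy_update_le β h τ hβ σ y s

theorem card_top_le (x : Site v m) (ℓ : ℕ) : (top x ℓ).card ≤ ∑ k ∈ Finset.range ℓ, b ^ k := by
  have h1 : (top x ℓ).card ≤ ((Finset.range ℓ).biUnion (level (x : Vertex b))).card := by
    refine Finset.card_le_card_of_injOn Subtype.val (fun y hy => ?_) Subtype.val_injective.injOn
    have hy := mem_top.1 hy
    have := hy.1.length_le
    simp only [Finset.mem_coe, Finset.mem_biUnion, Finset.mem_range, mem_level]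
    exact ⟨(y : Vertex b).length - (x : Vertex b).length, by omega, hy.1, by omega⟩
  refine h1.trans (Finset.card_biUnion_le.trans (Finset.sum_le_sum fun k _ => ?_))
  refine Finset.card_image_le.trans (le_of_eq ?_)
  simp

theorem exists_ne_config : ∃ f : Config v m → ℝ, (∀ σ, 0 ≤ f σ) ∧ ∃ σ σ', f σ ≠ f σ' := by
  have x : Site v m := Classical.arbitrary _
  refine ⟨fun σ => if σ x = 1 then 1 else 0, fun σ => by beta_reduce; split_ifs <;> norm_num,
    1, -1, ?_⟩
  have : ((-1 : ℤˣ) = 1) = False := by decide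
  simp [this]

/-- A block entropy inequality gives a logarithmic Sobolev inequality. -/
theorem exists_le_logSobolev (b : ℕ) {β : ℝ} (hβ : 0 ≤ β) (h : ℝ) (ℓ : ℕ) {K : ℝ} (hK : 0 < K) :
    ∃ C : ℝ, 0 < C ∧ ∀ (τ : Vertex b → ℤˣ) (v : Vertex b) (m : ℕ),
      (∀ f : Config v m → ℝ, (∀ σ, 0 ≤ f σ) →
        entropy β h τ f ≤ K * blockEntropyForm β h τ ℓ f) →
      1 / C ≤ logSobolev β h τ v m := by
  set r := 2 * β * (b + 1 + |h|) with hr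
  have hr0 : 0 ≤ r := by positivity
  set N := ∑ k ∈ Finset.range ℓ, b ^ k with hN
  set M := 4 * (N : ℝ) ^ 2 * (2 * exp r) ^ (N + 1) with hM
  have hM0 : 0 ≤ M := by positivity
  have he1 : 1 ≤ 2 * exp r := by
    have := one_le_exp hr0; linarith
  -- The `2` undoes the `1 / 2` in the Dirichlet form, and `ℓ + 1` bounds the number of blocks
  -- containing a site. The summand `1` keeps `C` positive for `ℓ = 0`, where `M = 0`.
  set C := K * (M * (2 * (ℓ + 1))) + 1 with hC
  have hC0 : 0 < C := by positivity
  refine ⟨C, hC0, fun τ v m hent => ?_⟩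
  unfold logSobolev
  refine le_csInf ?_ ?_
  · obtain ⟨f, hf, hne⟩ := exists_ne_config (v := v) (m := m)
    exact ⟨_, f, hf, hne, rfl⟩
  rintro _ ⟨f, hf, ⟨σ, σ', hne⟩, rfl⟩
  have hpos : 0 < entropy β h τ f := by
    rw [entropy_eq _ _ _ _ σ]
    exact cent_pos_of_ne hf (Agree.refl _ σ) (Agree.univ _ _) hne
  rw [div_le_div_iff₀ hC0 hpos, one_mul]
  refine (hent f hf).trans ?_
  rw [blockEntropyForm_eq β h τ ℓ f σ, dirichlet_eq τ _ σ]
  set H := energy β h τ v m with hH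
  set g : Config v m → ℝ := fun σ => √(f σ)
  have hblock : ∀ x : Site v m, cexp H Finset.univ (cent H (top x ℓ) f) σ
      ≤ M * ∑ y ∈ top x (ℓ + 1), localForm H Finset.univ g y σ := by
    intro x
    have h1 : ∀ ρ, cent H (top x ℓ) f ρ ≤ M * ∑ y ∈ top x ℓ, localForm H (top x ℓ) g y ρ := by
      intro ρ
      refine (cent_le_localForm (energy_update τ hβ) hr0 hf ρ).trans
        (mul_le_mul_of_nonneg_right ?_ (Finset.sum_nonneg fun y _ => localForm_nonneg H _ _ y ρ))
      have hc : (top x ℓ).card ≤ N := card_top_le x ℓ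
      have hc' : ((top x ℓ).card : ℝ) ≤ N := by exact_mod_cast hc
      exact mul_le_mul (mul_le_mul_of_nonneg_left (pow_le_pow_left₀ (by positivity) hc' 2)
        (by norm_num)) (pow_le_pow_right₀ he1 (by omega)) (by positivity) (by positivity)
    have h2 := cexp_mono H (A := Finset.univ) h1 σ
    rw [cexp_const_mul, cexp_sum] at h2
    have h3 : ∀ y, cexp H Finset.univ (localForm H (top x ℓ) g y) σ
        = localForm H Finset.univ g y σ := fun y => cexp_tower H (Finset.subset_univ _) _ _
    simp only [h3] at h2
    refine h2.trans (mul_le_mul_of_nonneg_left ?_ hM0)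
    refine Finset.sum_le_sum_of_subset_of_nonneg (fun y hy => ?_)
      fun y _ _ => localForm_nonneg H _ _ y σ
    have := mem_top.1 hy
    exact mem_top.2 ⟨this.1, by omega⟩
  have h1 : ∑ x, cexp H Finset.univ (cent H (top x ℓ) f) σ
      ≤ M * ((ℓ + 1) * ∑ y, localForm H Finset.univ g y σ) := by
    refine (Finset.sum_le_sum fun x _ => hblock x).trans ?_
    rw [← Finset.mul_sum]
    exact mul_le_mul_of_nonneg_left (sum_top_le (fun y => localForm_nonneg H _ _ y σ) ℓ) hM0
  have h2 : 0 ≤ ∑ y, localForm H Finset.univ g y σ :=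
    Finset.sum_nonneg fun y _ => localForm_nonneg H _ _ y σ
  have h3 := mul_le_mul_of_nonneg_left h1 hK.le
  rw [hC]
  linarith

theorem entropy_le_of_logSobolev {C : ℝ} (hC : 0 < C) (hls : 1 / C ≤ logSobolev β h τ v m)
    {f : Config v m → ℝ} (hf : ∀ σ, 0 ≤ f σ) :
    entropy β h τ f ≤ C * dirichlet β h τ (fun σ => √(f σ)) := by
  have hd : ∀ g : Config v m → ℝ, 0 ≤ dirichlet β h τ g := by
    intro g
    rw [dirichlet_eq τ g 1]
    exact mul_nonneg (by norm_num) (Finset.sum_nonneg fun y _ => localForm_nonneg _ _ _ y 1)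
  by_cases hne : ∃ σ σ', f σ ≠ f σ'
  · obtain ⟨σ, σ', hne⟩ := hne
    have hpos : 0 < entropy β h τ f := by
      rw [entropy_eq _ _ _ _ σ]
      exact cent_pos_of_ne hf (Agree.refl _ σ) (Agree.univ _ _) hne
    have h1 : 1 / C ≤ dirichlet β h τ (fun σ => √(f σ)) / entropy β h τ f := by
      refine hls.trans (csInf_le ⟨0, ?_⟩ ⟨f, hf, ⟨σ, σ', hne⟩, rfl⟩)
      rintro _ ⟨g, hg, -, rfl⟩
      refine div_nonneg (hd _) ?_
      rw [entropy_eq _ _ _ _ 1]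
      exact cent_nonneg _ hg 1
    rw [div_le_div_iff₀ hC hpos] at h1
    linarith
  · push Not at hne
    rw [entropy_eq _ _ _ _ 1, cent_of_inv _ fun _ _ _ => hne _ _]
    exact mul_nonneg hC.le (hd _)

end IsingTree

/-! ### Entropy decay under the lazy heat-bath dynamics -/

namespace SpinSystem

variable {S : Type*} [Fintype S] [DecidableEq S] (H : (S → ℤˣ) → ℝ)

/-- The total variation distance is controlled by the entropy. -/
theorem sq_cexp_abs_sub_le {A : Finset S} {f : (S → ℤˣ) → ℝ} (hf : ∀ σ, 0 ≤ f σ) (η : S → ℤˣ) :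
    cexp H A (fun σ => |f σ - cexp H A f η|) η ^ 2 ≤ 4 * cexp H A f η * cent H A f η := by
  have hE := cexp_sqrt_sub_sq_le_cent H (A := A) hf η
  set m := cexp H A f η with hm
  have hm0 : 0 ≤ m := cexp_nonneg H hf η
  set X := cexp H A (fun σ => |f σ - m|) η with hX
  -- Cauchy–Schwarz for the factors `|√f - √m|` and `√f + √m` of `|f - m|`, through the discriminant
  -- of a nonnegative quadratic.
  have hq : ∀ t : ℝ, 0 ≤ cent H A f η * (t * t) + (-2 * X) * t + 4 * m := by
    intro t
    have hpt : ∀ σ, 2 * t * |f σ - m| ≤ (t * t) * (√(f σ) - √m) ^ 2 + (2 * f σ + 2 * m) := by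
      intro σ
      have e1 := sq_sqrt (hf σ)
      have e2 := sq_sqrt hm0
      have e3 : f σ - m = (√(f σ) - √m) * (√(f σ) + √m) := by nlinarith
      rw [e3, abs_mul, abs_of_nonneg (add_nonneg (sqrt_nonneg (f σ)) (sqrt_nonneg m))]
      have e4 := sq_abs (√(f σ) - √m)
      nlinarith [sq_nonneg (t * |√(f σ) - √m| - (√(f σ) + √m)), sq_nonneg (√(f σ) - √m)]
    have hint := cexp_mono H (A := A) hpt η
    rw [cexp_const_mul, cexp_add, cexp_const_mul, cexp_add, cexp_const_mul, cexp_const, ← hm,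
      ← hX] at hint
    have := mul_le_mul_of_nonneg_left hE (mul_self_nonneg t)
    linarith
  have := discrim_le_zero hq
  unfold discrim at this
  linarith

/-- One step of the lazy heat-bath dynamics in `A`, of rate `ρ` per site. -/
def step (A : Finset S) (ρ : ℝ) (f : (S → ℤˣ) → ℝ) (σ : S → ℤˣ) : ℝ :=
  f σ + ρ * ∑ y ∈ A, (cexp H {y} f σ - f σ)

variable {H} {A : Finset S} {ρ : ℝ}

theorem step_eq (f : (S → ℤˣ) → ℝ) (σ : S → ℤˣ) : step H A ρ f σ
    = (1 - ρ * A.card) * f σ + ∑ y ∈ A, ρ * cexp H {y} f σ := by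
  unfold step
  rw [Finset.sum_sub_distrib, Finset.sum_const, nsmul_eq_mul, ← Finset.mul_sum]
  ring

theorem step_sub_const (f : (S → ℤˣ) → ℝ) (c : ℝ) :
    step H A ρ (fun σ => f σ - c) = fun σ => step H A ρ f σ - c := by
  funext σ
  unfold step
  simp only [cexp_sub, cexp_const]
  have : ∀ y, cexp H {y} f σ - c - (f σ - c) = cexp H {y} f σ - f σ := fun y => by ring
  simp only [this]
  ring

theorem iterate_step_sub_const (f : (S → ℤˣ) → ℝ) (c : ℝ) (k : ℕ) :
    (step H A ρ)^[k] (fun σ => f σ - c) = fun σ => (step H A ρ)^[k] f σ - c := by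
  induction k generalizing f with
  | zero => rfl
  | succ k ih => rw [Function.iterate_succ_apply, step_sub_const, ih, Function.iterate_succ_apply]

/-- Reversibility, inherited from the self-adjointness of every single-site average. -/
theorem cexp_step_mul (f g : (S → ℤˣ) → ℝ) (η : S → ℤˣ) :
    cexp H A (fun σ => step H A ρ f σ * g σ) η = cexp H A (fun σ => f σ * step H A ρ g σ) η := by
  have h1 : ∀ σ, step H A ρ f σ * g σ = (1 - ρ * A.card) * (f σ * g σ)
      + ∑ y ∈ A, ρ * (cexp H {y} f σ * g σ) := by
    intro σ
    rw [step_eq, add_mul, Finset.sum_mul]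
    simp only [mul_assoc]
  have h2 : ∀ σ, f σ * step H A ρ g σ = (1 - ρ * A.card) * (f σ * g σ)
      + ∑ y ∈ A, ρ * (f σ * cexp H {y} g σ) := by
    intro σ
    rw [step_eq, mul_add, Finset.mul_sum]
    congr 1
    · ring
    · exact Finset.sum_congr rfl fun y _ => by ring
  simp only [h1, h2]
  rw [cexp_add, cexp_add, cexp_sum, cexp_sum]
  congr 1
  refine Finset.sum_congr rfl fun y hy => ?_
  rw [cexp_const_mul, cexp_const_mul, cexp_mul_cexp_comm H (Finset.singleton_subset_iff.2 hy)]

theorem cexp_iterate_step_mul (f g : (S → ℤˣ) → ℝ) (η : S → ℤˣ) (k : ℕ) :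
    cexp H A (fun σ => (step H A ρ)^[k] f σ * g σ) η
      = cexp H A (fun σ => f σ * (step H A ρ)^[k] g σ) η := by
  induction k generalizing f with
  | zero => rfl
  | succ k ih =>
    rw [Function.iterate_succ_apply, ih, Function.iterate_succ_apply', cexp_step_mul]

theorem step_one : step H A ρ (fun _ => 1) = fun _ => 1 := by
  funext σ
  simp [step, cexp_one]

theorem cexp_step (f : (S → ℤˣ) → ℝ) (η : S → ℤˣ) : cexp H A (step H A ρ f) η = cexp H A f η := by
  have := cexp_step_mul (H := H) (A := A) (ρ := ρ) f (fun _ => 1) η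
  simpa [step_one] using this

theorem step_nonneg (hρ : 0 ≤ ρ) (hρA : ρ * A.card ≤ 1) {f : (S → ℤˣ) → ℝ} (hf : ∀ σ, 0 ≤ f σ)
    (σ : S → ℤˣ) : 0 ≤ step H A ρ f σ := by
  rw [step_eq]
  exact add_nonneg (mul_nonneg (by linarith) (hf σ))
    (Finset.sum_nonneg fun y _ => mul_nonneg hρ (cexp_nonneg H hf σ))

/-- One step of the dynamics contracts the entropy. -/
theorem cent_step_le {C : ℝ} (hC : 0 < C) (hρ : 0 ≤ ρ) (hρA : ρ * A.card ≤ 1) {η : S → ℤˣ}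
    {f : (S → ℤˣ) → ℝ} (hf : ∀ σ, 0 ≤ f σ)
    (hls : cent H A f η ≤ C * ∑ y ∈ A, cexp H A (cent H {y} f) η) :
    cent H A (step H A ρ f) η ≤ (1 - ρ / C) * cent H A f η := by
  -- A step is a convex combination of `f` and its single-site averages, so Jensen applies to `t log
  -- t`. The average at `y` lowers the entropy by exactly the mean of `cent H {y} f`.
  have hpt : ∀ σ, step H A ρ f σ * log (step H A ρ f σ) ≤ (1 - ρ * A.card) * (f σ * log (f σ))
      + ∑ y ∈ A, ρ * (cexp H {y} f σ * log (cexp H {y} f σ)) := by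
    intro σ
    have := Real.convexOn_mul_log.map_add_sum_le (t := A) (v := 1 - ρ * A.card) (w := fun _ => ρ)
      (q := f σ) (p := fun y => cexp H {y} f σ) (fun _ _ => hρ) (by simp; ring)
      (fun y _ => cexp_nonneg H hf σ) (by linarith) (hf σ)
    simp only [smul_eq_mul] at this
    rw [step_eq]
    exact this
  have hint := cexp_mono H (A := A) hpt η
  rw [cexp_add, cexp_const_mul, cexp_sum] at hint
  have hy : ∀ y ∈ A, cexp H A (fun σ => ρ * (cexp H {y} f σ * log (cexp H {y} f σ))) η
      = ρ * cexp H A (fun σ => f σ * log (f σ)) η - ρ * cexp H A (cent H {y} f) η := by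
    intro y hy
    have : cexp H A (cent H {y} f) η = cexp H A (fun σ => f σ * log (f σ)) η
        - cexp H A (fun σ => cexp H {y} f σ * log (cexp H {y} f σ)) η := by
      rw [← cexp_tower H (Finset.singleton_subset_iff.2 hy) (fun σ => f σ * log (f σ)), ← cexp_sub]
      rfl
    rw [cexp_const_mul, this]
    ring
  rw [Finset.sum_congr rfl hy, Finset.sum_sub_distrib, Finset.sum_const, nsmul_eq_mul,
    ← Finset.mul_sum] at hint
  have h1 : cent H A (step H A ρ f) η ≤ cent H A f η
      - ρ * ∑ y ∈ A, cexp H A (cent H {y} f) η := by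
    unfold cent at hint ⊢
    rw [cexp_step]
    linarith
  have h2 : ρ / C * cent H A f η ≤ ρ * ∑ y ∈ A, cexp H A (cent H {y} f) η := by
    rw [div_mul_eq_mul_div, div_le_iff₀ hC]
    have := mul_le_mul_of_nonneg_left hls hρ
    linarith
  linarith

theorem iterate_step_nonneg (hρ : 0 ≤ ρ) (hρA : ρ * A.card ≤ 1) {f : (S → ℤˣ) → ℝ}
    (hf : ∀ σ, 0 ≤ f σ) (k : ℕ) : ∀ σ, 0 ≤ (step H A ρ)^[k] f σ := by
  induction k with
  | zero => exact hf
  | succ k ih => rw [Function.iterate_succ_apply']; exact step_nonneg hρ hρA ih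

theorem cexp_iterate_step (f : (S → ℤˣ) → ℝ) (η : S → ℤˣ) (k : ℕ) :
    cexp H A ((step H A ρ)^[k] f) η = cexp H A f η := by
  induction k with
  | zero => rfl
  | succ k ih => rw [Function.iterate_succ_apply', cexp_step, ih]

theorem cent_iterate_step_le {C : ℝ} (hC : 0 < C) (hρ : 0 ≤ ρ) (hρA : ρ * A.card ≤ 1)
    (hρC : ρ ≤ C) {η : S → ℤˣ} (hls : ∀ f : (S → ℤˣ) → ℝ, (∀ σ, 0 ≤ f σ) →
      cent H A f η ≤ C * ∑ y ∈ A, cexp H A (cent H {y} f) η)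
    {f : (S → ℤˣ) → ℝ} (hf : ∀ σ, 0 ≤ f σ) (k : ℕ) :
    cent H A ((step H A ρ)^[k] f) η ≤ (1 - ρ / C) ^ k * cent H A f η := by
  induction k with
  | zero => simp
  | succ k ih =>
    have hg := iterate_step_nonneg (H := H) hρ hρA hf k
    rw [Function.iterate_succ_apply', pow_succ', mul_assoc]
    have h0 : 0 ≤ 1 - ρ / C := by
      rw [sub_nonneg, div_le_one hC]; exact hρC
    exact (cent_step_le hC hρ hρA hg (hls _ hg)).trans (mul_le_mul_of_nonneg_left ih h0)

/-! ### Propagation of oscillations and decay of correlations -/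

/-- The flips at `y ∈ A` change `ψ` by at most `d y`. -/
def OscBound (A : Finset S) (ψ : (S → ℤˣ) → ℝ) (d : S → ℝ) : Prop :=
  ∀ σ, ∀ y ∈ A, |ψ (Function.update σ y (-σ y)) - ψ σ| ≤ d y

theorem OscBound.nonneg {ψ : (S → ℤˣ) → ℝ} {d : S → ℝ} (hd : OscBound A ψ d) {y : S}
    (hy : y ∈ A) : 0 ≤ d y := (abs_nonneg _).trans (hd 1 y hy)

theorem OscBound.abs_update_sub_le {ψ : (S → ℤˣ) → ℝ} {d : S → ℝ} (hd : OscBound A ψ d) {z : S}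
    (hz : z ∈ A) (σ : S → ℤˣ) (s : ℤˣ) : |ψ (Function.update σ z s) - ψ σ| ≤ d z := by
  rcases update_eq_or σ z s with e | e
  · rw [e, sub_self, abs_zero]; exact hd.nonneg hz
  · rw [e]; exact hd σ z hz

theorem prob_nonneg (z : S) (s : ℤˣ) (σ : S → ℤˣ) : 0 ≤ prob H A z s σ :=
  cexp_nonneg H (fun σ => by split_ifs <;> norm_num) σ

theorem inv_empty {X : Type*} (f : (S → ℤˣ) → X) : Inv ∅ f := fun _ _ h => by
  rw [funext fun x => h x (Finset.notMem_empty x)]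

theorem cexp_singleton (z : S) (ψ : (S → ℤˣ) → ℝ) (σ : S → ℤˣ) : cexp H {z} ψ σ
    = prob H {z} z 1 σ * ψ (Function.update σ z 1)
      + prob H {z} z (-1) σ * ψ (Function.update σ z (-1)) :=
  cexp_eq_prob_add H (by rw [Finset.erase_singleton]; exact inv_empty ψ) σ

theorem abs_convex_comb_le {p q s t D : ℝ} (hp : 0 ≤ p) (hq : 0 ≤ q) (hpq : p + q = 1)
    (hs : |s| ≤ D) (ht : |t| ≤ D) : |p * s + q * t| ≤ D := by
  refine (abs_add_le _ _).trans ?_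
  rw [abs_mul, abs_mul, abs_of_nonneg hp, abs_of_nonneg hq]
  calc p * |s| + q * |t| ≤ p * D + q * D := by gcongr
    _ = D := by rw [← add_mul, hpq, one_mul]

theorem OscBound.abs_sub_cexp_le {ψ : (S → ℤˣ) → ℝ} {d : S → ℝ} (hd : OscBound A ψ d) {z : S}
    (hz : z ∈ A) (σ : S → ℤˣ) : |ψ σ - cexp H {z} ψ σ| ≤ d z := by
  have h1 := hd.abs_update_sub_le hz σ 1
  have h2 := hd.abs_update_sub_le hz σ (-1)
  have hp := prob_add_prob H {z} z σ
  have p1 := prob_nonneg (H := H) (A := {z}) z 1 σ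
  have p2 := prob_nonneg (H := H) (A := {z}) z (-1) σ
  refine le_trans (le_of_eq ?_) (abs_convex_comb_le p1 p2 hp h1 h2)
  rw [cexp_singleton, ← abs_neg]
  congr 1
  linear_combination ψ σ * hp

/-- The heat-bath update at `z` spreads oscillations only from `z` to its neighbours. -/
theorem OscBound.cexp_singleton {Adj : S → S → Prop} [DecidableRel Adj]
    (hAdj : ∀ z y, z ≠ y → ¬ Adj z y → Uncoupled H {z} {y})
    {ψ : (S → ℤˣ) → ℝ} {d : S → ℝ} (hd : OscBound A ψ d) {z : S} (hz : z ∈ A) :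
    OscBound A (cexp H {z} ψ) (fun y => d y + if Adj z y then d z else 0) := by
  intro σ y hy
  have hdz := hd.nonneg hz
  have hdy := hd.nonneg hy
  by_cases hzy : z = y
  · subst hzy
    rw [cexp_inv H {z} ψ σ _ (agree_update (Finset.mem_singleton_self z) _ _), sub_self, abs_zero]
    beta_reduce
    split_ifs <;> linarith
  set σ' := Function.update σ y (-σ y) with hσ'
  have hcomm : ∀ s, Function.update σ' z s
      = Function.update (Function.update σ z s) y (-(Function.update σ z s) y) := by
    intro s
    rw [hσ', Function.update_of_ne (Ne.symm hzy), Function.update_comm (Ne.symm hzy)]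
  have h1 := hd (Function.update σ z 1) y hy
  have h2 := hd (Function.update σ z (-1)) y hy
  have h3 := hd (Function.update σ z (-1)) z hz
  rw [← hcomm] at h1 h2
  rw [Function.update_idem, Function.update_self, neg_neg] at h3
  have hp := prob_add_prob H {z} z σ
  have hp' := prob_add_prob H {z} z σ'
  have p1 := prob_nonneg (H := H) (A := {z}) z 1 σ
  have p1' := prob_nonneg (H := H) (A := {z}) z 1 σ'
  have p2 := prob_nonneg (H := H) (A := {z}) z (-1) σ
  have p2' := prob_nonneg (H := H) (A := {z}) z (-1) σ'
  rw [SpinSystem.cexp_singleton, SpinSystem.cexp_singleton]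
  -- The first two terms carry the oscillation of `ψ` at `y`. The last one carries the change of the
  -- update probability at `z`, which vanishes unless `Adj z y`.
  have e : prob H {z} z 1 σ' * ψ (Function.update σ' z 1)
      + prob H {z} z (-1) σ' * ψ (Function.update σ' z (-1))
      - (prob H {z} z 1 σ * ψ (Function.update σ z 1)
      + prob H {z} z (-1) σ * ψ (Function.update σ z (-1)))
      = prob H {z} z 1 σ' * (ψ (Function.update σ' z 1) - ψ (Function.update σ z 1))
      + prob H {z} z (-1) σ' * (ψ (Function.update σ' z (-1)) - ψ (Function.update σ z (-1)))
      + (prob H {z} z 1 σ' - prob H {z} z 1 σ)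
        * (ψ (Function.update σ z 1) - ψ (Function.update σ z (-1))) := by
    have e1 : prob H {z} z (-1) σ = 1 - prob H {z} z 1 σ := by linarith
    have e2 : prob H {z} z (-1) σ' = 1 - prob H {z} z 1 σ' := by linarith
    rw [e1, e2]; ring
  rw [e]
  have hΔ : |(prob H {z} z 1 σ' - prob H {z} z 1 σ)
      * (ψ (Function.update σ z 1) - ψ (Function.update σ z (-1)))| ≤ if Adj z y then d z else 0 := by
    split_ifs with ha
    · rw [abs_mul]
      have : |prob H {z} z 1 σ' - prob H {z} z 1 σ| ≤ 1 := by
        rw [abs_le]; constructor <;> linarith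
      calc _ ≤ 1 * d z := mul_le_mul this h3 (abs_nonneg _) zero_le_one
        _ = d z := one_mul _
    · have hi : Inv {y} (fun ξ : S → ℤˣ => if ξ z = 1 then (1 : ℝ) else 0) := by
        intro ξ ξ' hξ
        beta_reduce
        rw [hξ z (by simpa using hzy)]
      have : prob H {z} z 1 σ' = prob H {z} z 1 σ :=
        (hAdj z y hzy ha).inv_cexp hi σ σ' (agree_update (Finset.mem_singleton_self y) _ _)
      rw [this, sub_self, zero_mul, abs_zero]
  refine (abs_add_le _ _).trans (add_le_add ?_ hΔ)
  exact abs_convex_comb_le p1' p2' hp' h1 h2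

theorem OscBound.step {Adj : S → S → Prop} [DecidableRel Adj]
    (hAdj : ∀ z y, z ≠ y → ¬ Adj z y → Uncoupled H {z} {y}) (hρ : 0 ≤ ρ) (hρA : ρ * A.card ≤ 1)
    {ψ : (S → ℤˣ) → ℝ} {d : S → ℝ} (hd : OscBound A ψ d) :
    OscBound A (step H A ρ ψ) (fun y => d y + ρ * ∑ z ∈ A, if Adj z y then d z else 0) := by
  intro σ y hy
  rw [step_eq, step_eq]
  set σ' := Function.update σ y (-σ y) with hσ'
  have e : (1 - ρ * A.card) * ψ σ' + ∑ z ∈ A, ρ * cexp H {z} ψ σ'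
      - ((1 - ρ * A.card) * ψ σ + ∑ z ∈ A, ρ * cexp H {z} ψ σ)
      = (1 - ρ * A.card) * (ψ σ' - ψ σ)
        + ∑ z ∈ A, ρ * (cexp H {z} ψ σ' - cexp H {z} ψ σ) := by
    simp only [mul_sub, Finset.sum_sub_distrib]; ring
  rw [e]
  have h1 : |(1 - ρ * A.card) * (ψ σ' - ψ σ)| ≤ (1 - ρ * A.card) * d y := by
    rw [abs_mul, abs_of_nonneg (by linarith : 0 ≤ 1 - ρ * A.card)]
    exact mul_le_mul_of_nonneg_left (hd σ y hy) (by linarith)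
  have h2 : |∑ z ∈ A, ρ * (cexp H {z} ψ σ' - cexp H {z} ψ σ)|
      ≤ ∑ z ∈ A, ρ * (d y + if Adj z y then d z else 0) := by
    refine (Finset.abs_sum_le_sum_abs _ _).trans (Finset.sum_le_sum fun z hz => ?_)
    rw [abs_mul, abs_of_nonneg hρ]
    exact mul_le_mul_of_nonneg_left (hd.cexp_singleton hAdj hz σ y hy) hρ
  refine (abs_add_le _ _).trans ((add_le_add h1 h2).trans (le_of_eq ?_))
  rw [← Finset.mul_sum, Finset.sum_add_distrib, Finset.sum_const, nsmul_eq_mul]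
  ring

/-- Finite speed of propagation: weighted oscillations grow at most exponentially. -/
theorem exists_oscBound_iterate_step {Adj : S → S → Prop} [DecidableRel Adj]
    (hAdj : ∀ z y, z ≠ y → ¬ Adj z y → Uncoupled H {z} {y}) (hρ : 0 ≤ ρ) (hρA : ρ * A.card ≤ 1)
    {wt : S → ℝ} {K : ℝ} (hK : 0 ≤ K)
    (hwt : ∀ z ∈ A, (∑ y ∈ A, if Adj z y then wt y else 0) ≤ K * wt z)
    {ψ : (S → ℤˣ) → ℝ} {d : S → ℝ} (hd : OscBound A ψ d) (k : ℕ) :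
    ∃ d', OscBound A ((SpinSystem.step H A ρ)^[k] ψ) d' ∧
      ∑ y ∈ A, wt y * d' y ≤ (1 + ρ * K) ^ k * ∑ y ∈ A, wt y * d y := by
  induction k with
  | zero => exact ⟨d, hd, by simp⟩
  | succ k ih =>
    obtain ⟨d', hd', hW⟩ := ih
    refine ⟨_, by rw [Function.iterate_succ_apply']; exact hd'.step hAdj hρ hρA, ?_⟩
    have h1 : ∑ y ∈ A, wt y * (d' y + ρ * ∑ z ∈ A, if Adj z y then d' z else 0)
        = ∑ y ∈ A, wt y * d' y
          + ρ * ∑ z ∈ A, d' z * ∑ y ∈ A, if Adj z y then wt y else 0 := by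
      simp only [mul_add, Finset.sum_add_distrib, Finset.mul_sum]
      congr 1
      rw [Finset.sum_comm]
      refine Finset.sum_congr rfl fun z _ => Finset.sum_congr rfl fun y _ => ?_
      split_ifs <;> ring
    have h2 : ∑ z ∈ A, d' z * (∑ y ∈ A, if Adj z y then wt y else 0)
        ≤ K * ∑ z ∈ A, wt z * d' z := by
      rw [Finset.mul_sum]
      refine Finset.sum_le_sum fun z hz => ?_
      have := mul_le_mul_of_nonneg_left (hwt z hz) (hd'.nonneg hz)
      linarith
    rw [h1, pow_succ']
    have h3 := mul_le_mul_of_nonneg_left h2 hρ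
    have h4 := mul_le_mul_of_nonneg_left hW (show 0 ≤ 1 + ρ * K by positivity)
    linarith

/-- The correlation between a function of the spins outside `B` and a local function decays
with the distance. -/
theorem sq_cexp_sub_mul_le {Adj : S → S → Prop} [DecidableRel Adj]
    (hAdj : ∀ z y, z ≠ y → ¬ Adj z y → Uncoupled H {z} {y}) (hρ : 0 ≤ ρ) (hρA : ρ * A.card ≤ 1)
    {wt : S → ℝ} {K : ℝ} (hK : 0 ≤ K) (hwt0 : ∀ y ∈ A, 0 ≤ wt y)
    (hwt : ∀ z ∈ A, (∑ y ∈ A, if Adj z y then wt y else 0) ≤ K * wt z)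
    {C : ℝ} (hC : 0 < C) (hρC : ρ ≤ C) {η : S → ℤˣ} (hls : ∀ f : (S → ℤˣ) → ℝ, (∀ σ, 0 ≤ f σ) →
      cent H A f η ≤ C * ∑ y ∈ A, cexp H A (cent H {y} f) η)
    {φ : (S → ℤˣ) → ℝ} (hφ : ∀ σ, |φ σ| ≤ 1) {d : S → ℝ} (hd : OscBound A φ d)
    (hW : ∑ y ∈ A, wt y * d y ≤ 1) {B : Finset S} {ω : ℝ} (hω : 0 < ω)
    (hB : ∀ y ∈ A, y ∉ B → ω ≤ wt y) {f : (S → ℤˣ) → ℝ} (hf : ∀ σ, 0 ≤ f σ) (hfB : Inv B f) (k : ℕ) :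
    cexp H A (fun σ => (f σ - cexp H A f η) * φ σ) η ^ 2 ≤ 8 * cexp H A f η * cent H A f η *
      ((1 - ρ / C) ^ k + (k * ρ * (1 + ρ * K) ^ k / ω) ^ 2) := by
  set m := cexp H A f η with hm
  have hm0 : 0 ≤ m := cexp_nonneg H hf η
  set fb : (S → ℤˣ) → ℝ := fun σ => f σ - m with hfb
  have hfbB : Inv B fb := hfB.comp fun t => t - m
  set X := cexp H A (fun σ => |fb σ|) η with hX
  have hX0 : 0 ≤ X := cexp_nonneg H (fun _ => abs_nonneg _) η
  have hX2 : X ^ 2 ≤ 4 * m * cent H A f η := sq_cexp_abs_sub_le H hf η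
  set q := 1 + ρ * K with hq
  have hq1 : 1 ≤ q := by have := mul_nonneg hρ hK; linarith
  -- Updates in `B` leave the covariance unchanged, because `fb` does not depend on those spins.
  -- Outside `B` the weight is at least `ω`, so the weighted oscillation divided by `ω` bounds the
  -- effect of the updates.
  have hstep : ∀ i, |cexp H A (fun σ => fb σ * (SpinSystem.step H A ρ)^[i] φ σ) η
      - cexp H A (fun σ => fb σ * (SpinSystem.step H A ρ)^[i + 1] φ σ) η|
      ≤ ρ * X * (q ^ i / ω) := by
    intro i
    obtain ⟨d', hd', hW'⟩ := exists_oscBound_iterate_step hAdj hρ hρA hK hwt hd i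
    set ψ := (SpinSystem.step H A ρ)^[i] φ with hψ
    rw [Function.iterate_succ_apply', ← hψ, ← cexp_sub]
    have e1 : ∀ σ, fb σ * ψ σ - fb σ * SpinSystem.step H A ρ ψ σ
        = ∑ y ∈ A, ρ * (fb σ * (ψ σ - cexp H {y} ψ σ)) := by
      intro σ
      unfold SpinSystem.step
      rw [← Finset.mul_sum, ← Finset.mul_sum, Finset.sum_sub_distrib, Finset.sum_sub_distrib]
      ring
    simp only [e1]
    rw [cexp_sum]
    have e2 : ∀ y ∈ A, |cexp H A (fun σ => ρ * (fb σ * (ψ σ - cexp H {y} ψ σ))) η|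
        ≤ ρ * X * (wt y * d' y / ω) := by
      intro y hy
      have hdy := hd'.nonneg hy
      rw [cexp_const_mul, abs_mul, abs_of_nonneg hρ, mul_assoc]
      refine mul_le_mul_of_nonneg_left ?_ hρ
      by_cases hyB : y ∈ B
      · have : cexp H A (fun σ => fb σ * (ψ σ - cexp H {y} ψ σ)) η = 0 := by
          simp only [mul_sub]
          rw [cexp_sub, cexp_mul_cexp H (Finset.singleton_subset_iff.2 hy)
            (hfbB.mono (Finset.singleton_subset_iff.2 hyB)), sub_self]
        rw [this, abs_zero]
        exact mul_nonneg hX0 (div_nonneg (mul_nonneg (hwt0 y hy) hdy) hω.le)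
      · have h1 : ∀ σ, |fb σ * (ψ σ - cexp H {y} ψ σ)| ≤ d' y * |fb σ| := by
          intro σ
          rw [abs_mul, mul_comm]
          exact mul_le_mul_of_nonneg_right (hd'.abs_sub_cexp_le hy σ) (abs_nonneg _)
        refine ((abs_cexp_le H _ η).trans (cexp_mono H h1 η)).trans ?_
        rw [cexp_const_mul, mul_comm]
        refine mul_le_mul_of_nonneg_left ?_ hX0
        rw [le_div_iff₀ hω, mul_comm]
        exact mul_le_mul_of_nonneg_right (hB y hy hyB) hdy
    refine (Finset.abs_sum_le_sum_abs _ _).trans ((Finset.sum_le_sum e2).trans ?_)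
    rw [← Finset.mul_sum, ← Finset.sum_div]
    refine mul_le_mul_of_nonneg_left (div_le_div_of_nonneg_right ?_ hω.le) (mul_nonneg hρ hX0)
    exact hW'.trans (mul_le_of_le_one_right (by positivity) hW)
  have htel : ∀ i, |cexp H A (fun σ => fb σ * φ σ) η
      - cexp H A (fun σ => fb σ * (SpinSystem.step H A ρ)^[i] φ σ) η|
      ≤ i * (ρ * X * (q ^ k / ω)) ∨ k < i := by
    intro i
    induction i with
    | zero => left; simp
    | succ i ih =>
      by_cases hik : k < i + 1
      · exact Or.inr hik
      left
      have h1 := ih.resolve_right (by omega)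
      have h2 : ρ * X * (q ^ i / ω) ≤ ρ * X * (q ^ k / ω) :=
        mul_le_mul_of_nonneg_left (div_le_div_of_nonneg_right
          (pow_le_pow_right₀ hq1 (by omega)) hω.le) (mul_nonneg hρ hX0)
      refine (abs_sub_le _ _ _).trans ((add_le_add h1 ((hstep i).trans h2)).trans (le_of_eq ?_))
      push_cast; ring
  have h1 := (htel k).resolve_right (lt_irrefl k)
  set Y := cexp H A (fun σ => fb σ * (SpinSystem.step H A ρ)^[k] φ σ) η with hY
  -- Self-adjointness moves the dynamics from `φ` to `f`, where the entropy decays and controls the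
  -- `L¹` distance to the mean.
  have hY2 : Y ^ 2 ≤ 4 * m * ((1 - ρ / C) ^ k * cent H A f η) := by
    have hg := iterate_step_nonneg (H := H) hρ hρA hf k
    have h2 : |Y| ≤ cexp H A (fun σ => |(SpinSystem.step H A ρ)^[k] f σ - m|) η := by
      rw [hY, ← cexp_iterate_step_mul, hfb, iterate_step_sub_const]
      refine (abs_cexp_le H _ η).trans (cexp_mono H (fun σ => ?_) η)
      rw [abs_mul]
      exact mul_le_of_le_one_right (abs_nonneg _) (hφ σ)
    have h3 := sq_cexp_abs_sub_le H (A := A) hg η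
    rw [cexp_iterate_step, ← hm] at h3
    rw [← sq_abs]
    exact (pow_le_pow_left₀ (abs_nonneg Y) h2 2).trans (h3.trans (mul_le_mul_of_nonneg_left
      (cent_iterate_step_le hC hρ hρA hρC hls hf k) (by positivity)))
  set U := cexp H A (fun σ => fb σ * φ σ) η with hU
  have h2 : (U - Y) ^ 2 ≤ X ^ 2 * (k * ρ * q ^ k / ω) ^ 2 := by
    rw [← sq_abs, ← mul_pow]
    refine pow_le_pow_left₀ (abs_nonneg _) (h1.trans (le_of_eq ?_)) 2
    ring
  have h3 := h2.trans (mul_le_mul_of_nonneg_right hX2 (sq_nonneg _))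
  -- `U ^ 2 ≤ 2 (U - Y) ^ 2 + 2 Y ^ 2`; this doubles the constant `4` to `8`.
  nlinarith [sq_nonneg (U - Y - Y)]

/-- The entropy of the projection onto one spin is bounded by a covariance. -/
theorem cent_cexp_erase_le_covariance {x : S} {f : (S → ℤˣ) → ℝ} (hf : ∀ σ, 0 ≤ f σ)
    {η : S → ℤˣ} (hm : 0 < cexp H A f η) {κ : ℝ} (hκ : 0 < κ) (hp : ∀ s, κ ≤ prob H A x s η) :
    cent H A (cexp H (A.erase x) f) η ≤ cexp H A (fun σ => (f σ - cexp H A f η) *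
      (if σ x = 1 then 1 else 0)) η ^ 2 / (κ ^ 2 * cexp H A f η) := by
  set a := cexp H (A.erase x) f with ha
  set m := cexp H A f η
  have hAx : A.erase x ⊆ A := Finset.erase_subset x A
  have a0 : ∀ σ, 0 ≤ a σ := cexp_nonneg H hf
  have ma : cexp H A a η = m := cexp_tower H hAx f η
  have ia : Inv (A.erase x) a := cexp_inv H _ _
  -- Integrated, this bounds the entropy by the variance over the mean; on two points the variance
  -- is `u ^ 2 / (p p')`, with `u` the covariance with the indicator.
  have hpt : ∀ σ, a σ * log (a σ) - log m * a σ ≤ 1 / m * (a σ - m) ^ 2 + (a σ - m) := by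
    intro σ
    have e0 : 1 / m * (a σ - m) ^ 2 + (a σ - m) = a σ * (a σ / m - 1) := by field_simp; ring
    rw [e0]
    rcases (a0 σ).eq_or_lt with h1 | h1
    · rw [← h1]; simp
    · have e := log_le_sub_one_of_pos (div_pos h1 hm)
      rw [log_div h1.ne' hm.ne'] at e
      have e' := mul_le_mul_of_nonneg_left e h1.le
      linarith
  have hint := cexp_mono H (A := A) hpt η
  rw [cexp_sub, cexp_const_mul, cexp_add, cexp_const_mul, cexp_sub, cexp_const, ma] at hint
  have hu : cexp H A (fun σ => (f σ - m) * (if σ x = 1 then 1 else 0)) η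
      = prob H A x 1 η * (a (Function.update η x 1) - m) := by
    have i1 : Inv (A.erase x) (fun σ : S → ℤˣ => if σ x = 1 then (1 : ℝ) else 0) := by
      intro ξ ξ' hξ
      beta_reduce
      rw [hξ x (Finset.notMem_erase x A)]
    have i2 : Inv (A.erase x) (fun σ : S → ℤˣ => (if σ x = 1 then (1 : ℝ) else 0) * (a σ - m)) := by
      intro ξ ξ' hξ
      have e1 := i1 ξ ξ' hξ
      beta_reduce at e1 ⊢
      rw [e1, ia ξ ξ' hξ]
    have e : cexp H A (fun σ => (if σ x = 1 then 1 else 0) * (a σ - m)) η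
        = cexp H A (fun σ => (if σ x = 1 then 1 else 0) * (f σ - m)) η := by
      rw [← cexp_mul_cexp H hAx i1 (fun σ => f σ - m)]
      simp only [cexp_sub, cexp_const, ← ha]
    simp only [mul_comm _ (ite _ _ _)]
    rw [← e, cexp_eq_prob_add H i2]
    simp
  have hvar : cexp H A (fun σ => (a σ - m) ^ 2) η
      = prob H A x 1 η * (a (Function.update η x 1) - m) ^ 2
        + prob H A x (-1) η * (a (Function.update η x (-1)) - m) ^ 2 :=
    cexp_eq_prob_add H (ia.comp fun t => (t - m) ^ 2) η
  have hmean := cexp_eq_prob_add H ia η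
  rw [ma] at hmean
  have hpq := prob_add_prob H A x η
  have hp1 := hp 1
  have hp2 := hp (-1)
  set p := prob H A x 1 η
  set p' := prob H A x (-1) η
  set a₁ := a (Function.update η x 1)
  set a₂ := a (Function.update η x (-1))
  set u := p * (a₁ - m) with hudef
  have hu2 : p' * (a₂ - m) = -u := by
    have : m = (p + p') * m := by rw [hpq, one_mul]
    rw [hudef]; linarith
  have hcent : cent H A a η ≤ 1 / m * (p * (a₁ - m) ^ 2 + p' * (a₂ - m) ^ 2) := by
    unfold cent
    rw [ma, ← hvar]
    linarith
  rw [hu]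
  refine hcent.trans ?_
  rw [one_div_mul_eq_div, mul_comm (κ ^ 2), ← div_div, div_right_comm]
  refine div_le_div_of_nonneg_right ?_ hm.le
  rw [le_div_iff₀ (by positivity)]
  have e : p * p' * (p * (a₁ - m) ^ 2 + p' * (a₂ - m) ^ 2) = u ^ 2 := by
    have e1 : p * p' * (p * (a₁ - m) ^ 2 + p' * (a₂ - m) ^ 2)
        = p' * u ^ 2 + p * (p' * (a₂ - m)) ^ 2 := by rw [hudef]; ring
    rw [e1, hu2]
    have : p' = 1 - p := by linarith
    rw [this]; ring
  have hκ2 : κ ^ 2 ≤ p * p' := by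
    rw [sq]; exact mul_le_mul hp1 hp2 hκ.le (hκ.le.trans hp1)
  have hv0 : 0 ≤ p * (a₁ - m) ^ 2 + p' * (a₂ - m) ^ 2 :=
    add_nonneg (mul_nonneg (hκ.le.trans hp1) (sq_nonneg _))
      (mul_nonneg (hκ.le.trans hp2) (sq_nonneg _))
  rw [mul_comm]
  calc _ ≤ p * p' * (p * (a₁ - m) ^ 2 + p' * (a₂ - m) ^ 2) := mul_le_mul_of_nonneg_right hκ2 hv0
    _ = _ := e

end SpinSystem

/-! ### Restricting a log-Sobolev inequality to a subset -/

namespace SpinSystem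

variable {S : Type*} [Fintype S] [DecidableEq S] {H : (S → ℤˣ) → ℝ} {A : Finset S} {r : ℝ}

/-- Flipping one spin in the boundary condition changes expectations by a bounded factor. -/
theorem cexp_flip_le (hr : ∀ σ y s, H (Function.update σ y s) ≤ H σ + r) {p : S} (hp : p ∉ A)
    {G : (S → ℤˣ) → ℝ} (hG0 : ∀ σ, 0 ≤ G σ) (hG : Inv {p} G) (ζ : S → ℤˣ) :
    cexp H A G (Function.update ζ p (-ζ p)) ≤ exp (2 * r) * cexp H A G ζ := by
  -- Flipping `p` carries one fibre to the other and leaves `G` unchanged. Numerator and partition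
  -- function each change by a factor of at most `exp r`, hence `exp (2 * r)`.
  let F : (S → ℤˣ) → (S → ℤˣ) := fun σ => Function.update σ p (-σ p)
  have hF : Function.Involutive F := by
    intro σ
    simp [F]
  have hag : ∀ σ, Agree A (F ζ) (F σ) ↔ Agree A ζ σ := by
    intro σ
    refine forall₂_congr fun x _ => ?_
    by_cases hx : x = p
    · subst hx; simp [F]
    · simp [F, Function.update_of_ne hx]
  have hsum : ∀ K : (S → ℤˣ) → ℝ, (∑ σ, if Agree A (F ζ) σ then K σ else 0)
      = ∑ σ, if Agree A ζ σ then K (F σ) else 0 := by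
    intro K
    refine (Fintype.sum_equiv hF.toPerm _ _ fun σ => ?_).symm
    exact if_congr (hag σ).symm rfl rfl
  have h1 : (∑ σ, if Agree A (F ζ) σ then exp (H σ) * G σ else 0)
      ≤ exp r * ∑ σ, if Agree A ζ σ then exp (H σ) * G σ else 0 := by
    rw [hsum, Finset.mul_sum]
    refine Finset.sum_le_sum fun σ _ => ?_
    split_ifs
    · rw [hG σ (F σ) (agree_update (Finset.mem_singleton_self p) _ _), ← mul_assoc, ← exp_add]
      refine mul_le_mul_of_nonneg_right (exp_le_exp.2 ?_) (hG0 σ)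
      linarith [hr σ p (-σ p)]
    · simp
  have h2 : partition H A ζ ≤ exp r * partition H A (F ζ) := by
    unfold partition
    rw [hsum, Finset.mul_sum]
    refine Finset.sum_le_sum fun σ _ => ?_
    split_ifs
    · rw [← exp_add]
      refine exp_le_exp.2 ?_
      have := (abs_le.1 (abs_energy_flip_le hr σ p)).1
      simp only [F]
      linarith
    · simp
  change (∑ σ, if Agree A (F ζ) σ then exp (H σ) * G σ else 0) / partition H A (F ζ) ≤ _
  have hN : 0 ≤ ∑ σ, if Agree A ζ σ then exp (H σ) * G σ else 0 :=
    Finset.sum_nonneg fun σ _ => by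
      split_ifs
      · exact mul_nonneg (exp_pos _).le (hG0 σ)
      · rfl
  rw [div_le_iff₀ (partition_pos H A _)]
  refine h1.trans ?_
  unfold cexp
  rw [mul_assoc, div_mul_eq_mul_div, two_mul, exp_add, mul_assoc]
  refine mul_le_mul_of_nonneg_left ?_ (exp_pos r).le
  rw [mul_div_assoc', le_div_iff₀ (partition_pos H A ζ)]
  calc _ ≤ _ := mul_le_mul_of_nonneg_left h2 hN
    _ = _ := by ring

/-- A logarithmic Sobolev inequality for the whole system passes to a subset whose conditional
distribution depends little on the boundary condition. -/
theorem cent_le_of_global (hr0 : 0 ≤ r) (hr : ∀ σ y s, H (Function.update σ y s) ≤ H σ + r)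
    {R : ℝ} (hR : 0 < R)
    (hcomp : ∀ G : (S → ℤˣ) → ℝ, (∀ σ, 0 ≤ G σ) → Inv Aᶜ G →
      ∀ ξ η, cexp H A G ξ ≤ R * cexp H A G η)
    {C : ℝ} (hC : 0 < C) (η : S → ℤˣ)
    (hls : ∀ f : (S → ℤˣ) → ℝ, (∀ σ, 0 ≤ f σ) → cent H Finset.univ f η ≤ C *
      (1 / 2 * ∑ y, localForm H Finset.univ (fun σ => √(f σ)) y η))
    {f : (S → ℤˣ) → ℝ} (hf : ∀ σ, 0 ≤ f σ) :
    cent H A f η ≤ R * C * R * (4 * exp r) * ∑ y ∈ A, cexp H A (cent H {y} f) η := by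
  -- Freezing the outside spins at `η` gives a test function for the global inequality that equals
  -- `f` on the fibre of `η` and depends only on `A`.
  set F : (S → ℤˣ) → ℝ := fun σ => f (A.piecewise σ η) with hFdef
  have hF0 : ∀ σ, 0 ≤ F σ := fun σ => hf _
  have hpw : ∀ σ σ', Agree Aᶜ σ σ' → A.piecewise σ' η = A.piecewise σ η := by
    intro σ σ' hσ
    funext x
    by_cases hx : x ∈ A
    · simp [hx, hσ x (by simpa using hx)]
    · simp [hx]
  have hFi : Inv Aᶜ F := fun σ σ' hσ => by simp only [hFdef]; rw [hpw σ σ' hσ]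
  have hFf : ∀ σ, Agree A η σ → f σ = F σ := by
    intro σ hσ
    simp only [hFdef]
    congr 1
    funext x
    by_cases hx : x ∈ A
    · simp [hx]
    · simp [hx, hσ x hx]
  have hle : ∀ G : (S → ℤˣ) → ℝ, (∀ σ, 0 ≤ G σ) → Inv Aᶜ G →
      cexp H A G η ≤ R * cexp H Finset.univ G η ∧ cexp H Finset.univ G η ≤ R * cexp H A G η := by
    intro G hG0 hGi
    rw [← cexp_tower H (Finset.subset_univ A) G]
    constructor
    · rw [← cexp_const_mul, ← cexp_const H Finset.univ (cexp H A G η) η]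
      exact cexp_mono H (fun ξ => hcomp G hG0 hGi η ξ) η
    · rw [← cexp_const H Finset.univ (R * cexp H A G η) η]
      exact cexp_mono H (fun ξ => hcomp G hG0 hGi ξ η) η
  have hent : cent H A F η ≤ R * cent H Finset.univ F η := by
    set t := cexp H Finset.univ F η with ht
    have ht0 : 0 ≤ t := cexp_nonneg H hF0 η
    rcases ht0.eq_or_lt with h0 | h0
    · have hz : ∀ σ, F σ = 0 := fun σ => eq_zero_of_cexp_eq_zero H hF0 h0.symm (Agree.univ _ _)
      have : F = fun _ => 0 := funext hz
      rw [this, cent_of_inv H (fun _ _ _ => rfl), cent_of_inv H (fun _ _ _ => rfl), mul_zero]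
    -- Entropy is the minimum over `t > 0` of the mean of this integrand, attained when `t` is the
    -- mean. The integrand is nonnegative, so the two measures may be compared up to the factor `R`.
    set G : (S → ℤˣ) → ℝ := fun σ => F σ * log (F σ) - (log t + 1) * F σ + t with hG
    have hge : ∀ c, 0 < c → ∀ x, 0 ≤ x → 0 ≤ x * log x - (log c + 1) * x + c := by
      intro c hc x hx
      rcases hx.eq_or_lt with h1 | h1
      · rw [← h1]; simp [hc.le]
      · have e := log_le_sub_one_of_pos (div_pos hc h1)
        rw [log_div hc.ne' h1.ne'] at e
        have e' := mul_le_mul_of_nonneg_left e h1.le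
        have : x * (c / x - 1) = c - x := by field_simp
        linarith
    have hGi : Inv Aᶜ G := hFi.comp fun s => s * log s - (log t + 1) * s + t
    have h1 := (hle G (fun σ => hge t h0 _ (hF0 σ)) hGi).1
    have e1 : ∀ B, cexp H B G η = cexp H B (fun σ => F σ * log (F σ)) η
        - (log t + 1) * cexp H B F η + t := by
      intro B
      rw [hG, cexp_add, cexp_sub, cexp_const_mul, cexp_const]
    rw [e1, e1] at h1
    have h2 : cexp H A F η * log (cexp H A F η) - (log t + 1) * cexp H A F η + t ≥ 0 :=
      hge t h0 _ (cexp_nonneg H hF0 η)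
    unfold cent
    rw [← ht] at h1 ⊢
    linarith
  set G : S → (S → ℤˣ) → ℝ :=
    fun y σ => (√(F (Function.update σ y (-σ y))) - √(F σ)) ^ 2 with hG
  have hrate : ∀ y σ, rate H y σ ≤ 1 := by
    intro y σ
    unfold rate
    rw [div_le_one (partition_pos H _ _)]
    unfold partition
    refine le_trans (le_of_eq ?_) (Finset.single_le_sum (fun ρ _ => ?_)
      (Finset.mem_univ (Function.update σ y (-σ y))))
    · rw [if_pos (agree_update (Finset.mem_singleton_self y) _ _)]
    · split_ifs
      · exact (exp_pos _).le
      · rfl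
  have hform : ∑ y, localForm H Finset.univ (fun σ => √(F σ)) y η
      ≤ ∑ y ∈ A, R * cexp H A (G y) η := by
    rw [← Finset.sum_subset (Finset.subset_univ A)]
    · refine Finset.sum_le_sum fun y hy => ?_
      refine le_trans (cexp_mono H (g := G y) (fun σ => ?_) η)
        (hle (G y) (fun σ => sq_nonneg _) ?_).2
      · exact mul_le_of_le_one_left (sq_nonneg _) (hrate y σ)
      · intro σ σ' hσ
        have h1 := hFi _ _ hσ
        have h2 : F (Function.update σ' y (-σ' y)) = F (Function.update σ y (-σ y)) := by
          refine hFi _ _ fun x hx => ?_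
          have hxA : σ' x = σ x := hσ x hx
          by_cases hxy : x = y
          · subst hxy; simp [hxA]
          · rw [Function.update_of_ne hxy, Function.update_of_ne hxy, hxA]
        simp only [hG]
        rw [h1, h2]
    · intro y _ hy
      unfold localForm
      refine Eq.trans (cexp_congr_fiber H (g := fun _ => 0) fun σ _ => ?_) (cexp_const H _ 0 η)
      beta_reduce
      rw [hFi σ _ (agree_update (Finset.mem_compl.2 hy) _ _)]
      simp
  -- Both values of the spin at `y` have conditional probability at least `1 / (2 exp r)`, so the
  -- Hellinger bound controls the distance of each square root to `√c`. This produces the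
  -- single-site entropies that `cent_step_le` needs.
  have hsingle : ∀ y ∈ A, cexp H A (G y) η ≤ 8 * exp r * cexp H A (cent H {y} f) η := by
    intro y hy
    rw [← cexp_const_mul]
    refine cexp_mono_fiber H fun σ hσ => ?_
    have hfl := agree_update (A := {y}) (Finset.mem_singleton_self y) (-σ y) σ
    simp only [hG]
    rw [← hFf σ hσ, ← hFf _ (hσ.trans (agree_update hy _ _))]
    set c := cexp H {y} f σ with hc
    have h1 := le_mul_cexp hr hr0 (Agree.refl {y} σ) (F := fun ρ => (√(f ρ) - √c) ^ 2)
      (fun _ => sq_nonneg _)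
    have h2 := le_mul_cexp hr hr0 hfl (F := fun ρ => (√(f ρ) - √c) ^ 2) (fun _ => sq_nonneg _)
    have h3 := cexp_sqrt_sub_sq_le_cent H (A := {y}) hf σ
    rw [← hc] at h3
    rw [Finset.card_singleton, pow_one] at h1 h2
    have h4 := mul_le_mul_of_nonneg_left h3 (show 0 ≤ 2 * exp r by positivity)
    nlinarith [sq_nonneg ((√(f (Function.update σ y (-σ y))) - √c) + (√(f σ) - √c))]
  rw [cent_congr_fiber H hFf]
  refine hent.trans ?_
  have h1 := (hls F hF0).trans (mul_le_mul_of_nonneg_left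
    (mul_le_mul_of_nonneg_left hform (by norm_num)) hC.le)
  have h2 : ∑ y ∈ A, R * cexp H A (G y) η
      ≤ R * (8 * exp r * ∑ y ∈ A, cexp H A (cent H {y} f) η) := by
    rw [← Finset.mul_sum, Finset.mul_sum A _ (8 * exp r)]
    exact mul_le_mul_of_nonneg_left (Finset.sum_le_sum hsingle) hR.le
  have h3 := h1.trans (mul_le_mul_of_nonneg_left (mul_le_mul_of_nonneg_left h2
    (by norm_num : (0 : ℝ) ≤ 1 / 2)) hC.le)
  have h4 := mul_le_mul_of_nonneg_left h3 hR.le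
  linarith

end SpinSystem

/-! ### A log-Sobolev inequality implies exponential entropy mixing -/

namespace IsingTree

open SpinSystem

variable {b : ℕ} {v : Vertex b} {m : ℕ} {β : ℝ} {h : ℝ} (τ : Vertex b → ℤˣ)

/-- Expectations in a subtree depend on the outside only through the parent of its root. -/
theorem cexp_below_le (hβ : 0 ≤ β) (x : Site v m) {G : Config v m → ℝ} (hG0 : ∀ σ, 0 ≤ G σ)
    (hG : Inv (below x)ᶜ G) (ξ η : Config v m) :
    cexp (energy β h τ v m) (below x) G ξ
      ≤ exp (2 * (2 * β * (b + 1 + |h|))) * cexp (energy β h τ v m) (below x) G η := by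
  set H := energy β h τ v m with hH
  set r := 2 * β * (b + 1 + |h|) with hr
  have hr0 : 0 ≤ r := by positivity
  have he : 1 ≤ exp (2 * r) := one_le_exp (by positivity)
  have hc0 : ∀ ζ, 0 ≤ cexp H (below x) G ζ := fun ζ => cexp_nonneg H hG0 ζ
  by_cases hp : ∃ (p : Site v m) (i : Fin b), (x : Vertex b) = i :: (p : Vertex b)
  · obtain ⟨p, i, hp⟩ := hp
    have hpx : p ∉ below x := by
      intro hpx
      have := (mem_below.1 hpx).length_le
      rw [hp, List.length_cons] at this
      omega
    have hu : Uncoupled H (below x) ((below x)ᶜ.erase p) := by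
      refine uncoupled_below β h τ subset_rfl
        (fun y hy => Finset.mem_compl.1 (Finset.mem_erase.1 hy).2) fun y hy j hj => ?_
      rw [hp] at hj
      injection hj with _ hj
      exact (Finset.mem_erase.1 hy).1 (Subtype.ext hj.symm)
    have hi : Inv ((below x)ᶜ.erase p ∪ below x) (cexp H (below x) G) :=
      (hu.inv_cexp (hG.mono (Finset.erase_subset _ _))).union (cexp_inv H _ _)
    -- By the Markov property only the spin at the parent `p` matters, so the two boundary
    -- conditions may be taken to differ by at most one flip.
    have hξ : cexp H (below x) G ξ = cexp H (below x) G (Function.update η p (ξ p)) := by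
      refine hi _ _ fun y hy => ?_
      have : y = p := by
        by_contra hyp
        refine hy (Finset.mem_union.2 ?_)
        by_cases hyx : y ∈ below x
        · exact Or.inr hyx
        · exact Or.inl (Finset.mem_erase.2 ⟨hyp, Finset.mem_compl.2 hyx⟩)
      subst this
      simp
    rw [hξ]
    rcases update_eq_or η p (ξ p) with e | e
    · rw [e]
      exact le_mul_of_one_le_left (hc0 η) he
    · rw [e]
      exact cexp_flip_le (energy_update τ hβ) hpx hG0
        (hG.mono (Finset.singleton_subset_iff.2 (Finset.mem_compl.2 hpx))) η
  · push Not at hp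
    have hu : Uncoupled H (below x) (below x)ᶜ :=
      uncoupled_below β h τ subset_rfl (fun y hy => Finset.mem_compl.1 hy) fun y _ j => hp y j
    have hi : Inv ((below x)ᶜ ∪ below x) (cexp H (below x) G) :=
      (hu.inv_cexp hG).union (cexp_inv H _ _)
    have : cexp H (below x) G ξ = cexp H (below x) G η := by
      refine hi _ _ fun y hy => absurd (Finset.mem_union.2 ?_) hy
      by_cases hyx : y ∈ below x
      · exact Or.inr hyx
      · exact Or.inl (Finset.mem_compl.2 hyx)
    rw [this]
    exact le_mul_of_one_le_left (hc0 η) he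

/-- The sum of the weights `M ^ depth` over the neighbours of a site. -/
theorem sum_neighbour_weight_le {M : ℝ} (hM : 1 ≤ M) (x z : Site v m) (hz : z ∈ below x) :
    (∑ y ∈ below x, if Adjacent (z : Vertex b) (y : Vertex b) then
      M ^ ((y : Vertex b).length - (x : Vertex b).length) else 0)
      ≤ (b * M + 1) * M ^ ((z : Vertex b).length - (x : Vertex b).length) := by
  have hM0 : 0 ≤ M := zero_le_one.trans hM
  set L := (x : Vertex b).length with hL
  have hzL := (mem_below.1 hz).length_le
  -- A neighbour is one of the `b` children, whose weight is larger by a factor `M`, or the parent,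
  -- whose weight is no larger.
  have hpt : ∀ y ∈ below x, (if Adjacent (z : Vertex b) (y : Vertex b) then
      M ^ ((y : Vertex b).length - L) else 0)
      ≤ (∑ i : Fin b, if (y : Vertex b) = i :: (z : Vertex b) then
          M * M ^ ((z : Vertex b).length - L) else 0)
        + if (y : Vertex b) = (z : Vertex b).tail then M ^ ((z : Vertex b).length - L) else 0 := by
    intro y hy
    have hs0 : 0 ≤ ∑ i : Fin b, if (y : Vertex b) = i :: (z : Vertex b) then
        M * M ^ ((z : Vertex b).length - L) else 0 :=
      Finset.sum_nonneg fun i _ => by split_ifs <;> positivity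
    have ht0 : 0 ≤ if (y : Vertex b) = (z : Vertex b).tail then
        M ^ ((z : Vertex b).length - L) else 0 := by split_ifs <;> positivity
    by_cases ha : Adjacent (z : Vertex b) (y : Vertex b)
    · rw [if_pos ha]
      rcases ha with ⟨i, hi⟩ | ⟨i, hi⟩
      · refine le_trans ?_ (le_add_of_nonneg_right ht0)
        refine le_trans (le_of_eq ?_) (Finset.single_le_sum
          (fun i _ => by split_ifs <;> positivity) (Finset.mem_univ i))
        rw [if_pos hi, hi, List.length_cons, Nat.sub_add_comm hzL, pow_succ']
      · refine le_trans ?_ (le_add_of_nonneg_left hs0)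
        rw [if_pos (by rw [hi, List.tail_cons]), hi, List.length_cons]
        exact pow_le_pow_right₀ hM (by omega)
    · rw [if_neg ha]
      exact add_nonneg hs0 ht0
  have hone : ∀ (u : Vertex b) (t : ℝ), 0 ≤ t →
      (∑ y ∈ below x, if (y : Vertex b) = u then t else 0) ≤ t := by
    intro u t ht
    by_cases hu : ∃ y ∈ below x, (y : Vertex b) = u
    · obtain ⟨y, hy, rfl⟩ := hu
      rw [Finset.sum_eq_single_of_mem y hy fun y' _ hne =>
        if_neg fun e => hne (Subtype.ext e), if_pos rfl]
    · push Not at hu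
      rw [Finset.sum_eq_zero fun y hy => if_neg (hu y hy)]
      exact ht
  refine (Finset.sum_le_sum hpt).trans ?_
  rw [Finset.sum_add_distrib, Finset.sum_comm, add_mul, one_mul]
  refine add_le_add ?_ (hone _ _ (by positivity))
  refine (Finset.sum_le_sum fun i _ => hone _ _ (by positivity)).trans (le_of_eq ?_)
  rw [Finset.sum_const, Finset.card_univ, Fintype.card_fin, nsmul_eq_mul, mul_assoc]

/-- Since `k ρ = ℓ / K`, both `k ρ` and `(1 + ρ K) ^ k` are at most `exp ℓ`. Dividing by `exp 3 ^ ℓ`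
leaves `exp (-ℓ)` before squaring. -/
theorem decay_bound {K C ρ : ℝ} {k ℓ : ℕ} (hK1 : 1 ≤ K) (hC1 : 1 ≤ C) (hρ0 : 0 ≤ ρ) (hρC : ρ ≤ C)
    (hkρ : (k : ℝ) * ρ = ℓ / K) :
    (1 - ρ / C) ^ k + (k * ρ * (1 + ρ * K) ^ k / exp 3 ^ ℓ) ^ 2
      ≤ exp (-(1 / (K * C)) * ℓ) + exp (-(1 / (K * C)) * ℓ) := by
  have hK0 : 0 < K := by linarith
  have hC0 : 0 < C := by linarith
  have hd1 : (1 - ρ / C) ^ k ≤ exp (-(1 / (K * C)) * ℓ) := by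
    have h1 : 0 ≤ 1 - ρ / C := by rw [sub_nonneg, div_le_one hC0]; exact hρC
    have h2 : 1 - ρ / C ≤ exp (-(ρ / C)) := by
      have := add_one_le_exp (-(ρ / C)); linarith
    refine (pow_le_pow_left₀ h1 h2 k).trans (le_of_eq ?_)
    rw [← exp_nat_mul]
    congr 1
    have : (k : ℝ) * -(ρ / C) = -((k * ρ) / C) := by ring
    rw [this, hkρ]
    field_simp
  have hd2 : (k * ρ * (1 + ρ * K) ^ k / exp 3 ^ ℓ) ^ 2 ≤ exp (-(1 / (K * C)) * ℓ) := by
    have hℓ0 : (0 : ℝ) ≤ ℓ := Nat.cast_nonneg ℓ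
    have h1 : (k : ℝ) * ρ ≤ exp ℓ := by
      rw [hkρ]
      refine (div_le_self hℓ0 hK1).trans ?_
      have := add_one_le_exp (ℓ : ℝ); linarith
    have h2 : (1 + ρ * K) ^ k ≤ exp ℓ := by
      have h3 : 1 + ρ * K ≤ exp (ρ * K) := by
        have := add_one_le_exp (ρ * K); linarith
      refine (pow_le_pow_left₀ (by positivity) h3 k).trans (le_of_eq ?_)
      rw [← exp_nat_mul, ← mul_assoc, hkρ, div_mul_cancel₀ _ hK0.ne']
    have h3 : k * ρ * (1 + ρ * K) ^ k / exp 3 ^ ℓ ≤ exp (-ℓ) := by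
      rw [div_le_iff₀ (by positivity), ← exp_nat_mul, ← exp_add]
      refine (mul_le_mul h1 h2 (by positivity) (exp_pos _).le).trans ?_
      rw [← exp_add]
      exact exp_le_exp.2 (by linarith)
    refine (pow_le_pow_left₀ (by positivity) h3 2).trans ?_
    rw [← exp_nat_mul]
    refine exp_le_exp.2 ?_
    have h4 : 1 / (K * C) ≤ 1 := by
      rw [div_le_one (by positivity)]
      exact one_le_mul_of_one_le_of_one_le hK1 hC1
    have h5 := mul_le_mul_of_nonneg_right h4 hℓ0
    push_cast
    linarith
  exact add_le_add hd1 hd2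

/-- A logarithmic Sobolev inequality implies exponential entropy mixing. -/
theorem exists_entropyMixing (b : ℕ) {β : ℝ} (hβ : 0 ≤ β) (h : ℝ) {C : ℝ} (hC : 0 < C) :
    ∃ c θ : ℝ, 0 < c ∧ 0 < θ ∧ ∀ (τ : Vertex b → ℤˣ) (v : Vertex b) (m : ℕ),
      1 / C ≤ logSobolev β h τ v m →
      ∀ ℓ : ℕ, EntropyMixing β h τ v m ℓ (c * exp (-θ * (ℓ : ℝ))) := by
  set r := 2 * β * (b + 1 + |h|) with hr
  have hr0 : 0 ≤ r := by positivity
  set R := exp (2 * r) with hR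
  have hR0 : 0 < R := exp_pos _
  -- The summand `1` ensures `1 ≤ C'`, hence `ρ ≤ C'` below.
  set C' := R * C * R * (4 * exp r) + 1 with hC'
  have hCpos : 0 < R * C * R * (4 * exp r) := by positivity
  have hC'1 : 1 ≤ C' := by linarith
  set M := exp 3 with hM
  have hM1 : 1 ≤ M := one_le_exp (by norm_num)
  set K := b * M + 1 with hK
  have hK1 : 1 ≤ K := by
    have : (0 : ℝ) ≤ b * M := by positivity
    linarith
  have hK0 : 0 < K := by linarith
  have hC'0 : 0 < C' := by linarith
  set κ := 1 / (2 * exp r) with hκ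
  have hκ0 : 0 < κ := by positivity
  refine ⟨16 / κ ^ 2, 1 / (K * C'), by positivity, by positivity, fun τ v m hls ℓ => ?_⟩
  rw [entropyMixing_iff]
  intro x η f hf hfB
  set H := energy β h τ v m with hH
  set A := below x with hA
  have hupd : ∀ σ y s, H (Function.update σ y s) ≤ H σ + r := energy_update τ hβ
  have hglob : ∀ f : Config v m → ℝ, (∀ σ, 0 ≤ f σ) → cent H Finset.univ f η ≤ C *
      (1 / 2 * ∑ y, localForm H Finset.univ (fun σ => √(f σ)) y η) := by
    intro f hf
    have := entropy_le_of_logSobolev τ hC hls hf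
    rwa [entropy_eq _ _ _ _ η, dirichlet_eq τ _ η] at this
  have hlocal : ∀ f : Config v m → ℝ, (∀ σ, 0 ≤ f σ) →
      cent H A f η ≤ C' * ∑ y ∈ A, cexp H A (cent H {y} f) η := by
    intro f hf
    refine (cent_le_of_global hr0 hupd hR0
      (fun G hG0 hG ξ η => cexp_below_le τ hβ x hG0 hG ξ η) hC η hglob hf).trans
      (mul_le_mul_of_nonneg_right (by linarith) ?_)
    exact Finset.sum_nonneg fun y _ => cexp_nonneg H (fun σ => cent_nonneg H hf σ) η
  rcases (cexp_nonneg H (A := A) hf η).eq_or_lt with h0 | h0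
  · have hz : ∀ σ, Agree A η σ → f σ = 0 := fun σ hσ => eq_zero_of_cexp_eq_zero H hf h0.symm hσ
    have hz' : ∀ σ, Agree A η σ → cexp H (A.erase x) f σ = 0 := by
      intro σ hσ
      refine (cexp_congr_fiber H (g := fun _ => 0) fun ρ hρ => ?_).trans (cexp_const H _ 0 σ)
      exact hz ρ (hσ.trans (hρ.mono (Finset.erase_subset _ _)))
    rw [cent_congr_fiber H hz', cent_congr_fiber H hz, cent_of_inv H fun _ _ _ => rfl, mul_zero]
  have hn : (0 : ℝ) < A.card := by
    exact_mod_cast Finset.card_pos.2 ⟨x, self_mem_below x⟩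
  set ρ := 1 / (A.card * K) with hρ
  have hρ0 : 0 ≤ ρ := by positivity
  have hρA : ρ * A.card ≤ 1 := by
    have : ρ * A.card = 1 / K := by rw [hρ]; field_simp
    rw [this, div_le_one hK0]; exact hK1
  have hn1 : (1 : ℝ) ≤ A.card := by
    exact_mod_cast Finset.card_pos.2 ⟨x, self_mem_below x⟩
  have hρC : ρ ≤ C' := by
    have : ρ ≤ ρ * A.card := le_mul_of_one_le_right hρ0 hn1
    linarith
  -- The elapsed time `k ρ = ℓ / K` does not depend on the size of the subtree. It is long enough
  -- for the entropy to decay exponentially in `ℓ`, and short enough that little influence crosses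
  -- the block.
  set k := A.card * ℓ with hk
  have hkρ : (k : ℝ) * ρ = ℓ / K := by
    rw [hk, hρ]; push_cast; field_simp
  have hAdj : ∀ z y : Site v m, z ≠ y → ¬ Adjacent (z : Vertex b) (y : Vertex b) →
      Uncoupled H {z} {y} := by
    intro z y hzy ha
    refine uncoupled_of_not_adjacent β h τ (Finset.disjoint_singleton.2 hzy) ?_
    intro z' hz' y' hy'
    rw [Finset.mem_singleton.1 hz', Finset.mem_singleton.1 hy']
    exact ha
  classical
  have hosc : OscBound A (fun σ : Config v m => if σ x = 1 then (1 : ℝ) else 0)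
      (fun y => if y = x then 1 else 0) := by
    intro σ y _
    beta_reduce
    by_cases hyx : y = x
    · rw [if_pos hyx]
      split_ifs <;> norm_num
    · rw [if_neg hyx, Function.update_of_ne (Ne.symm hyx), sub_self, abs_zero]
  have hcov := sq_cexp_sub_mul_le (H := H) (A := A) (ρ := ρ)
    (Adj := fun z y : Site v m => Adjacent (z : Vertex b) (y : Vertex b)) hAdj hρ0 hρA
    (wt := fun y => M ^ ((y : Vertex b).length - (x : Vertex b).length)) (K := K) hK0.le
    (fun y _ => by positivity)
    (fun z hz => by
      refine le_trans (le_of_eq ?_) (sum_neighbour_weight_le hM1 x z hz)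
      exact Finset.sum_congr rfl fun y _ => if_congr Iff.rfl rfl rfl)
    hC'0 hρC hlocal (φ := fun σ => if σ x = 1 then 1 else 0)
    (fun σ => by split_ifs <;> norm_num) hosc
    (by
      rw [Finset.sum_eq_single_of_mem x (self_mem_below x)
        fun y _ hyx => by rw [if_neg hyx, mul_zero]]
      simp)
    (B := top x ℓ) (ω := M ^ ℓ) (by positivity)
    (fun y hy hyB => by
      refine pow_le_pow_right₀ hM1 ?_
      have h1 := mem_below.1 hy
      have h2 := h1.length_le
      have h3 : ¬ (y : Vertex b).length < (x : Vertex b).length + ℓ :=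
        fun h3 => hyB (mem_top.2 ⟨h1, h3⟩)
      omega) hf hfB k
  have hprob : ∀ s, κ ≤ prob H A x s η := by
    intro s
    -- The bound holds for the spin at `x` given all the others; averaging over the rest of the
    -- subtree preserves it.
    have h1 : ∀ σ, κ ≤ prob H {x} x s σ := by
      intro σ
      have := le_mul_cexp hupd hr0 (agree_update (Finset.mem_singleton_self x) s σ)
        (F := fun σ => if σ x = s then 1 else 0) (fun σ => by split_ifs <;> norm_num)
      rw [Finset.card_singleton, pow_one] at this
      rw [Function.update_self, if_pos rfl] at this
      rw [hκ, div_le_iff₀' (by positivity)]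
      exact this
    unfold prob at h1 ⊢
    rw [← cexp_tower H (Finset.singleton_subset_iff.2 (self_mem_below x)),
      ← cexp_const H A κ η]
    exact cexp_mono H h1 η
  have hmain := cent_cexp_erase_le_covariance (x := x) hf h0 hκ0 hprob
  have hent0 := cent_nonneg H (A := A) hf η
  refine hmain.trans ?_
  rw [div_le_iff₀ (by positivity)]
  have h1 := mul_le_mul_of_nonneg_left (decay_bound hK1 hC'1 hρ0 hρC hkρ)
    (show 0 ≤ 8 * cexp H A f η * cent H A f η by positivity)
  refine (hcov.trans h1).trans (le_of_eq ?_)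
  field_simp
  ring

end IsingTree

end

theorem theoremt (b : ℕ) (hb : 2 ≤ b) (β h : ℝ) (hβ : 0 ≤ β) :
    -- entropy mixing at one block height implies the block entropy inequality
    (∀ (τ : IsingTree.Vertex b → ℤˣ) (v : IsingTree.Vertex b) (m ℓ : ℕ) (δ : ℝ), 0 < δ → δ ≤ 1 →
      IsingTree.EntropyMixing β h τ v m ℓ
        (((1 - δ) * IsingTree.pMin β h τ v m / ((ℓ : ℝ) + 1 - δ)) ^ 2) →
      ∀ f : IsingTree.Config v m → ℝ, (∀ σ, 0 ≤ f σ) →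
        IsingTree.entropy β h τ f ≤ 2 / δ * IsingTree.blockEntropyForm β h τ ℓ f) ∧
    -- hence a lower bound on the log-Sobolev constant, uniform in the tree and in `τ`
    (∀ (ℓ : ℕ) (δ : ℝ), 0 < δ → δ ≤ 1 → ∃ C : ℝ, 0 < C ∧
      ∀ (τ : IsingTree.Vertex b → ℤˣ) (v : IsingTree.Vertex b) (m : ℕ),
        IsingTree.EntropyMixing β h τ v m ℓ
          (((1 - δ) * IsingTree.pMin β h τ v m / ((ℓ : ℝ) + 1 - δ)) ^ 2) →
        1 / C ≤ IsingTree.logSobolev β h τ v m) ∧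
    -- conversely, a lower bound on the log-Sobolev constant implies exponential entropy mixing
    (∀ C : ℝ, 0 < C → ∃ c θ : ℝ, 0 < c ∧ 0 < θ ∧
      ∀ (τ : IsingTree.Vertex b → ℤˣ) (v : IsingTree.Vertex b) (m : ℕ),
        1 / C ≤ IsingTree.logSobolev β h τ v m →
        ∀ ℓ : ℕ, IsingTree.EntropyMixing β h τ v m ℓ (c * Real.exp (-θ * (ℓ : ℝ)))) := by
  refine ⟨fun τ v m ℓ δ hδ hδ1 hmix f hf =>
    IsingTree.entropy_le_blockEntropyForm β h τ hδ hδ1 hmix hf, fun ℓ δ hδ hδ1 => ?_,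
    fun C hC => IsingTree.exists_entropyMixing b hβ h hC⟩
  obtain ⟨C, hC, hls⟩ := IsingTree.exists_le_logSobolev b hβ h ℓ (K := 2 / δ) (by positivity)
  exact ⟨C, hC, fun τ v m hmix => hls τ v m fun f hf =>
    IsingTree.entropy_le_blockEntropyForm β h τ hδ hδ1 hmix hf⟩
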